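/- **Setting.** Let $P_X$ be a probability law on $\mathbb C$ with $\mathrm E|x|^2=1$, let $snr>0$, and consider $\mathbf y=\mathbf A\mathbf x+\mathbf n$ with $\mathbf A\in\mathbb C^{M\times N}$ right-unitarily invariant, $\mathbf n\sim\mathcal{CN}(\mathbf 0,snr^{-1}\mathbf I)$, and $\mathbf x,\mathbf A,\mathbf n$ independent. Let $M,N\to\infty$ with $N/M\to\beta\in(0,\infty)$, and let the empirical eigenvalue distribution of $\mathbf R=\mathbf A^{\rm H}\mathbf A$ converge weakly in probability to a law $\mu$ on $[0,\infty)$ with mean $1$. Logarithms are natural, and $z,\mathbf z$ denote standard complex Gaussian noise. Put $$\hat\gamma_{\rm SE}(v)=\int (snr\,\lambda+v^{-1})^{-1}d\mu(\lambda),\qquad \eta_{\rm SE}(v)=v^{-1}-[\hat\gamma_{\rm SE}^{-1}(v)]^{-1},\qquad \hat\phi^{\mathcal S}_{\rm SE}(\rho)=\mathrm E\big|x-\mathrm E[x\mid\sqrt\rho x+z]\big|^2\quad(x\sim P_X),$$ let $\eta_{\rm SE}^{-1}(\rho)=\inf\{v:\eta_{\rm SE}(v)\le\rho\}$ be the inverse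 of the decreasing function $\eta_{\rm SE}$ (it is $+\infty$ below the range of $\eta_{\rm SE}$, and $0$ for $\rho\ge snr$), and let $\hat\phi^*_{\rm SE}=\min\{\eta_{\rm SE}^{-1},\hat\phi^{\mathcal S}_{\rm SE}\}$. The replica constrained capacity is $$C^{\rm Rep}_{\rm LUIS}(snr)=\int_0^{v^*snr}\mathcal R_{\mathbf R}(-z)\,dz+I(x;\sqrt{\rho^*}x+z)-\rho^*v^*,$$ where $\mathcal R_{\mathbf R}$ is the R-transform of $\mu$ and $\rho^*>0$ is the unique solution of $\rho^*=snr\,\mathcal R_{\mathbf R}(-snr\,v^*)$, $v^*=\hat\phi^{\mathcal S}_{\rm SE}(\rho^*)$. A code of length $N$ is a random vector $\mathbf x\in\mathbb C^N$ whose entries all have law $P_X$ (for instance, uniform on a finite codebook). A code family $\mathcal C$ (one code for each system size) has the transfer function $\hat\phi^{\mathcal C}_{\rm SE}(\rho)=\lim\frac1N\mathrm E\|\mathbf x-\mathrm E[\mathbf x\mid\sqrt\rho\mathbf x+\mathbf z]\|^2$, $\rho\ge0$, the limit being assumed to exist, and OAMP with this code has the rate $R_{\rm OAMP}=\int_0^\infty\hat\phi^{\mathcal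 C}_{\rm SE}(\rho)\,d\rho$. OAMP alternates between the linear MMSE estimator for $\mathbf y=\mathbf A\mathbf x+\mathbf n$ and the a-posteriori-probability decoder of the code, each followed by Gram–Schmidt orthogonalization of its output error with respect to its input error. The message to the decoder is scaled to have the form $\mathbf x+\boldsymbol\xi$ with $\mathrm E\{\mathbf x^{\rm H}\boldsymbol\xi\}=0$, the message to the linear estimator is scaled to have least mean squared error, and the first message to the linear estimator is $\mathbf 0$. **Theorem 2 (capacity optimality).** Assume the following. 1. There is exactly one $\rho>0$ with $\hat\phi^{\mathcal S}_{\rm SE}(\rho)=\eta^{-1}_{\rm SE}(\rho)$, that is, such that $v=\hat\phi^{\mathcal S}_{\rm SE}(\rho)$ is in the domain of $\eta_{\rm SE}$ and $\eta_{\rm SE}(v)=\rho$. 2. $\mathcal C_1,\mathcal C_2,\dots$ are code families for which state evolution is correct: for each $k$ and each iteration $t$, as $N\to\infty$, the inverse $\rho_t$ of the per-symbol mean squared error of the message to the decoder tends to $\bar\rho_t$, and the per-symbol mean squared error of the decoder's estimate tends to $\hat\phi^{\mathcal C_k}_{\rm SE}(\bar\rho_t)$. Here $\bar v_0=1$, $\bar\rho_t=[\hat\gamma_{\rm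 SE}(\bar v_t)]^{-1}-\bar v_t^{-1}$ (with value $snr$ if $\bar v_t=0$), and $\bar v_{t+1}=\big([\hat\phi^{\mathcal C_k}_{\rm SE}(\bar\rho_t)]^{-1}-\bar\rho_t\big)^{-1}$ (with value $0$ if $\hat\phi^{\mathcal C_k}_{\rm SE}(\bar\rho_t)=0$). 3. For each $k$, $\hat\phi^{\mathcal C_k}_{\rm SE}\le\hat\phi^*_{\rm SE}$ on $[0,snr]$, with strict inequality on $(0,snr)$; and $\hat\phi^{\mathcal C_k}_{\rm SE}(\rho)\to\hat\phi^*_{\rm SE}(\rho)$ as $k\to\infty$ for each $\rho\in[0,snr]$. Then $\rho^*$ exists and is unique, each $\hat\phi^{\mathcal C_k}_{\rm SE}$ is integrable on $(0,\infty)$, and the achievable rate of OAMP tends to the replica constrained capacity: $$R_{\rm OAMP}(\mathcal C_k)=\int_0^\infty\hat\phi^{\mathcal C_k}_{\rm SE}(\rho)\,d\rho\;\longrightarrow\; C^{\rm Rep}_{\rm LUIS}(snr)\qquad(k\to\infty).$$ Moreover, if the codes of $\mathcal C_k$ are uniform on finite codebooks, their code rates $\frac1N\log|\mathcal C_{k,N}|$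 tend to $R_{\rm OAMP}(\mathcal C_k)$ as $N\to\infty$. OAMP with $\mathcal C_k$ is error-free: for each $\varepsilon>0$ there is $T$ such that for each $t\ge T$ the per-symbol mean squared error of the decoder's estimate in iteration $t$ is below $\varepsilon$ for all large $N$. The last claim holds provided that, if $\hat\phi^{\mathcal C_k}_{\rm SE}$ has jumps, its left limits too are below $\eta^{-1}_{\rm SE}$ on $(0,snr)$, in the sense that for each $\rho\in(0,snr)$ some $r\in(0,\rho)$ has $\hat\phi^{\mathcal C_k}_{\rm SE}(r)<\eta_{\rm SE}^{-1}(\rho)$. -/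

import Mathlib

open MeasureTheory ProbabilityTheory Filter Topology Set

noncomputable section

namespace OAMP

/-! ### Gaussian noise -/

/-- The circularly symmetric complex Gaussian law `CN(0, v)`: independent real and imaginary
parts, each with variance `v / 2`. -/
def cgauss (v : NNReal) : Measure ℂ :=
  ((gaussianReal 0 (v / 2)).prod (gaussianReal 0 (v / 2))).map fun p => (⟨p.1, p.2⟩ : ℂ)

/-- The law `CN(0, v I_n)` on `ℂⁿ`. -/
def cgaussVec (n : ℕ) (v : NNReal) : Measure (Fin n → ℂ) :=
  Measure.pi fun _ => cgauss v

/-! ### Scalar channel: MMSE and mutual information -/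

/-- The joint law of `(x, z)` with `x ∼ PX` and `z ∼ CN(0, 1)` independent. -/
def scalarLaw (PX : Measure ℂ) : Measure (ℂ × ℂ) := PX.prod (cgauss 1)

/-- The output `√ρ x + z` of the scalar channel. -/
def scalarOut (ρ : ℝ) (p : ℂ × ℂ) : ℂ := (Real.sqrt ρ : ℂ) * p.1 + p.2

/-- The per-symbol MMSE of the constellation constraint,
`mmse{x | √ρ x + z, x ∼ PX} = E |x - E[x | √ρ x + z]|²`. -/
def phiS (PX : Measure ℂ) (ρ : ℝ) : ℝ :=
  ∫ p, ‖p.1 - ((scalarLaw PX)[fun q : ℂ × ℂ => q.1 |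
    MeasurableSpace.comap (scalarOut ρ) inferInstance]) p‖ ^ 2 ∂(scalarLaw PX)

/-- The mutual information `I(x; √ρ x + z)` in nats: the Kullback-Leibler divergence of the joint
law from the product of the marginal laws. -/
def mutualInfo (PX : Measure ℂ) (ρ : ℝ) : ℝ :=
  (InformationTheory.klDiv
    ((scalarLaw PX).map fun p => (p.1, scalarOut ρ p))
    (PX.prod ((scalarLaw PX).map (scalarOut ρ)))).toReal

/-! ### Code constraint -/

/-- A code constraint of length `n`: a random codeword `x ∼ P` in `ℂⁿ`, all of whose entries have
the law `PX`.  A codebook with equiprobable codewords is `P = uniformOn C`; IID entries, and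
infinite codebooks, are allowed. -/
structure IsCode (PX : Measure ℂ) {n : ℕ} (P : Measure (Fin n → ℂ)) : Prop where
  prob : IsProbabilityMeasure P
  marginal : ∀ i, P.map (fun x => x i) = PX

/-- The normalized MMSE `(1/n) E ‖x - E[x | √ρ x + z]‖²` of a code constraint of length `n`,
with `z ∼ CN(0, I)`. -/
def codeMmse {n : ℕ} (P : Measure (Fin n → ℂ)) (ρ : ℝ) : ℝ :=
  (1 / (n : ℝ)) * ∑ i, ∫ p, ‖p.1 i -
    ((P.prod (cgaussVec n 1))[fun q : (Fin n → ℂ) × (Fin n → ℂ) => q.1 i |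
      MeasurableSpace.comap (fun q : (Fin n → ℂ) × (Fin n → ℂ) =>
        (Real.sqrt ρ : ℂ) • q.1 + q.2) inferInstance]) p‖ ^ 2 ∂(P.prod (cgaussVec n 1))

/-! ### Large unitarily invariant systems -/

/-- A sequence of right-unitarily invariant systems: the `j`-th sensing matrix has size
`M j × N j` and law `A j`; `M j, N j → ∞` with `N j / M j → β`; the law is invariant under right
multiplication by unitary matrices; the empirical eigenvalue distribution of `Aᴴ A` converges
weakly in probability to `μ`, and the limit is normalized to mean one. -/
structure IsLUIS (N M : ℕ → ℕ) (A : ∀ j, Measure (Fin (M j) → Fin (N j) → ℂ)) (β : ℝ)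
    (μ : Measure ℝ) : Prop where
  prob : ∀ j, IsProbabilityMeasure (A j)
  tendsto_N : Tendsto N atTop atTop
  tendsto_M : Tendsto M atTop atTop
  ratio_pos : 0 < β
  tendsto_ratio : Tendsto (fun j => (N j : ℝ) / (M j : ℝ)) atTop (𝓝 β)
  invariant : ∀ j, ∀ V ∈ Matrix.unitaryGroup (Fin (N j)) ℂ,
    (A j).map (fun a i l => (Matrix.of a * V) i l) = A j
  spectrum_prob : IsProbabilityMeasure μ
  spectrum_nonneg : ∀ᵐ l ∂μ, 0 ≤ l
  spectrum_mean : ∫ l, l ∂μ = 1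
  spectrum : ∀ f : BoundedContinuousFunction ℝ ℝ, ∀ ε > 0,
    Tendsto (fun j => A j {a | ε ≤ |(1 / (N j : ℝ)) * ∑ i,
      f ((Matrix.isHermitian_conjTranspose_mul_self (Matrix.of a)).eigenvalues i)
        - ∫ l, f l ∂μ|}) atTop (𝓝 0)

/-! ### Transfer functions; `μ` is the asymptotic eigenvalue distribution of `Aᴴ A` -/

/-- `γ̂_SE(v)`, the limit of `(1/N) tr (snr Aᴴ A + v⁻¹ I)⁻¹`. -/
def gammaHat (μ : Measure ℝ) (snr v : ℝ) : ℝ := ∫ l, (snr * l + v⁻¹)⁻¹ ∂μ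

/-- The range of `γ̂_SE` on `(0, ∞)`, which is the domain of its inverse. -/
def gammaRange (μ : Measure ℝ) (snr : ℝ) : Set ℝ := gammaHat μ snr '' Ioi 0

/-- The inverse of `γ̂_SE` on `(0, ∞)`. -/
def gammaHatInv (μ : Measure ℝ) (snr v : ℝ) : ℝ :=
  Function.invFunOn (gammaHat μ snr) (Ioi 0) v

/-- `η_SE(v) = v⁻¹ - (γ̂_SE⁻¹(v))⁻¹`, for `v` in the range of `γ̂_SE`. -/
def etaSE (μ : Measure ℝ) (snr v : ℝ) : ℝ := v⁻¹ - (gammaHatInv μ snr v)⁻¹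

/-- The inverse of the decreasing function `η_SE`, extended to all `ρ`: it is `⊤` for `ρ` below
the range of `η_SE`, and `0` for `ρ ≥ snr = η_SE(0)`. -/
def etaInv (μ : Measure ℝ) (snr ρ : ℝ) : ENNReal :=
  ⨅ (v : ℝ) (_ : v ∈ gammaRange μ snr ∧ etaSE μ snr v ≤ ρ), ENNReal.ofReal v

/-- `φ̂*_SE = min {η_SE⁻¹, φ̂^S_SE}`. -/
def phiStar (PX : Measure ℂ) (μ : Measure ℝ) (snr ρ : ℝ) : ℝ :=
  (min (etaInv μ snr ρ) (ENNReal.ofReal (phiS PX ρ))).toReal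

/-- `ρ > 0` is a fixed point: with `v = φ̂^S_SE(ρ)`, also `v = η_SE⁻¹(ρ)`, that is, `v` is in the
domain of `η_SE` and `η_SE(v) = ρ`. -/
def IsFixedPoint (PX : Measure ℂ) (μ : Measure ℝ) (snr ρ : ℝ) : Prop :=
  0 < ρ ∧ phiS PX ρ ∈ gammaRange μ snr ∧ etaSE μ snr (phiS PX ρ) = ρ

/-! ### Replica constrained capacity -/

/-- The Stieltjes transform `S(z) = ∫ (l - z)⁻¹ dμ(l)`. -/
def stieltjes (μ : Measure ℝ) (z : ℝ) : ℝ := ∫ l, (l - z)⁻¹ ∂μ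

/-- The R-transform `R(ω) = S⁻¹(-ω) - 1/ω`, for `-ω` in the range of `S` on the negative
half-line. -/
def rTransform (μ : Measure ℝ) (ω : ℝ) : ℝ :=
  Function.invFunOn (stieltjes μ) (Iio 0) (-ω) - ω⁻¹

/-- `ρ > 0` solves the replica equation `ρ = snr R(-snr v)` with `v = mmse{x | √ρ x + z}`
(the R-transform being defined at `-snr v`). -/
def IsReplicaSolution (PX : Measure ℂ) (μ : Measure ℝ) (snr ρ : ℝ) : Prop :=
  0 < ρ ∧ snr * phiS PX ρ ∈ stieltjes μ '' Iio 0 ∧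
    ρ = snr * rTransform μ (-(snr * phiS PX ρ))

/-- The solution `ρ*` of the replica equation (meaningful when it is unique). -/
def replicaRho (PX : Measure ℂ) (μ : Measure ℝ) (snr : ℝ) : ℝ :=
  Classical.epsilon (IsReplicaSolution PX μ snr)

/-- The replica constrained capacity
`∫_0^{v* snr} R(-z) dz + I(x; √ρ* x + z) - ρ* v*`, in nats. -/
def replicaCapacity (PX : Measure ℂ) (μ : Measure ℝ) (snr : ℝ) : ℝ :=
  let ρ := replicaRho PX μ snr
  let v := phiS PX ρ
  (∫ z in (0 : ℝ)..(v * snr), rTransform μ (-z)) + mutualInfo PX ρ - ρ * v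

/-! ### The OAMP receiver with a-posteriori-probability decoding -/

section Algorithm

/-- Outcomes `(x, A, n)`: transmitted codeword, sensing matrix, noise. -/
abbrev Sample (n m : ℕ) := (Fin n → ℂ) × (Fin m → Fin n → ℂ) × (Fin m → ℂ)

/-- The law of `(x, A, n)`: independent, with `x ∼ P`, `A ∼ α` and `n ∼ CN(0, σ² I)`,
`σ² = snr⁻¹`. -/
def sysLaw {n m : ℕ} (P : Measure (Fin n → ℂ)) (α : Measure (Fin m → Fin n → ℂ)) (snr : ℝ) :
    Measure (Sample n m) :=
  P.prod (α.prod (cgaussVec m (Real.toNNReal snr⁻¹)))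

/-- The codeword `x` as a random vector. -/
def codeword {n m : ℕ} (ω : Sample n m) : Fin n → ℂ := ω.1

/-- The sensing matrix `A`. -/
def sensing {n m : ℕ} (ω : Sample n m) : Matrix (Fin m) (Fin n) ℂ := Matrix.of ω.2.1

/-- The observation `y = A x + n`. -/
def observation {n m : ℕ} (ω : Sample n m) : Fin m → ℂ :=
  (sensing ω).mulVec (codeword ω) + ω.2.2

/-- `E{uᴴ w}`. -/
def corr {n m : ℕ} (Q : Measure (Sample n m)) (u w : Sample n m → Fin n → ℂ) : ℂ :=
  ∫ ω, star (u ω) ⬝ᵥ w ω ∂Q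

/-- `E{‖u‖²}`. -/
def power {n m : ℕ} (Q : Measure (Sample n m)) (u : Sample n m → Fin n → ℂ) : ℝ :=
  ∫ ω, ∑ i, ‖u ω i‖ ^ 2 ∂Q

/-- The mean squared error `(1/n) E{‖u - x‖²}`. -/
def mse {n m : ℕ} (Q : Measure (Sample n m)) (u : Sample n m → Fin n → ℂ) : ℝ :=
  (1 / (n : ℝ)) * power Q (u - codeword)

/-- The Gram-Schmidt coefficient `α` of `u = α x + ξ`, with `E{xᴴ ξ} = 0`. -/
def gsScale {n m : ℕ} (Q : Measure (Sample n m)) (u : Sample n m → Fin n → ℂ) : ℂ :=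
  corr Q codeword u / power Q codeword

/-- The Gram-Schmidt error `ξ` of `u = α x + ξ`. -/
def gsError {n m : ℕ} (Q : Measure (Sample n m)) (u : Sample n m → Fin n → ℂ) :
    Sample n m → Fin n → ℂ :=
  u - gsScale Q u • codeword

/-- Gram-Schmidt orthogonalization of the estimate `f` with respect to the input message `u`:
`f - B u` with `B = E{ξᴴ f} / E{‖ξ‖²}`. -/
def gso {n m : ℕ} (Q : Measure (Sample n m)) (u f : Sample n m → Fin n → ℂ) :
    Sample n m → Fin n → ℂ :=
  f - (corr Q (gsError Q u) f / power Q (gsError Q u)) • u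

/-- The prototype linear estimator `γ̂`: the posterior mean of `x` given `y = A x + n` when
`x ∼ CN(s, v I)` a priori, `v` being the mean squared error of the message `s`. -/
def leEstimate {n m : ℕ} (Q : Measure (Sample n m)) (snr : ℝ) (s : Sample n m → Fin n → ℂ) :
    Sample n m → Fin n → ℂ := fun ω =>
  let A := sensing ω
  let v : ℂ := (mse Q s : ℂ)
  ((snr : ℂ) • (A.conjTranspose * A) + v⁻¹ • (1 : Matrix (Fin n) (Fin n) ℂ))⁻¹.mulVec
    ((snr : ℂ) • A.conjTranspose.mulVec (observation ω) + v⁻¹ • s ω)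

/-- The message from the linear estimator to the decoder: orthogonalized, and scaled to the form
`x + ξ` with `E{xᴴ ξ} = 0`. -/
def leMessage {n m : ℕ} (Q : Measure (Sample n m)) (snr : ℝ) (s : Sample n m → Fin n → ℂ) :
    Sample n m → Fin n → ℂ :=
  let u := gso Q s (leEstimate Q snr s)
  (gsScale Q u)⁻¹ • u

/-- The a-posteriori-probability decoder: the posterior mean `E[x | r = x + ρ^(-1/2) z]` of the
codeword `x ∼ P`, where `z ∼ CN(0, I)`, by Bayes' rule. -/
def appDecoder {n : ℕ} (P : Measure (Fin n → ℂ)) (ρ : ℝ) (r : Fin n → ℂ) : Fin n → ℂ :=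
  (∫ x, Real.exp (-ρ * ∑ i, ‖r i - x i‖ ^ 2) ∂P)⁻¹ •
    ∫ x, Real.exp (-ρ * ∑ i, ‖r i - x i‖ ^ 2) • x ∂P

/-- The decoder's estimate `φ̂^C` from the message `r`, whose error has power `1/ρ` per symbol. -/
def decEstimate {n m : ℕ} (P : Measure (Fin n → ℂ)) (Q : Measure (Sample n m))
    (r : Sample n m → Fin n → ℂ) : Sample n m → Fin n → ℂ :=
  fun ω => appDecoder P (mse Q r)⁻¹ (r ω)

/-- The message from the decoder to the linear estimator: orthogonalized, and scaled to have the
least mean squared error. -/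
def decMessage {n m : ℕ} (P : Measure (Fin n → ℂ)) (Q : Measure (Sample n m))
    (r : Sample n m → Fin n → ℂ) : Sample n m → Fin n → ℂ :=
  let u := gso Q r (decEstimate P Q r)
  (corr Q u codeword / power Q u) • u

/-- The input message of the linear estimator in iteration `t`; there is no prior information at
`t = 0`. -/
def leInput {n m : ℕ} (P : Measure (Fin n → ℂ)) (α : Measure (Fin m → Fin n → ℂ)) (snr : ℝ) :
    ℕ → Sample n m → Fin n → ℂ
  | 0 => 0
  | t + 1 => decMessage P (sysLaw P α snr)
      (leMessage (sysLaw P α snr) snr (leInput P α snr t))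

/-- `ρ_t`, the inverse mean squared error of the message that the decoder receives. -/
def oampRho {n m : ℕ} (P : Measure (Fin n → ℂ)) (α : Measure (Fin m → Fin n → ℂ)) (snr : ℝ)
    (t : ℕ) : ℝ :=
  (mse (sysLaw P α snr) (leMessage (sysLaw P α snr) snr (leInput P α snr t)))⁻¹

/-- The mean squared error of the decoder's estimate in iteration `t`. -/
def oampMse {n m : ℕ} (P : Measure (Fin n → ℂ)) (α : Measure (Fin m → Fin n → ℂ)) (snr : ℝ)
    (t : ℕ) : ℝ :=
  mse (sysLaw P α snr) (decEstimate P (sysLaw P α snr)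
    (leMessage (sysLaw P α snr) snr (leInput P α snr t)))

end Algorithm

/-! ### State evolution -/

/-- `γ_SE(v) = γ̂_SE(v)⁻¹ - v⁻¹`, with its limit `snr` at `v = 0`. -/
def gammaSE (μ : Measure ℝ) (snr v : ℝ) : ℝ :=
  if v = 0 then snr else (gammaHat μ snr v)⁻¹ - v⁻¹

/-- `(φ̂(ρ)⁻¹ - ρ)⁻¹`, written so that it is `0` when `φ̂(ρ) = 0`. -/
def phiOrth (φ : ℝ → ℝ) (ρ : ℝ) : ℝ := φ ρ / (1 - ρ * φ ρ)

/-- The state-evolution value of the mean squared error of the linear estimator's input, for a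
code with transfer function `φ`. -/
def seInput (μ : Measure ℝ) (snr : ℝ) (φ : ℝ → ℝ) : ℕ → ℝ
  | 0 => 1
  | t + 1 => phiOrth φ (gammaSE μ snr (seInput μ snr φ t))

/-- The state-evolution value of `ρ_t`. -/
def seRho (μ : Measure ℝ) (snr : ℝ) (φ : ℝ → ℝ) (t : ℕ) : ℝ :=
  gammaSE μ snr (seInput μ snr φ t)

/-- State evolution is correct for joint OAMP and decoding: in every iteration, in the large-system
limit, the signal-to-noise ratio at the decoder's input and the mean squared error at its output
are those predicted by the transfer functions. -/
def StateEvolution (μ : Measure ℝ) (snr : ℝ) (φ : ℝ → ℝ) (N M : ℕ → ℕ)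
    (A : ∀ j, Measure (Fin (M j) → Fin (N j) → ℂ)) (P : ∀ j, Measure (Fin (N j) → ℂ)) : Prop :=
  ∀ t, Tendsto (fun j => oampRho (P j) (A j) snr t) atTop (𝓝 (seRho μ snr φ t)) ∧
    Tendsto (fun j => oampMse (P j) (A j) snr t) atTop (𝓝 (φ (seRho μ snr φ t)))

/-- OAMP is error-free in the large-system limit: its mean squared error becomes arbitrarily small
after sufficiently many iterations. -/
def ErrorFree (snr : ℝ) (N M : ℕ → ℕ)
    (A : ∀ j, Measure (Fin (M j) → Fin (N j) → ℂ)) (P : ∀ j, Measure (Fin (N j) → ℂ)) : Prop :=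
  ∀ ε > 0, ∃ T, ∀ t ≥ T, ∀ᶠ j in atTop, oampMse (P j) (A j) snr t < ε

/-- `R_OAMP = ∫_0^∞ φ̂^C_SE(ρ) dρ`, in nats per symbol. -/
def oampRate (φ : ℝ → ℝ) : ℝ := ∫ ρ in Ioi (0 : ℝ), φ ρ

end OAMP

end

/-! The proof compares areas below curves, read as functions of the signal-to-noise ratio ρ. In
Gaussian noise the area below an MMSE curve up to ρ is the mutual information at ρ
(`info_sqrt_eq_integral`), and for a finite codebook the area up to infinity is its entropy
(`integrableOn_mmse_and_integral`). Both are proved for a signal of arbitrary law in a real inner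
product space, so that the scalar channel on `ℂ` and the codeword channel on `EuclideanSpace ℂ (Fin
n)` are instances.

Uniqueness of the fixed point ρ* makes the matched curve equal to φ̂^S on (0, ρ*) and to η⁻¹ on (ρ*,
snr]; beyond snr it vanishes. The left area is I(x; √ρ* x + z). By the layer-cake formula, the right
area is the integral of η over (0, v*] minus ρ* v* (`integral_etaSE`). Since η(v) = snr R(-snr v)
(`snr_mul_rTransform`), that integral is the R-transform term of the capacity, and the two areas add
up to it (`integral_phiStar`). The transfer curves are bounded by 1 on [0, snr] and vanish beyond,
so dominated convergence carries the rates to this limit.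

Error-freeness is a monotonicity argument (`tendsto_transfer_seRho`). With 1/γ̂(v) = γ(v) + 1/v, a
transfer value below η⁻¹(γ(v)) ≤ γ̂(v) makes the next input error smaller than v. The errors
therefore decrease, and a positive limit would contradict the gap between the curve and η⁻¹. -/

noncomputable section

set_option linter.unusedSectionVars false

namespace OAMP

/-! ### Bayesian estimation in additive Gaussian noise

The signal `x ∼ P` and the noise `z ∼ γ` take values in a real inner product space, `γ` having the
density `exp (-‖z‖²)` with respect to a translation-invariant measure `ν`. -/

section Bayes

variable {W : Type*} [NormedAddCommGroup W] [InnerProductSpace ℝ W] [MeasurableSpace W]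
  [BorelSpace W] [SecondCountableTopology W] [CompleteSpace W]

/-- `γ` has the density `exp (-‖z‖²)` with respect to the translation-invariant measure `ν`. -/
structure IsGaussNoise (ν γ : Measure W) : Prop where
  sigmaFinite : SigmaFinite ν
  invariant : ν.IsAddLeftInvariant
  density : γ = ν.withDensity fun z => ENNReal.ofReal (Real.exp (-‖z‖ ^ 2))
  prob : IsProbabilityMeasure γ
  sq : Integrable (fun z => ‖z‖ ^ 2) γ

/-- The unnormalized likelihood of `x` given `s x + z = y`. -/
def lik (s : ℝ) (x y : W) : ℝ := Real.exp (-‖y - s • x‖ ^ 2)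

/-- The normalization of the posterior law. -/
def evid (P : Measure W) (s : ℝ) (y : W) : ℝ := ∫ x, lik s x y ∂P

/-- The posterior mean of `f x` given `s x + z = y`. -/
def postAvg {E : Type*} [NormedAddCommGroup E] [NormedSpace ℝ E] (P : Measure W) (s : ℝ)
    (f : W → E) (y : W) : E := (evid P s y)⁻¹ • ∫ x, lik s x y • f x ∂P

/-- The posterior mean of `x` given `s x + z = y`. -/
def pmean (P : Measure W) (s : ℝ) (y : W) : W := postAvg P s (fun x => x) y

/-- The minimum mean squared error of `x` given `s x + z`. -/
def mmse (P γ : Measure W) (s : ℝ) : ℝ :=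
  ∫ p, ‖p.1 - pmean P s (s • p.1 + p.2)‖ ^ 2 ∂(P.prod γ)

lemma lik_pos (s : ℝ) (x y : W) : 0 < lik s x y := Real.exp_pos _

lemma lik_le_one (s : ℝ) (x y : W) : lik s x y ≤ 1 := by
  unfold lik; rw [Real.exp_le_one_iff]; nlinarith [sq_nonneg ‖y - s • x‖]

lemma norm_lik_le (s : ℝ) (x y : W) : ‖lik s x y‖ ≤ 1 := by
  rw [Real.norm_of_nonneg (lik_pos s x y).le]; exact lik_le_one s x y

@[fun_prop]
lemma continuous_lik : Continuous fun q : ℝ × W × W => lik q.1 q.2.1 q.2.2 := by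
  unfold lik; fun_prop

lemma continuous_lik_pair (s : ℝ) : Continuous fun q : W × W => lik s q.1 q.2 := by
  unfold lik; fun_prop

lemma continuous_lik_left (s : ℝ) (y : W) : Continuous fun x : W => lik s x y := by
  unfold lik; fun_prop

lemma integrable_lik_smul {E : Type*} [NormedAddCommGroup E] [NormedSpace ℝ E] {P : Measure W}
    {f : W → E} (hf : Integrable f P) (s : ℝ) (y : W) :
    Integrable (fun x => lik s x y • f x) P :=
  hf.bdd_smul 1 (continuous_lik_left s y).aestronglyMeasurable
    (ae_of_all _ fun x => norm_lik_le s x y)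

variable {P γ ν : Measure W}

lemma integrable_lik [IsProbabilityMeasure P] (s : ℝ) (y : W) :
    Integrable (fun x => lik s x y) P := by
  simpa using integrable_lik_smul (integrable_const (1 : ℝ) (μ := P)) s y

lemma evid_pos [IsProbabilityMeasure P] (s : ℝ) (y : W) : 0 < evid P s y := by
  unfold evid
  rw [integral_pos_iff_support_of_nonneg (fun x => (lik_pos s x y).le) (integrable_lik s y)]
  have : Function.support (fun x => lik s x y) = univ := by
    ext x; simp [(lik_pos s x y).ne']
  simp [this]

lemma evid_le_one [IsProbabilityMeasure P] (s : ℝ) (y : W) : evid P s y ≤ 1 := by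
  have := integral_mono (integrable_lik (P := P) s y) (integrable_const (1 : ℝ))
    fun x => lik_le_one s x y
  simpa [evid] using this

lemma postAvg_const [IsProbabilityMeasure P] {E : Type*} [NormedAddCommGroup E] [NormedSpace ℝ E]
    [CompleteSpace E] (s : ℝ) (c : E) (y : W) : postAvg P s (fun _ => c) y = c := by
  unfold postAvg
  rw [integral_smul_const, smul_smul]
  change ((evid P s y)⁻¹ * evid P s y) • c = c
  rw [inv_mul_cancel₀ (evid_pos s y).ne', one_smul]

lemma postAvg_add {E : Type*} [NormedAddCommGroup E] [NormedSpace ℝ E] {f g : W → E}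
    (hf : Integrable f P) (hg : Integrable g P) (s : ℝ) (y : W) :
    postAvg P s (fun x => f x + g x) y = postAvg P s f y + postAvg P s g y := by
  unfold postAvg
  simp only [smul_add]
  rw [integral_add (integrable_lik_smul hf s y) (integrable_lik_smul hg s y), smul_add]

lemma postAvg_clm {E F : Type*} [NormedAddCommGroup E] [NormedSpace ℝ E] [CompleteSpace E]
    [NormedAddCommGroup F] [NormedSpace ℝ F] [CompleteSpace F] (L : E →L[ℝ] F) {f : W → E}
    (hf : Integrable f P) (s : ℝ) (y : W) :
    postAvg P s (fun x => L (f x)) y = L (postAvg P s f y) := by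
  unfold postAvg
  rw [map_smul, ← L.integral_comp_comm (integrable_lik_smul hf s y)]
  simp only [map_smul]

lemma postAvg_mono [IsProbabilityMeasure P] {f g : W → ℝ}
    (hf : Integrable f P) (hg : Integrable g P) (hfg : ∀ x, f x ≤ g x) (s : ℝ) (y : W) :
    postAvg P s f y ≤ postAvg P s g y := by
  unfold postAvg
  refine mul_le_mul_of_nonneg_left ?_ (inv_nonneg.2 (evid_pos s y).le)
  exact integral_mono (integrable_lik_smul hf s y) (integrable_lik_smul hg s y)
    fun x => mul_le_mul_of_nonneg_left (hfg x) (lik_pos s x y).le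

lemma norm_postAvg_le [IsProbabilityMeasure P] {E : Type*} [NormedAddCommGroup E]
    [NormedSpace ℝ E] (f : W → E) (s : ℝ) (y : W) :
    ‖postAvg P s f y‖ ≤ postAvg P s (fun x => ‖f x‖) y := by
  unfold postAvg
  rw [norm_smul, norm_inv, Real.norm_of_nonneg (evid_pos s y).le, smul_eq_mul]
  refine mul_le_mul_of_nonneg_left ?_ (inv_nonneg.2 (evid_pos s y).le)
  refine (norm_integral_le_integral_norm _).trans (le_of_eq ?_)
  congr 1; ext x
  rw [norm_smul, Real.norm_of_nonneg (lik_pos s x y).le, smul_eq_mul]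

/-! #### Joint measurability -/

lemma stronglyMeasurable_evid [SFinite P] :
    StronglyMeasurable fun q : ℝ × W => evid P q.1 q.2 := by
  unfold evid
  refine StronglyMeasurable.integral_prod_right (f := fun (q : ℝ × W) x => lik q.1 x q.2) ?_
  have : Continuous fun r : (ℝ × W) × W => lik r.1.1 r.2 r.1.2 := by unfold lik; fun_prop
  exact this.stronglyMeasurable

lemma stronglyMeasurable_postAvg [SFinite P] {E Z : Type*} [NormedAddCommGroup E]
    [NormedSpace ℝ E] [MeasurableSpace Z] {f : Z → W → E} {s : Z → ℝ} {y : Z → W}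
    (hf : StronglyMeasurable (Function.uncurry f)) (hs : Measurable s) (hy : Measurable y) :
    StronglyMeasurable fun q => postAvg P (s q) (f q) (y q) := by
  unfold postAvg
  refine StronglyMeasurable.smul ?_ ?_
  · exact ((stronglyMeasurable_evid (P := P)).comp_measurable
      (hs.prodMk hy)).measurable.inv.stronglyMeasurable
  · refine StronglyMeasurable.integral_prod_right (f := fun q x => lik (s q) x (y q) • f q x) ?_
    refine StronglyMeasurable.smul ?_ hf
    have : Measurable fun r : Z × W => (s r.1, r.2, y r.1) := by fun_prop
    exact continuous_lik.stronglyMeasurable.comp_measurable this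

lemma stronglyMeasurable_pmean [SFinite P] :
    StronglyMeasurable fun q : ℝ × W => pmean P q.1 q.2 := by
  exact stronglyMeasurable_postAvg (P := P) (Z := ℝ × W) (f := fun _ x => x)
    (s := fun q => q.1) (y := fun q => q.2) measurable_snd.stronglyMeasurable
    measurable_fst measurable_snd

lemma measurable_pmean [SFinite P] (s : ℝ) : Measurable (pmean P s) :=
  (stronglyMeasurable_pmean (P := P)).measurable.comp (g := fun q : ℝ × W => pmean P q.1 q.2)
    (f := fun y : W => (s, y)) measurable_prodMk_left

/-! #### The joint law of signal and observation -/

/-- For each fixed signal the observation is a translate of the noise, so the shear preserves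
`P.prod ν`, and the noise density becomes the likelihood. `P` itself needs no density. -/
lemma map_joint [SFinite P] (h : IsGaussNoise ν γ) (s : ℝ) :
    (P.prod γ).map (fun p => (p.1, s • p.1 + p.2)) =
      (P.prod ν).withDensity fun q => ENNReal.ofReal (lik s q.1 q.2) := by
  have := h.sigmaFinite
  have := h.invariant
  have hm : Measurable fun z : W => ENNReal.ofReal (Real.exp (-‖z‖ ^ 2)) := by fun_prop
  have hmp : MeasurePreserving (fun p : W × W => (p.1, s • p.1 + p.2)) (P.prod ν) (P.prod ν) := by
    refine (MeasurePreserving.id P).skew_product (g := fun x z => s • x + z) (by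
      simp only [Function.uncurry_def]; fun_prop) ?_
    exact ae_of_all _ fun x => map_add_left_eq_self ν (s • x)
  have hl : Measurable fun q : W × W => ENNReal.ofReal (lik s q.1 q.2) :=
    (continuous_lik_pair s).measurable.ennreal_ofReal
  rw [h.density, prod_withDensity_right hm]
  ext B hB
  rw [Measure.map_apply hmp.measurable hB, withDensity_apply _ (hmp.measurable hB),
    withDensity_apply _ hB, ← hmp.setLIntegral_comp_preimage hB hl]
  simp [lik]

lemma integral_joint [SFinite P] (h : IsGaussNoise ν γ) (s : ℝ) {E : Type*}
    [NormedAddCommGroup E] [NormedSpace ℝ E] {G : W → W → E}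
    (hG : StronglyMeasurable (Function.uncurry G)) :
    ∫ p, G p.1 (s • p.1 + p.2) ∂(P.prod γ) = ∫ q, lik s q.1 q.2 • G q.1 q.2 ∂(P.prod ν) := by
  have hl : Measurable fun q : W × W => ENNReal.ofReal (lik s q.1 q.2) :=
    (continuous_lik_pair s).measurable.ennreal_ofReal
  have h1 := integral_map (μ := P.prod γ) (φ := fun p => (p.1, s • p.1 + p.2))
    (f := Function.uncurry G) (by fun_prop) hG.aestronglyMeasurable
  rw [map_joint h, integral_withDensity_eq_integral_toReal_smul hl (by simp)] at h1
  simp only [Function.uncurry, ENNReal.toReal_ofReal (lik_pos s _ _).le] at h1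
  exact h1.symm

lemma integrable_joint_iff [SFinite P] (h : IsGaussNoise ν γ) (s : ℝ) {E : Type*}
    [NormedAddCommGroup E] [NormedSpace ℝ E] {G : W → W → E}
    (hG : StronglyMeasurable (Function.uncurry G)) :
    Integrable (fun p => G p.1 (s • p.1 + p.2)) (P.prod γ) ↔
      Integrable (fun q => lik s q.1 q.2 • G q.1 q.2) (P.prod ν) := by
  have hl : Measurable fun q : W × W => ENNReal.ofReal (lik s q.1 q.2) :=
    (continuous_lik_pair s).measurable.ennreal_ofReal
  have h1 := integrable_map_measure (μ := P.prod γ) (f := fun p => (p.1, s • p.1 + p.2))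
    (g := Function.uncurry G) hG.aestronglyMeasurable (by fun_prop)
  rw [map_joint h, integrable_withDensity_iff_integrable_smul' hl (by simp)] at h1
  simp only [Function.uncurry, ENNReal.toReal_ofReal (lik_pos s _ _).le] at h1
  exact h1.symm

/-- Replacing the signal by its posterior average does not change expectations. -/
lemma integrable_postAvg_and_integral [IsProbabilityMeasure P] (h : IsGaussNoise ν γ) (s : ℝ)
    {E : Type*} [NormedAddCommGroup E] [NormedSpace ℝ E] [CompleteSpace E] {G : W → W → E}
    (hG : StronglyMeasurable (Function.uncurry G))
    (hi : Integrable (fun p => G p.1 (s • p.1 + p.2)) (P.prod γ)) :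
    Integrable (fun p => postAvg P s (fun x => G x (s • p.1 + p.2)) (s • p.1 + p.2)) (P.prod γ) ∧
    ∫ p, postAvg P s (fun x => G x (s • p.1 + p.2)) (s • p.1 + p.2) ∂(P.prod γ) =
      ∫ p, G p.1 (s • p.1 + p.2) ∂(P.prod γ) := by
  have := h.sigmaFinite
  set c : W → E := fun y => postAvg P s (fun x => G x y) y with hc
  have hcm : StronglyMeasurable c :=
    stronglyMeasurable_postAvg (s := fun _ => s) (f := fun y x => G x y)
      (hG.comp_measurable measurable_swap) measurable_const measurable_id
  have hcm2 : StronglyMeasurable (Function.uncurry fun _ y : W => c y) :=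
    hcm.comp_measurable measurable_snd
  rw [integrable_joint_iff h s hG] at hi
  -- For fixed `y` the `P`-integral of the norm is evidence times `‖c y‖`, which cancels the
  -- normalization and is at most the integral of `lik * ‖G‖`; Fubini makes the latter
  -- `ν`-integrable.
  have hi2 : Integrable (fun q : W × W => lik s q.1 q.2 • c q.2) (P.prod ν) := by
    rw [integrable_prod_iff' (by
      exact ((continuous_lik_pair s).stronglyMeasurable.smul hcm2).aestronglyMeasurable)]
    refine ⟨ae_of_all _ fun y => (integrable_lik s y).smul_const (c y), ?_⟩
    have hb := hi.norm.integral_prod_right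
    refine hb.mono' ?_ (ae_of_all _ fun y => ?_)
    · refine StronglyMeasurable.aestronglyMeasurable ?_
      refine StronglyMeasurable.integral_prod_left (f := fun x y => ‖lik s x y • c y‖) ?_
      exact ((continuous_lik_pair s).stronglyMeasurable.smul hcm2).norm
    · have h1 : ∀ x, ‖lik s x y • c y‖ = lik s x y * ‖c y‖ := fun x => by
        rw [norm_smul, Real.norm_of_nonneg (lik_pos s x y).le]
      simp only [h1]
      rw [integral_mul_const, Real.norm_of_nonneg (mul_nonneg
        (integral_nonneg fun x => (lik_pos s x y).le) (norm_nonneg _))]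
      change evid P s y * ‖c y‖ ≤ _
      have h2 := norm_postAvg_le (P := P) (fun x => G x y) s y
      have h3 := mul_le_mul_of_nonneg_left h2 (evid_pos (P := P) s y).le
      refine h3.trans (le_of_eq ?_)
      unfold postAvg
      rw [smul_eq_mul, mul_inv_cancel_left₀ (evid_pos (P := P) s y).ne']
      congr 1; ext x
      rw [norm_smul, Real.norm_of_nonneg (lik_pos s x y).le, smul_eq_mul]
  refine ⟨(integrable_joint_iff h s hcm2).2 hi2, ?_⟩
  rw [integral_joint h s hG, integral_joint (G := fun _ y => c y) h s hcm2,
    integral_prod_symm _ hi2, integral_prod_symm _ hi]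
  congr 1; ext y
  simp only []
  rw [integral_smul_const]
  change evid P s y • c y = _
  simp only [hc, postAvg, smul_smul, mul_inv_cancel₀ (evid_pos (P := P) s y).ne', one_smul]

/-- Bayes' rule: the conditional expectation given the observation is the posterior average. -/
lemma condExp_eq_postAvg [IsProbabilityMeasure P] (h : IsGaussNoise ν γ) (s : ℝ)
    {Ω : Type*} {m0 : MeasurableSpace Ω} {Q : Measure Ω} [IsProbabilityMeasure Q] {X Y : Ω → W}
    (hX : Measurable X) (hY : Measurable Y)
    (hXY : Q.map (fun ω => (X ω, Y ω)) = (P.prod γ).map fun p => (p.1, s • p.1 + p.2))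
    {E : Type*} [NormedAddCommGroup E] [NormedSpace ℝ E] [CompleteSpace E] {f : W → E}
    (hf : StronglyMeasurable f) (hi : Integrable f P) :
    (fun ω => postAvg P s f (Y ω)) =ᵐ[Q]
      Q[fun ω => f (X ω) | MeasurableSpace.comap Y inferInstance] := by
  have hγ := h.prob
  have hpm : StronglyMeasurable (postAvg P s f) :=
    stronglyMeasurable_postAvg (s := fun _ => s) (y := fun y : W => y) (f := fun _ => f)
      (hf.comp_measurable measurable_snd) measurable_const measurable_id
  have hmeas : Measurable fun p : W × W => (p.1, s • p.1 + p.2) := by fun_prop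
  have tr : ∀ G : W × W → E, StronglyMeasurable G →
      ∫ ω, G (X ω, Y ω) ∂Q = ∫ p, G (p.1, s • p.1 + p.2) ∂(P.prod γ) := fun G hG => by
    rw [← integral_map (hX.prodMk hY).aemeasurable hG.aestronglyMeasurable, hXY,
      integral_map hmeas.aemeasurable hG.aestronglyMeasurable]
  have tri : ∀ G : W × W → E, StronglyMeasurable G →
      (Integrable (fun ω => G (X ω, Y ω)) Q ↔
        Integrable (fun p => G (p.1, s • p.1 + p.2)) (P.prod γ)) := fun G hG => by
    rw [← Function.comp_def G, ← integrable_map_measure hG.aestronglyMeasurable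
      (hX.prodMk hY).aemeasurable, hXY, integrable_map_measure hG.aestronglyMeasurable
      hmeas.aemeasurable]; rfl
  have hif : Integrable (fun p : W × W => f p.1) (P.prod γ) := hi.comp_fst γ
  have hG0 : StronglyMeasurable (Function.uncurry fun x _ : W => f x) :=
    hf.comp_measurable measurable_fst
  have key := integrable_postAvg_and_integral (G := fun x _ => f x) h s hG0 hif
  have hiX : Integrable (fun ω => f (X ω)) Q := (tri (fun p => f p.1) hG0).2 hif
  have hiY : Integrable (fun ω => postAvg P s f (Y ω)) Q :=
    (tri (fun p => postAvg P s f p.2) (hpm.comp_measurable measurable_snd)).2 key.1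
  refine ae_eq_condExp_of_forall_setIntegral_eq hY.comap_le hiX
    (fun _ _ _ => hiY.integrableOn) ?_ ?_
  · rintro _ ⟨B, hB, rfl⟩ -
    rw [← integral_indicator (hY hB), ← integral_indicator (hY hB)]
    have e1 : ∀ g : Ω → E, (Y ⁻¹' B).indicator g = fun ω => B.indicator (fun _ => g ω) (Y ω) := by
      intro g; ext ω; rfl
    rw [e1, e1]
    have hm1 : StronglyMeasurable fun p : W × W => B.indicator (fun _ => f p.1) p.2 := by
      have : (fun p : W × W => B.indicator (fun _ => f p.1) p.2) =
          (Prod.snd ⁻¹' B).indicator fun p => f p.1 := by ext p; rfl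
      rw [this]; exact hG0.indicator (measurable_snd hB)
    have hm2 : StronglyMeasurable fun p : W × W =>
        B.indicator (fun _ => postAvg P s f p.2) p.2 := by
      have : (fun p : W × W => B.indicator (fun _ => postAvg P s f p.2) p.2) =
          (Prod.snd ⁻¹' B).indicator fun p => postAvg P s f p.2 := by ext p; rfl
      rw [this]; exact (hpm.comp_measurable measurable_snd).indicator (measurable_snd hB)
    rw [tr (fun p => B.indicator (fun _ => postAvg P s f p.2) p.2) hm2,
      tr (fun p => B.indicator (fun _ => f p.1) p.2) hm1]
    have hi3 : Integrable (fun p : W × W => B.indicator (fun _ => f p.1) (s • p.1 + p.2))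
        (P.prod γ) := by
      refine hif.mono (hm1.comp_measurable hmeas).aestronglyMeasurable (ae_of_all _ fun p => ?_)
      by_cases hb : s • p.1 + p.2 ∈ B <;> simp [hb]
    -- An indicator of an event of the observation is constant under the posterior average, so
    -- averaging `1_B(y) f(x)` only replaces `f` by its posterior mean.
    rw [← (integrable_postAvg_and_integral (G := fun x y => B.indicator (fun _ => f x) y) h s hm1
      hi3).2]
    congr 1; ext p
    by_cases hb : s • p.1 + p.2 ∈ B <;> simp [hb, postAvg]
  · exact (hpm.comp_measurable (comap_measurable Y)).aestronglyMeasurable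

end Bayes

end OAMP

namespace OAMP

/-! ### Posterior mean and minimum mean squared error -/

section Mmse

variable {W : Type*} [NormedAddCommGroup W] [InnerProductSpace ℝ W] [MeasurableSpace W]
  [BorelSpace W] [SecondCountableTopology W] [CompleteSpace W]
variable {P γ ν : Measure W}

lemma integrable_self_of_sq [IsFiniteMeasure P] (hP : Integrable (fun x => ‖x‖ ^ 2) P) :
    Integrable (fun x => x) P :=
  ((memLp_two_iff_integrable_sq_norm measurable_id.aestronglyMeasurable).2 hP).integrable
    one_le_two

lemma integrable_sub_sq [IsFiniteMeasure P] (hP : Integrable (fun x => ‖x‖ ^ 2) P) (c : W) :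
    Integrable (fun x => ‖x - c‖ ^ 2) P := by
  have h1 := (memLp_two_iff_integrable_sq_norm measurable_id.aestronglyMeasurable).2 hP
  have h2 := h1.sub (memLp_const c)
  exact (memLp_two_iff_integrable_sq_norm (by fun_prop)).1 h2

/-- Bias-variance decomposition under the posterior law: ‖x - c‖² differs from ‖x‖² by an affine
function of x, whose posterior average depends on the posterior mean only. -/
lemma postAvg_sub_sq [IsProbabilityMeasure P] (hP : Integrable (fun x => ‖x‖ ^ 2) P) (s : ℝ)
    (c y : W) : postAvg P s (fun x => ‖x - c‖ ^ 2) y =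
      postAvg P s (fun x => ‖x‖ ^ 2) y - ‖pmean P s y‖ ^ 2 + ‖pmean P s y - c‖ ^ 2 := by
  have hi := integrable_self_of_sq hP
  have e : ∀ x : W, ‖x - c‖ ^ 2 = ‖x‖ ^ 2 + ((-2 : ℝ) • innerSL ℝ c) x + ‖c‖ ^ 2 := fun x => by
    rw [norm_sub_sq_real, real_inner_comm]; simp; ring
  simp only [e]
  have hl : Integrable (fun x => ((-2 : ℝ) • innerSL ℝ c) x) P :=
    ContinuousLinearMap.integrable_comp _ hi
  rw [postAvg_add (f := fun x => ‖x‖ ^ 2 + ((-2 : ℝ) • innerSL ℝ c) x) (hP.add hl)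
    (integrable_const _), postAvg_add hP hl, postAvg_const,
    postAvg_clm _ hi]
  simp only [pmean]; ring

lemma sq_norm_pmean_le [IsProbabilityMeasure P] (hP : Integrable (fun x => ‖x‖ ^ 2) P) (s : ℝ)
    (y : W) : ‖pmean P s y‖ ^ 2 ≤ postAvg P s (fun x => ‖x‖ ^ 2) y := by
  have h1 := postAvg_sub_sq hP s (pmean P s y) y
  have h2 := postAvg_mono (integrable_const (0 : ℝ)) (integrable_sub_sq hP (pmean P s y))
    (fun x => by positivity) s y
  rw [postAvg_const, h1] at h2
  simp at h2; linarith

lemma IsGaussNoise.integrable_fst_sq [IsProbabilityMeasure P] (h : IsGaussNoise ν γ)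
    (hP : Integrable (fun x => ‖x‖ ^ 2) P) :
    Integrable (fun p : W × W => ‖p.1‖ ^ 2) (P.prod γ) :=
  have := h.prob
  hP.comp_fst γ

lemma IsGaussNoise.integrable_snd_sq [IsProbabilityMeasure P] (h : IsGaussNoise ν γ) :
    Integrable (fun p : W × W => ‖p.2‖ ^ 2) (P.prod γ) :=
  have := h.prob
  h.sq.comp_snd P

lemma IsGaussNoise.integrable_postAvg_sq [IsProbabilityMeasure P] (h : IsGaussNoise ν γ)
    (hP : Integrable (fun x => ‖x‖ ^ 2) P) (s : ℝ) :
    Integrable (fun p => postAvg P s (fun x => ‖x‖ ^ 2) (s • p.1 + p.2)) (P.prod γ) ∧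
    ∫ p, postAvg P s (fun x => ‖x‖ ^ 2) (s • p.1 + p.2) ∂(P.prod γ) = ∫ x, ‖x‖ ^ 2 ∂P := by
  have := h.prob
  have := integrable_postAvg_and_integral (G := fun x _ : W => ‖x‖ ^ 2) h s
    (by exact Continuous.stronglyMeasurable (by fun_prop)) (h.integrable_fst_sq hP)
  refine ⟨this.1, this.2.trans ?_⟩
  rw [integral_fun_fst (fun x : W => ‖x‖ ^ 2)]; simp

lemma measurable_pmean_obs [SFinite P] (s : ℝ) :
    Measurable fun p : W × W => pmean P s (s • p.1 + p.2) :=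
  (measurable_pmean s).comp (by fun_prop)

lemma IsGaussNoise.integrable_pmean_sq [IsProbabilityMeasure P] (h : IsGaussNoise ν γ)
    (hP : Integrable (fun x => ‖x‖ ^ 2) P) (s : ℝ) :
    Integrable (fun p => ‖pmean P s (s • p.1 + p.2)‖ ^ 2) (P.prod γ) := by
  refine (h.integrable_postAvg_sq hP s).1.mono'
    ((measurable_pmean_obs s).norm.pow_const 2).aestronglyMeasurable (ae_of_all _ fun p => ?_)
  rw [Real.norm_of_nonneg (by positivity)]
  exact sq_norm_pmean_le hP s _

lemma integrable_sq_sub {Ω : Type*} [MeasurableSpace Ω] {Q : Measure Ω} {f g : Ω → W}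
    (hf : AEStronglyMeasurable f Q) (hg : AEStronglyMeasurable g Q)
    (hf2 : Integrable (fun ω => ‖f ω‖ ^ 2) Q)
    (hg2 : Integrable (fun ω => ‖g ω‖ ^ 2) Q) : Integrable (fun ω => ‖f ω - g ω‖ ^ 2) Q :=
  (memLp_two_iff_integrable_sq_norm (hf.sub hg)).1
    (((memLp_two_iff_integrable_sq_norm hf).2 hf2).sub
      ((memLp_two_iff_integrable_sq_norm hg).2 hg2))

lemma IsGaussNoise.integrable_err [IsProbabilityMeasure P] (h : IsGaussNoise ν γ)
    (hP : Integrable (fun x => ‖x‖ ^ 2) P) (s : ℝ) :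
    Integrable (fun p => ‖p.1 - pmean P s (s • p.1 + p.2)‖ ^ 2) (P.prod γ) :=
  integrable_sq_sub measurable_fst.aestronglyMeasurable
    (measurable_pmean_obs s).aestronglyMeasurable (h.integrable_fst_sq hP)
    (h.integrable_pmean_sq hP s)

lemma mmse_eq_integral_postAvg [IsProbabilityMeasure P] (h : IsGaussNoise ν γ)
    (hP : Integrable (fun x => ‖x‖ ^ 2) P) (s : ℝ) :
    mmse P γ s = ∫ p, (postAvg P s (fun x => ‖x‖ ^ 2) (s • p.1 + p.2) -
      ‖pmean P s (s • p.1 + p.2)‖ ^ 2) ∂(P.prod γ) := by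
  have := (integrable_postAvg_and_integral (G := fun x y : W => ‖x - pmean P s y‖ ^ 2) h s
    (by
      have := measurable_pmean (P := P) s
      exact Measurable.stronglyMeasurable (by simp only [Function.uncurry_def]; fun_prop))
    (h.integrable_err hP s)).2
  rw [mmse, ← this]
  congr 1; ext p
  rw [postAvg_sub_sq hP]; simp

lemma mmse_eq [IsProbabilityMeasure P] (h : IsGaussNoise ν γ)
    (hP : Integrable (fun x => ‖x‖ ^ 2) P) (s : ℝ) :
    mmse P γ s = ∫ x, ‖x‖ ^ 2 ∂P -
      ∫ p, ‖pmean P s (s • p.1 + p.2)‖ ^ 2 ∂(P.prod γ) := by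
  rw [mmse_eq_integral_postAvg h hP, integral_sub (h.integrable_postAvg_sq hP s).1
    (h.integrable_pmean_sq hP s), (h.integrable_postAvg_sq hP s).2]

lemma mmse_nonneg (P γ : Measure W) (s : ℝ) : 0 ≤ mmse P γ s :=
  integral_nonneg fun _ => by positivity

/-- The posterior mean is the optimal estimator. -/
lemma mmse_le [IsProbabilityMeasure P] (h : IsGaussNoise ν γ)
    (hP : Integrable (fun x => ‖x‖ ^ 2) P) (s : ℝ) {g : W → W} (hg : Measurable g)
    (hi : Integrable (fun p => ‖p.1 - g (s • p.1 + p.2)‖ ^ 2) (P.prod γ)) :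
    mmse P γ s ≤ ∫ p, ‖p.1 - g (s • p.1 + p.2)‖ ^ 2 ∂(P.prod γ) := by
  have := integrable_postAvg_and_integral (G := fun x y : W => ‖x - g y‖ ^ 2) h s
    (Measurable.stronglyMeasurable (by simp only [Function.uncurry_def]; fun_prop)) hi
  rw [mmse_eq_integral_postAvg h hP, ← this.2]
  refine integral_mono ((h.integrable_postAvg_sq hP s).1.sub (h.integrable_pmean_sq hP s))
    this.1 fun p => ?_
  simp only
  rw [postAvg_sub_sq hP]
  linarith [sq_nonneg ‖pmean P s (s • p.1 + p.2) - g (s • p.1 + p.2)‖]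

lemma mmse_le_var [IsProbabilityMeasure P] (h : IsGaussNoise ν γ)
    (hP : Integrable (fun x => ‖x‖ ^ 2) P) (s : ℝ) (c : W) :
    mmse P γ s ≤ ∫ x, ‖x - c‖ ^ 2 ∂P := by
  have := h.prob
  have h1 := mmse_le h hP s (g := fun _ => c) measurable_const
    ((integrable_sub_sq hP c).comp_fst γ)
  refine h1.trans (le_of_eq ?_)
  rw [integral_fun_fst (fun x : W => ‖x - c‖ ^ 2)]; simp

/-! #### Continuity in the signal-to-noise ratio -/

/-- Fatou's lemma as lower semicontinuity; no dominating function is needed. -/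
lemma eventually_lt_integral_of_continuousAt {Ω : Type*} [MeasurableSpace Ω] {Q : Measure Ω}
    {F : ℝ → Ω → ℝ} (hm : ∀ s, Measurable (F s)) (h0 : ∀ s ω, 0 ≤ F s ω)
    (hi : ∀ s, Integrable (F s) Q) {s₀ : ℝ} (hc : ∀ ω, ContinuousAt (fun s => F s ω) s₀) {a : ℝ}
    (ha : a < ∫ ω, F s₀ ω ∂Q) : ∀ᶠ s in 𝓝 s₀, a < ∫ ω, F s ω ∂Q := by
  rcases lt_or_ge a 0 with h | h
  · exact Eventually.of_forall fun s => h.trans_le (integral_nonneg (h0 s))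
  have hF := lintegral_liminf_le (μ := Q) (u := 𝓝 s₀) (f := fun s ω => ENNReal.ofReal (F s ω))
    fun s => (hm s).ennreal_ofReal
  have h1 : ∀ ω, liminf (fun s => ENNReal.ofReal (F s ω)) (𝓝 s₀) = ENNReal.ofReal (F s₀ ω) :=
    fun ω => (ENNReal.continuous_ofReal.continuousAt.comp (hc ω)).tendsto.liminf_eq
  simp only [h1, ← ofReal_integral_eq_lintegral_ofReal (hi _) (ae_of_all _ (h0 _))] at hF
  have h2 : ENNReal.ofReal a < liminf (fun s => ENNReal.ofReal (∫ ω, F s ω ∂Q)) (𝓝 s₀) :=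
    (ENNReal.ofReal_lt_ofReal_iff (h.trans_lt ha)).2 ha |>.trans_le hF
  filter_upwards [eventually_lt_of_lt_liminf h2] with s hs
  exact lt_of_not_ge fun hle => (ENNReal.ofReal_le_ofReal hle).not_gt hs

lemma continuous_postIntegral {E : Type*} [NormedAddCommGroup E] [NormedSpace ℝ E] {f : W → E}
    (hf : Integrable f P) (x z : W) :
    Continuous fun s : ℝ => ∫ x', lik s x' (s • x + z) • f x' ∂P := by
  refine continuous_of_dominated (bound := fun x' => ‖f x'‖)
    (fun s => (integrable_lik_smul hf s _).aestronglyMeasurable)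
    (fun s => ae_of_all _ fun x' => ?_) hf.norm (ae_of_all _ fun x' => ?_)
  · rw [norm_smul]
    exact mul_le_of_le_one_left (norm_nonneg _) (norm_lik_le _ _ _)
  · unfold lik; fun_prop

lemma continuous_evid [IsProbabilityMeasure P] (x z : W) :
    Continuous fun s : ℝ => evid P s (s • x + z) := by
  simpa [evid] using continuous_postIntegral (integrable_const (1 : ℝ) (μ := P)) x z

lemma continuous_postAvg [IsProbabilityMeasure P] {E : Type*} [NormedAddCommGroup E]
    [NormedSpace ℝ E] {f : W → E} (hf : Integrable f P) (x z : W) :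
    Continuous fun s : ℝ => postAvg P s f (s • x + z) :=
  ((continuous_evid x z).inv₀ fun _ => (evid_pos _ _).ne').smul (continuous_postIntegral hf x z)

/-- The error is the integral of a nonnegative function continuous in `s`, and also a constant minus
such an integral. Fatou applied to the two forms gives lower and upper semicontinuity. -/
lemma continuous_mmse [IsProbabilityMeasure P] (h : IsGaussNoise ν γ)
    (hP : Integrable (fun x => ‖x‖ ^ 2) P) : Continuous (mmse P γ) := by
  have hc : ∀ p : W × W, Continuous fun s : ℝ => pmean P s (s • p.1 + p.2) := fun p =>
    continuous_postAvg (integrable_self_of_sq hP) p.1 p.2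
  have hpm := fun s => measurable_pmean_obs (P := P) s
  refine continuous_iff_continuousAt.2 fun s₀ => tendsto_order.2 ⟨fun a ha => ?_, fun a ha => ?_⟩
  · refine eventually_lt_integral_of_continuousAt (fun s => ?_) (fun s p => by positivity)
      (h.integrable_err hP) (fun p => ?_) ha
    · have := hpm s; fun_prop
    · exact ((continuous_const.sub (hc p)).norm.pow 2).continuousAt
  · rw [mmse_eq h hP] at ha
    have := eventually_lt_integral_of_continuousAt
      (F := fun s p => ‖pmean P s (s • p.1 + p.2)‖ ^ 2) (Q := P.prod γ) (s₀ := s₀)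
      (a := ∫ x, ‖x‖ ^ 2 ∂P - a) (fun s => (hpm s).norm.pow_const 2) (fun s p => by positivity)
      (h.integrable_pmean_sq hP) (fun p => ((hc p).norm.pow 2).continuousAt) (by linarith)
    filter_upwards [this] with s hs
    rw [mmse_eq h hP]; linarith

/-! #### The error vanishes for no or for all signal-to-noise ratios -/

/-- The likelihood is positive, so zero error means `x = pmean P s y` for `P.prod ν`-almost all
pairs. One good `y` then shows that `x` is almost surely constant. The contrapositive spreads
positivity of the error from one `ρ` to all. -/
lemma mmse_eq_zero_of_eq_zero [IsProbabilityMeasure P] (h : IsGaussNoise ν γ)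
    (hP : Integrable (fun x => ‖x‖ ^ 2) P) {s : ℝ} (hs : mmse P γ s = 0) (t : ℝ) :
    mmse P γ t = 0 := by
  have := h.sigmaFinite
  have hpm := measurable_pmean (P := P) s
  have hG : StronglyMeasurable (Function.uncurry fun x y : W => ‖x - pmean P s y‖ ^ 2) :=
    Measurable.stronglyMeasurable (by simp only [Function.uncurry_def]; fun_prop)
  have hi := (integrable_joint_iff h s hG).1 (h.integrable_err hP s)
  rw [mmse, integral_joint (G := fun x y => ‖x - pmean P s y‖ ^ 2) h s hG,
    integral_eq_zero_iff_of_nonneg (fun q => smul_nonneg (lik_pos _ _ _).le (by positivity)) hi]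
    at hs
  have hs2 : ∀ᵐ q ∂(P.prod ν), q.1 = pmean P s q.2 := by
    filter_upwards [hs] with q hq
    simpa [(lik_pos s q.1 q.2).ne', sub_eq_zero] using hq
  have hs3 : ∀ᵐ y ∂ν, ∀ᵐ x ∂P, x = pmean P s y :=
    Measure.ae_ae_of_ae_prod (Measure.measurePreserving_swap.quasiMeasurePreserving.ae hs2)
  have hν : ν ≠ 0 := by
    intro h0
    have := h.prob
    exact IsProbabilityMeasure.ne_zero γ (by rw [h.density, h0]; simp)
  have : (ae ν).NeBot := ae_neBot.2 hν
  obtain ⟨y, hy⟩ := hs3.exists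
  refine le_antisymm ((mmse_le_var h hP t (pmean P s y)).trans (le_of_eq ?_)) (mmse_nonneg _ _ _)
  rw [integral_eq_zero_of_ae]
  filter_upwards [hy] with x hx
  simp [sub_eq_zero.2 hx]

/-! #### Monotonicity -/

lemma measurePreserving_withDensity {Ω : Type*} [MeasurableSpace Ω] {Q : Measure Ω} {R : Ω → Ω}
    (hR : MeasurePreserving R Q Q) {f : Ω → ENNReal} (hf : Measurable f)
    (hfR : ∀ ω, f (R ω) = f ω) :
    MeasurePreserving R (Q.withDensity f) (Q.withDensity f) := by
  refine ⟨hR.measurable, ?_⟩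
  ext B hB
  rw [Measure.map_apply hR.measurable hB, withDensity_apply _ (hR.measurable hB),
    withDensity_apply _ hB, ← hR.setLIntegral_comp_preimage hB hf]
  simp only [hfR]

/-- A normalized combination of independent copies of the noise is again the noise. -/
lemma IsGaussNoise.map_combination (h : IsGaussNoise ν γ) {c d : ℝ} (hc : 0 ≤ c)
    (hcd : c ^ 2 + d ^ 2 = 1) : (γ.prod γ).map (fun p => c • p.1 + d • p.2) = γ := by
  have := h.sigmaFinite
  have := h.invariant
  have := h.prob
  rcases eq_or_ne d 0 with rfl | hd
  -- The sign condition `0 ≤ c` excludes `c = -1`.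
  · have : c = 1 := by nlinarith
    simp only [this, one_smul, zero_smul, add_zero]
    exact measurePreserving_fst.map_eq
  have shear : ∀ a : ℝ, MeasurePreserving (fun p : W × W => (p.1, a • p.1 + p.2))
      (ν.prod ν) (ν.prod ν) := fun a => by
    refine (MeasurePreserving.id ν).skew_product (g := fun x z => a • x + z) (by
      simp only [Function.uncurry_def]; fun_prop) ?_
    exact ae_of_all _ fun x => map_add_left_eq_self ν (a • x)
  have sw : MeasurePreserving (Prod.swap : W × W → W × W) (ν.prod ν) (ν.prod ν) :=
    Measure.measurePreserving_swap
  -- The rotation with cosine `c` and sine `d` is a product of three shears, with coefficients `a`,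
  -- `-d`, `a`, where `a` is the tangent of half the angle. Each shear preserves `ν.prod ν` by
  -- translation invariance.
  set a := (1 - c) / d
  have hR := (((sw.comp (shear a)).comp sw).comp (shear (-d))).comp ((sw.comp (shear a)).comp sw)
  have hRe : ((((Prod.swap ∘ fun p : W × W => (p.1, a • p.1 + p.2)) ∘ Prod.swap) ∘
      fun p : W × W => (p.1, (-d) • p.1 + p.2)) ∘
      ((Prod.swap ∘ fun p : W × W => (p.1, a • p.1 + p.2)) ∘ Prod.swap)) =
      fun p => (c • p.1 + d • p.2, (-d) • p.1 + c • p.2) := by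
    have h1 : a * d = 1 - c := div_mul_cancel₀ _ hd
    have h2 : a * (1 + c) = d := by
      rw [div_mul_eq_mul_div, div_eq_iff hd]; linarith
    clear_value a
    ext p
    · simp only [Function.comp, Prod.swap]
      match_scalars
      · linear_combination h2 - a * h1
      · linear_combination -h1
    · simp only [Function.comp, Prod.swap]
      match_scalars
      · linear_combination -h1
      · ring
  rw [hRe] at hR
  have hm : Measurable fun z : W => ENNReal.ofReal (Real.exp (-‖z‖ ^ 2)) := by fun_prop
  have hγγ : γ.prod γ = (ν.prod ν).withDensity fun p =>
      ENNReal.ofReal (Real.exp (-‖p.1‖ ^ 2)) * ENNReal.ofReal (Real.exp (-‖p.2‖ ^ 2)) := by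
    conv_lhs => rw [h.density]
    exact prod_withDensity hm hm
  -- The rotation keeps ‖p₁‖² + ‖p₂‖², hence preserves `γ.prod γ`; its first component has the law
  -- `γ`.
  have hR2 := measurePreserving_withDensity hR (f := fun p =>
      ENNReal.ofReal (Real.exp (-‖p.1‖ ^ 2)) * ENNReal.ofReal (Real.exp (-‖p.2‖ ^ 2)))
      (by fun_prop) (fun p => by
        simp only [← ENNReal.ofReal_mul (Real.exp_nonneg _), ← Real.exp_add]
        congr 2
        rw [norm_add_sq_real, norm_add_sq_real]
        simp only [norm_smul, mul_pow, inner_smul_left, inner_smul_right, Real.norm_eq_abs,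
          sq_abs, conj_trivial]
        linear_combination (-(‖p.1‖ ^ 2) - ‖p.2‖ ^ 2) * hcd)
  rw [← hγγ] at hR2
  have hcomp := measurePreserving_fst.comp hR2
  exact hcomp.map_eq

/-- Degradation: with c = s/t and c² + d² = 1, the observation at `s` has the law of c times the one
at `t` plus d times fresh noise. For each value of the fresh noise, the estimator for `s` is a
competitor at `t` and cannot beat the optimum there. -/
lemma mmse_antitoneOn [IsProbabilityMeasure P] (h : IsGaussNoise ν γ)
    (hP : Integrable (fun x => ‖x‖ ^ 2) P) : AntitoneOn (mmse P γ) (Ici 0) := by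
  intro s hs t _ hst
  have := h.prob
  rcases hst.eq_or_lt with rfl | hlt
  · exact le_rfl
  have ht : 0 < t := lt_of_le_of_lt hs hlt
  set c := s / t
  have hc0 : 0 ≤ c := div_nonneg hs ht.le
  have hc1 : c ≤ 1 := (div_le_one ht).2 hst
  set d := Real.sqrt (1 - c ^ 2)
  have hcd : c ^ 2 + d ^ 2 = 1 := by
    rw [Real.sq_sqrt (by nlinarith)]; ring
  have hct : c * t = s := div_mul_cancel₀ _ ht.ne'
  have hmp : MeasurePreserving (fun q : W × W × W => (q.1, c • q.2.1 + d • q.2.2))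
      (P.prod (γ.prod γ)) (P.prod γ) :=
    (MeasurePreserving.id P).prod ⟨by fun_prop, h.map_combination hc0 hcd⟩
  have hmp2 : MeasurePreserving (fun q : W × W × W => (q.2.1, q.2.2, q.1))
      (γ.prod (P.prod γ)) (P.prod (γ.prod γ)) := by
    have h1 := (measurePreserving_prodAssoc P γ γ)
    exact h1.comp Measure.measurePreserving_swap
  have hmp3 := hmp.comp hmp2
  have hpm := measurable_pmean (P := P) s
  have hF : StronglyMeasurable fun p : W × W => ‖p.1 - pmean P s (s • p.1 + p.2)‖ ^ 2 :=
    Measurable.stronglyMeasurable (by fun_prop)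
  have hint : Integrable (fun q : W × W × W =>
      ‖q.2.1 - pmean P s (c • (t • q.2.1 + q.2.2) + d • q.1)‖ ^ 2) (γ.prod (P.prod γ)) := by
    have := hmp3.integrable_comp_of_integrable (h.integrable_err hP s)
    refine this.congr (ae_of_all _ fun q => ?_)
    simp only [Function.comp, smul_add, smul_smul, hct, add_assoc]
  have heq : mmse P γ s = ∫ z', ∫ p, ‖p.1 - pmean P s (c • (t • p.1 + p.2) + d • z')‖ ^ 2
      ∂(P.prod γ) ∂γ := by
    have h1 := integral_map hmp3.measurable.aemeasurable
      (hF.aestronglyMeasurable (μ := Measure.map _ (γ.prod (P.prod γ))))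
    rw [hmp3.map_eq] at h1
    rw [← integral_prod _ hint, mmse, h1]
    congr 1; ext q
    simp only [Function.comp, smul_add, smul_smul, hct, add_assoc]
  rw [heq]
  have : mmse P γ t = ∫ _, mmse P γ t ∂γ := by simp
  rw [this]
  refine integral_mono_ae (integrable_const _) hint.integral_prod_left ?_
  filter_upwards [hint.prod_right_ae] with z' hz'
  exact mmse_le h hP t (g := fun y => pmean P s (c • y + d • z')) (by fun_prop) hz'

/-! #### The linear estimator -/

/-- The estimator y ↦ b y with b = s/(1 + s²) has error (1 - bs)² + b² = 1/(1 + s²), the cross term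
vanishing because the noise is centred. -/
lemma mmse_le_linear [IsProbabilityMeasure P] (h : IsGaussNoise ν γ)
    (hP : Integrable (fun x => ‖x‖ ^ 2) P) (hP1 : ∫ x, ‖x‖ ^ 2 ∂P = 1)
    (hγ1 : ∫ z, ‖z‖ ^ 2 ∂γ = 1) (hγ0 : ∫ z, z ∂γ = 0) (s : ℝ) :
    mmse P γ s ≤ (1 + s ^ 2)⁻¹ := by
  have := h.prob
  have hs : (1 + s ^ 2) ≠ 0 := by positivity
  set b := s / (1 + s ^ 2)
  have hiP := integrable_self_of_sq hP
  have hiγ := integrable_self_of_sq h.sq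
  have e : ∀ p : W × W, ‖p.1 - b • (s • p.1 + p.2)‖ ^ 2 =
      (1 - b * s) ^ 2 * ‖p.1‖ ^ 2 + b ^ 2 * ‖p.2‖ ^ 2 -
        2 * (1 - b * s) * b * inner ℝ p.1 p.2 := fun p => by
    have : p.1 - b • (s • p.1 + p.2) = (1 - b * s) • p.1 - b • p.2 := by
      match_scalars <;> ring
    rw [this, norm_sub_sq_real]
    simp only [norm_smul, mul_pow, inner_smul_left, inner_smul_right, Real.norm_eq_abs,
      sq_abs, conj_trivial]
    ring
  have hin : Integrable (fun p : W × W => inner ℝ p.1 p.2) (P.prod γ) := by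
    refine ((h.integrable_fst_sq hP).add (h.integrable_snd_sq (P := P))).mono'
      (by fun_prop) (ae_of_all _ fun p => ?_)
    refine (norm_inner_le_norm p.1 p.2).trans ?_
    simp only [Pi.add_apply]
    nlinarith [sq_nonneg (‖p.1‖ - ‖p.2‖), sq_nonneg ‖p.1‖, sq_nonneg ‖p.2‖]
  have hin0 : ∫ p : W × W, inner ℝ p.1 p.2 ∂(P.prod γ) = 0 := by
    rw [integral_prod _ hin]
    have : ∀ x : W, ∫ z, inner ℝ x z ∂γ = 0 := fun x => by
      rw [integral_inner hiγ, hγ0, inner_zero_right]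
    simp [this]
  have i1 := (h.integrable_fst_sq hP).const_mul ((1 - b * s) ^ 2)
  have i2 := (h.integrable_snd_sq (P := P)).const_mul (b ^ 2)
  have i3 := hin.const_mul (2 * (1 - b * s) * b)
  refine (mmse_le h hP s (g := fun y => b • y) (by fun_prop) ?_).trans (le_of_eq ?_)
  · simp only [e]; exact (i1.add i2).sub i3
  · simp only [e]
    rw [integral_sub (by exact i1.add i2) i3, integral_add i1 i2, integral_const_mul,
      integral_const_mul, integral_const_mul, hin0, integral_fun_fst (fun x : W => ‖x‖ ^ 2),
      integral_fun_snd (fun x : W => ‖x‖ ^ 2), hP1, hγ1]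
    simp only [probReal_univ, one_smul, b]
    field_simp
    ring

end Mmse

end OAMP

namespace OAMP

section Info

variable {W : Type*} [NormedAddCommGroup W] [InnerProductSpace ℝ W] [MeasurableSpace W]
  [BorelSpace W] [SecondCountableTopology W] [CompleteSpace W]
variable {P γ ν : Measure W}

/-! ### The relation between mutual information and minimum mean squared error -/

/-- The mutual information of signal and observation. -/
def info (P γ : Measure W) (s : ℝ) : ℝ :=
  ∫ p, (-‖p.2‖ ^ 2 - Real.log (evid P s (s • p.1 + p.2))) ∂(P.prod γ)

/-- The derivative of the log-evidence `log (evid P s (s x + z))` in `s`. -/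
def evidSlope (P : Measure W) (s : ℝ) (p : W × W) : ℝ :=
  -2 * (inner ℝ (s • p.1 + p.2) p.1 - inner ℝ (s • p.1 + p.2) (pmean P s (s • p.1 + p.2)) -
    s * inner ℝ (pmean P s (s • p.1 + p.2)) p.1 +
    s * postAvg P s (fun x => ‖x‖ ^ 2) (s • p.1 + p.2))

/-- Signal and noise are held fixed, so the observation moves along with the parameter `s`. -/
lemma hasDerivAt_evid [IsProbabilityMeasure P] (hP : Integrable (fun x => ‖x‖ ^ 2) P) (s : ℝ)
    (x z : W) :
    HasDerivAt (fun s : ℝ => evid P s (s • x + z))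
      (∫ x', lik s x' (s • x + z) * (-2 * inner ℝ (s • x + z - s • x') (x - x')) ∂P) s := by
  have hi := integrable_self_of_sq hP
  have hm : ∀ s : ℝ, Measurable fun x' : W => lik s x' (s • x + z) := fun s =>
    (continuous_lik_left s _).measurable
  refine (hasDerivAt_integral_of_dominated_loc_of_deriv_le (s := univ)
    (bound := fun x' => 2 * ‖x - x'‖)
    (F := fun s x' => lik s x' (s • x + z))
    (F' := fun s x' => lik s x' (s • x + z) * (-2 * inner ℝ (s • x + z - s • x') (x - x')))
    univ_mem (Eventually.of_forall fun s => (hm s).aestronglyMeasurable)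
    (integrable_lik s _) ?_ ?_ ?_ ?_).2
  · have := hm s
    exact Measurable.aestronglyMeasurable (by fun_prop)
  · refine ae_of_all _ fun x' t _ => ?_
    rw [norm_mul, Real.norm_of_nonneg (lik_pos _ _ _).le, norm_mul]
    have h1 := norm_inner_le_norm (𝕜 := ℝ) (t • x + z - t • x') (x - x')
    set v := t • x + z - t • x'
    -- The likelihood is `exp (-‖v‖²)`, and r exp(-r²) ≤ 1. This makes the dominating function
    -- independent of `t` and `z`.
    have h2 : lik t x' (t • x + z) * ‖v‖ ≤ 1 := by
      unfold lik
      rw [Real.exp_neg, inv_mul_le_iff₀ (Real.exp_pos _)]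
      have := Real.add_one_le_exp (‖v‖ ^ 2)
      nlinarith [sq_nonneg (‖v‖ - 1)]
    have h3 : 0 < lik t x' (t • x + z) := lik_pos _ _ _
    calc lik t x' (t • x + z) * (‖(-2 : ℝ)‖ * ‖inner ℝ v (x - x')‖)
        ≤ lik t x' (t • x + z) * (2 * (‖v‖ * ‖x - x'‖)) := by
          rw [norm_neg, Real.norm_ofNat]; gcongr
      _ = 2 * ((lik t x' (t • x + z) * ‖v‖) * ‖x - x'‖) := by ring
      _ ≤ 2 * (1 * ‖x - x'‖) := by gcongr
      _ = _ := by ring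
  · exact (((integrable_const x).sub hi).norm).const_mul 2
  · refine ae_of_all _ fun x' t _ => ?_
    have h1 : HasDerivAt (fun t : ℝ => t • x + z - t • x') (x - x') t := by
      have h2 := (((hasDerivAt_id t).smul_const x).add_const z).sub
        ((hasDerivAt_id t).smul_const x')
      simp only [one_smul] at h2
      exact h2
    have h2 := h1.norm_sq.neg.exp
    refine h2.congr_deriv ?_
    simp only [lik, Pi.neg_apply]; ring

/-- The logarithmic derivative of the likelihood is quadratic in `x'`, so its posterior average
involves only the posterior mean and second moment. -/
lemma postAvg_slope [IsProbabilityMeasure P] (hP : Integrable (fun x => ‖x‖ ^ 2) P) (s : ℝ)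
    (x z : W) :
    postAvg P s (fun x' => -2 * inner ℝ (s • x + z - s • x') (x - x')) (s • x + z) =
      evidSlope P s (x, z) := by
  have hi := integrable_self_of_sq hP
  set y := s • x + z with hy
  have e : ∀ x' : W, -2 * inner ℝ (y - s • x') (x - x') =
      (-2 * inner ℝ y x) + ((2 : ℝ) • innerSL ℝ y + (2 * s) • innerSL ℝ x) x' +
        ((-2 * s) • ContinuousLinearMap.id ℝ ℝ) (‖x'‖ ^ 2) := fun x' => by
    simp only [inner_sub_left, inner_sub_right, inner_smul_left, real_inner_self_eq_norm_sq,
      conj_trivial, add_apply, smul_apply, innerSL_apply_apply, smul_eq_mul,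
      ContinuousLinearMap.id_apply, real_inner_comm x x']
    ring
  simp only [e]
  have hl : Integrable (fun x' => ((2 : ℝ) • innerSL ℝ y + (2 * s) • innerSL ℝ x) x') P :=
    ContinuousLinearMap.integrable_comp _ hi
  have hq : Integrable (fun x' : W => ((-2 * s) • ContinuousLinearMap.id ℝ ℝ) (‖x'‖ ^ 2)) P :=
    ContinuousLinearMap.integrable_comp _ hP
  rw [postAvg_add (f := fun x' => (-2 * inner ℝ y x) +
      ((2 : ℝ) • innerSL ℝ y + (2 * s) • innerSL ℝ x) x')
    ((integrable_const _).add hl) hq, postAvg_add (integrable_const _) hl, postAvg_const,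
    postAvg_clm _ hi, postAvg_clm _ hP]
  simp only [evidSlope, pmean, add_apply, smul_apply,
    innerSL_apply_apply, smul_eq_mul, ContinuousLinearMap.id_apply, ← hy]
  rw [real_inner_comm x (postAvg P s (fun x => x) y)]
  ring

lemma hasDerivAt_log_evid [IsProbabilityMeasure P] (hP : Integrable (fun x => ‖x‖ ^ 2) P) (s : ℝ)
    (p : W × W) :
    HasDerivAt (fun s : ℝ => Real.log (evid P s (s • p.1 + p.2))) (evidSlope P s p) s := by
  convert (hasDerivAt_evid hP s p.1 p.2).log (evid_pos _ _).ne' using 1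
  rw [← postAvg_slope hP]
  simp only [postAvg, smul_eq_mul]
  rw [inv_mul_eq_div]

lemma continuous_evidSlope [IsProbabilityMeasure P] (hP : Integrable (fun x => ‖x‖ ^ 2) P)
    (p : W × W) : Continuous fun s => evidSlope P s p := by
  have h1 : Continuous fun s : ℝ => pmean P s (s • p.1 + p.2) :=
    continuous_postAvg (integrable_self_of_sq hP) p.1 p.2
  have h2 : Continuous fun s : ℝ => postAvg P s (fun x => ‖x‖ ^ 2) (s • p.1 + p.2) :=
    continuous_postAvg hP p.1 p.2
  unfold evidSlope
  fun_prop

lemma measurable_evidSlope [SFinite P] :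
    Measurable fun q : ℝ × W × W => evidSlope P q.1 q.2 := by
  have h1 : Measurable fun q : ℝ × W × W => pmean P q.1 (q.1 • q.2.1 + q.2.2) :=
    (stronglyMeasurable_pmean (P := P)).measurable.comp
      (f := fun q : ℝ × W × W => (q.1, q.1 • q.2.1 + q.2.2)) (by fun_prop)
  have h2 : Measurable fun q : ℝ × W × W =>
      postAvg P q.1 (fun x => ‖x‖ ^ 2) (q.1 • q.2.1 + q.2.2) := by
    refine (stronglyMeasurable_postAvg (Z := ℝ × W × W) (f := fun _ x => ‖x‖ ^ 2) ?_
      measurable_fst (by fun_prop)).measurable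
    exact Measurable.stronglyMeasurable (by simp only [Function.uncurry_def]; fun_prop)
  unfold evidSlope
  fun_prop

lemma abs_real_inner_le_half (u v : W) : |inner ℝ u v| ≤ (‖u‖ ^ 2 + ‖v‖ ^ 2) / 2 :=
  (abs_real_inner_le_norm u v).trans (by nlinarith [sq_nonneg (‖u‖ - ‖v‖)])

/-- Meant for Fubini on `(0, S]`: the coefficients are uniform in `s`, and the one term that still
depends on `s`, the posterior second moment, has expectation E‖x‖² for every `s`. -/
lemma abs_evidSlope_le [IsProbabilityMeasure P] (hP : Integrable (fun x => ‖x‖ ^ 2) P)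
    {s S : ℝ} (hs : s ∈ Icc 0 S) (p : W × W) :
    ‖evidSlope P s p‖ ≤ (4 * S ^ 2 + 1 + S) * ‖p.1‖ ^ 2 + 4 * ‖p.2‖ ^ 2 +
      (1 + 3 * S) * postAvg P s (fun x => ‖x‖ ^ 2) (s • p.1 + p.2) := by
  obtain ⟨h0, h1⟩ := hs
  set y := s • p.1 + p.2 with hy
  have hA := sq_norm_pmean_le hP s y
  set A := postAvg P s (fun x => ‖x‖ ^ 2) y
  set m := pmean P s y
  have hA0 : 0 ≤ A := (sq_nonneg _).trans hA
  have hyn : ‖y‖ ^ 2 ≤ 2 * S ^ 2 * ‖p.1‖ ^ 2 + 2 * ‖p.2‖ ^ 2 := by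
    have h2 : ‖y‖ ≤ S * ‖p.1‖ + ‖p.2‖ := by
      refine (norm_add_le _ _).trans ?_
      rw [norm_smul, Real.norm_of_nonneg h0]; gcongr
    calc ‖y‖ ^ 2 ≤ (S * ‖p.1‖ + ‖p.2‖) ^ 2 := by gcongr
      _ ≤ _ := by nlinarith [sq_nonneg (S * ‖p.1‖ - ‖p.2‖)]
  have i1 := abs_real_inner_le_half y p.1
  have i2 := abs_real_inner_le_half y m
  have i3 := mul_le_mul h1 (abs_real_inner_le_half m p.1) (abs_nonneg _) (h0.trans h1)
  have i4 : s * A ≤ S * A := mul_le_mul_of_nonneg_right h1 hA0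
  have i5 : S * ‖m‖ ^ 2 ≤ S * A := mul_le_mul_of_nonneg_left hA (h0.trans h1)
  have key : ‖evidSlope P s p‖ ≤ 2 * (|inner ℝ y p.1| + |inner ℝ y m| + s * |inner ℝ m p.1| +
      s * A) := by
    rw [evidSlope, ← hy, norm_mul, norm_neg, Real.norm_ofNat]
    gcongr
    refine (norm_add_le _ _).trans (add_le_add ((norm_sub_le _ _).trans
      (add_le_add (norm_sub_le _ _) ?_)) ?_)
    · rw [norm_mul, Real.norm_of_nonneg h0]; rfl
    · rw [Real.norm_of_nonneg (mul_nonneg h0 hA0)]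
  nlinarith

lemma integrable_evidSlope_bound [IsProbabilityMeasure P] (h : IsGaussNoise ν γ)
    (hP : Integrable (fun x => ‖x‖ ^ 2) P) (s S : ℝ) :
    Integrable (fun p : W × W => (4 * S ^ 2 + 1 + S) * ‖p.1‖ ^ 2 + 4 * ‖p.2‖ ^ 2 +
      (1 + 3 * S) * postAvg P s (fun x => ‖x‖ ^ 2) (s • p.1 + p.2)) (P.prod γ) ∧
    ∫ p : W × W, ((4 * S ^ 2 + 1 + S) * ‖p.1‖ ^ 2 + 4 * ‖p.2‖ ^ 2 +
      (1 + 3 * S) * postAvg P s (fun x => ‖x‖ ^ 2) (s • p.1 + p.2)) ∂(P.prod γ) =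
      (4 * S ^ 2 + 1 + S) * ∫ x, ‖x‖ ^ 2 ∂P + 4 * ∫ z, ‖z‖ ^ 2 ∂γ +
        (1 + 3 * S) * ∫ x, ‖x‖ ^ 2 ∂P := by
  have := h.prob
  have j1 := (h.integrable_fst_sq hP).const_mul (4 * S ^ 2 + 1 + S)
  have j2 := (h.integrable_snd_sq (P := P)).const_mul 4
  have j3 := (h.integrable_postAvg_sq hP s).1.const_mul (1 + 3 * S)
  refine ⟨(j1.add j2).add j3, ?_⟩
  rw [integral_add (by exact j1.add j2) j3, integral_add j1 j2, integral_const_mul,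
    integral_const_mul, integral_const_mul, (h.integrable_postAvg_sq hP s).2,
    integral_fun_fst (fun x : W => ‖x‖ ^ 2), integral_fun_snd (fun x : W => ‖x‖ ^ 2)]
  simp

lemma integrable_evidSlope [IsProbabilityMeasure P] (h : IsGaussNoise ν γ)
    (hP : Integrable (fun x => ‖x‖ ^ 2) P) {S : ℝ} :
    Integrable (fun q : ℝ × W × W => evidSlope P q.1 q.2)
      ((volume.restrict (Ioc 0 S)).prod (P.prod γ)) := by
  have := h.prob
  have hm := measurable_evidSlope (P := P)
  rw [integrable_prod_iff hm.aestronglyMeasurable]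
  have hs : ∀ᵐ s ∂(volume.restrict (Ioc 0 S)), s ∈ Icc 0 S := by
    filter_upwards [ae_restrict_mem measurableSet_Ioc] with s hs using Ioc_subset_Icc_self hs
  have hsl : ∀ s ∈ Icc 0 S, Integrable (fun p => evidSlope P s p) (P.prod γ) := fun s hs =>
    (integrable_evidSlope_bound h hP s S).1.mono'
      (hm.comp measurable_prodMk_left).aestronglyMeasurable
      (ae_of_all _ fun p => abs_evidSlope_le hP hs p)
  refine ⟨hs.mono hsl, ?_⟩
  refine Integrable.mono' (integrable_const ((4 * S ^ 2 + 1 + S) * ∫ x, ‖x‖ ^ 2 ∂P +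
    4 * ∫ z, ‖z‖ ^ 2 ∂γ + (1 + 3 * S) * ∫ x, ‖x‖ ^ 2 ∂P)) ?_ ?_
  · exact (StronglyMeasurable.integral_prod_right (f := fun s p => ‖evidSlope P s p‖)
      (by exact hm.stronglyMeasurable.norm)).aestronglyMeasurable
  · filter_upwards [hs] with s hs
    rw [Real.norm_of_nonneg (integral_nonneg fun _ => norm_nonneg _),
      ← (integrable_evidSlope_bound h hP s S).2]
    exact integral_mono (hsl s hs).norm (integrable_evidSlope_bound h hP s S).1
      fun p => abs_evidSlope_le hP hs p

/-- Under the expectation ⟨y, x⟩ and ⟨y, E[x|y]⟩ cancel, and ⟨E[x|y], x⟩ becomes ‖E[x|y]‖². What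
remains is -2s (E‖x‖² - E‖E[x|y]‖²). No integration by parts in the noise is needed. -/
lemma integral_evidSlope [IsProbabilityMeasure P] (h : IsGaussNoise ν γ)
    (hP : Integrable (fun x => ‖x‖ ^ 2) P) (s : ℝ) :
    ∫ p, evidSlope P s p ∂(P.prod γ) = -(2 * s * mmse P γ s) := by
  have := h.prob
  have hi := integrable_self_of_sq hP
  have hfs := h.integrable_fst_sq hP
  have hss := h.integrable_snd_sq (P := P)
  have hpm := measurable_pmean (P := P) s
  have hpo := measurable_pmean_obs (P := P) s
  have hy2 : Integrable (fun p : W × W => ‖s • p.1 + p.2‖ ^ 2) (P.prod γ) := by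
    refine ((hfs.const_mul (2 * s ^ 2)).add (hss.const_mul 2)).mono' (by fun_prop)
      (ae_of_all _ fun p => ?_)
    rw [Real.norm_of_nonneg (by positivity)]
    have h2 : ‖s • p.1 + p.2‖ ≤ |s| * ‖p.1‖ + ‖p.2‖ := by
      refine (norm_add_le _ _).trans ?_
      rw [norm_smul, Real.norm_eq_abs]
    simp only [Pi.add_apply]
    calc ‖s • p.1 + p.2‖ ^ 2 ≤ (|s| * ‖p.1‖ + ‖p.2‖) ^ 2 := by gcongr
      _ ≤ _ := by nlinarith [sq_nonneg (|s| * ‖p.1‖ - ‖p.2‖), sq_abs s]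
  have hin : ∀ {f g : W × W → W}, Measurable f → Measurable g →
      Integrable (fun p => ‖f p‖ ^ 2) (P.prod γ) → Integrable (fun p => ‖g p‖ ^ 2) (P.prod γ) →
      Integrable (fun p => inner ℝ (f p) (g p)) (P.prod γ) := fun {f g} hf hg hf2 hg2 =>
    ((hf2.add hg2).div_const 2).mono' (hf.inner hg).aestronglyMeasurable
      (ae_of_all _ fun p => by exact abs_real_inner_le_half (f p) (g p))
  have hms := h.integrable_pmean_sq hP s
  have hyx := hin (f := fun p => s • p.1 + p.2) (g := fun p => p.1) (by fun_prop) (by fun_prop)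
    hy2 hfs
  have hmx := hin (f := fun p => pmean P s (s • p.1 + p.2)) (g := fun p => p.1) hpo
    (by fun_prop) hms hfs
  have k1 := integrable_postAvg_and_integral (G := fun x y : W => inner ℝ y x) h s
    (Measurable.stronglyMeasurable (by simp only [Function.uncurry_def]; fun_prop)) hyx
  have k2 := integrable_postAvg_and_integral (G := fun x y : W => inner ℝ (pmean P s y) x) h s
    (Measurable.stronglyMeasurable (by simp only [Function.uncurry_def]; fun_prop)) hmx
  have k3 := h.integrable_postAvg_sq hP s
  have e1 : ∀ u y : W, postAvg P s (fun x => inner ℝ u x) y = inner ℝ u (pmean P s y) :=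
    fun u y => postAvg_clm (innerSL ℝ u) hi s y
  simp only [e1] at k1 k2
  have hsum : ∀ p, evidSlope P s p = -2 * (inner ℝ (s • p.1 + p.2) p.1 -
      inner ℝ (s • p.1 + p.2) (pmean P s (s • p.1 + p.2)) -
      s * inner ℝ (pmean P s (s • p.1 + p.2)) p.1 +
      s * postAvg P s (fun x => ‖x‖ ^ 2) (s • p.1 + p.2)) := fun p => rfl
  simp only [hsum]
  rw [integral_const_mul, integral_add (by exact (hyx.sub k1.1).sub (hmx.const_mul s))
    (k3.1.const_mul s), integral_sub (by exact hyx.sub k1.1) (hmx.const_mul s),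
    integral_sub hyx k1.1, k1.2, integral_const_mul, integral_const_mul, k3.2, ← k2.2,
    mmse_eq h hP]
  simp only [real_inner_self_eq_norm_sq]
  ring

lemma evid_zero [IsProbabilityMeasure P] (y : W) : evid P 0 y = Real.exp (-‖y‖ ^ 2) := by
  simp [evid, lik]

/-- At `s = 0` the evidence is exactly `exp (-‖z‖²)`, so this is the fundamental theorem of calculus
along the path `s • x + z`. -/
lemma neg_sub_log_evid_eq [IsProbabilityMeasure P] (hP : Integrable (fun x => ‖x‖ ^ 2) P) (S : ℝ)
    (p : W × W) : -‖p.2‖ ^ 2 - Real.log (evid P S (S • p.1 + p.2)) =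
      -∫ s in (0 : ℝ)..S, evidSlope P s p := by
  rw [intervalIntegral.integral_eq_sub_of_hasDerivAt (fun s _ => hasDerivAt_log_evid hP s p)
    ((continuous_evidSlope hP p).intervalIntegrable _ _), evid_zero, Real.log_exp]
  simp [sub_eq_add_neg, add_comm]

lemma info_eq_integral [IsProbabilityMeasure P] (h : IsGaussNoise ν γ)
    (hP : Integrable (fun x => ‖x‖ ^ 2) P) {S : ℝ} (hS : 0 ≤ S) :
    info P γ S = ∫ s in (0 : ℝ)..S, 2 * s * mmse P γ s := by
  have := h.prob
  have hsw := integral_integral_swap (f := fun s p => evidSlope P s p)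
    (integrable_evidSlope h hP (S := S))
  unfold info
  simp only [neg_sub_log_evid_eq hP, intervalIntegral.integral_of_le hS]
  rw [integral_neg, ← hsw, ← integral_neg]
  congr 1; ext s
  rw [integral_evidSlope h hP, neg_neg]

/-- The mutual information is the integral of the minimum mean squared error over the
signal-to-noise ratio. -/
lemma info_sqrt_eq_integral [IsProbabilityMeasure P] (h : IsGaussNoise ν γ)
    (hP : Integrable (fun x => ‖x‖ ^ 2) P) {R : ℝ} (hR : 0 ≤ R) :
    info P γ (Real.sqrt R) = ∫ ρ in (0 : ℝ)..R, mmse P γ (Real.sqrt ρ) := by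
  have hc := continuous_mmse h hP
  rw [info_eq_integral h hP (Real.sqrt_nonneg R)]
  have := intervalIntegral.integral_comp_mul_deriv (a := 0) (b := Real.sqrt R)
    (f := fun s => s ^ 2) (f' := fun s => 2 * s) (g := fun ρ => mmse P γ (Real.sqrt ρ))
    (fun s _ => by simpa using hasDerivAt_pow 2 s) (by fun_prop) (by fun_prop)
  simp only [Real.sq_sqrt hR] at this
  rw [show (0 : ℝ) ^ 2 = 0 by norm_num] at this
  rw [← this]
  refine intervalIntegral.integral_congr fun s hs => ?_
  rw [uIcc_of_le (Real.sqrt_nonneg R)] at hs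
  simp only [Function.comp, Real.sqrt_sq hs.1]
  ring

/-! #### Discrete signals -/

lemma measureReal_mul_exp_le_evid [IsProbabilityMeasure P] (s : ℝ) (x z : W) :
    P.real {x} * Real.exp (-‖z‖ ^ 2) ≤ evid P s (s • x + z) := by
  have h1 : ∫ x' in {x}, lik s x' (s • x + z) ∂P = P.real {x} * Real.exp (-‖z‖ ^ 2) := by
    rw [integral_singleton]; simp [lik]
  rw [← h1]
  exact setIntegral_le_integral (integrable_lik s _) (ae_of_all _ fun x' => (lik_pos _ _ _).le)

/-- As `s` grows, every `x' ≠ x` lies infinitely far from the observation on the scale of the noise,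
and only the atom at `x` keeps its likelihood. -/
lemma tendsto_evid [IsProbabilityMeasure P] (x z : W) :
    Tendsto (fun s : ℝ => evid P s (s • x + z)) atTop
      (𝓝 (P.real {x} * Real.exp (-‖z‖ ^ 2))) := by
  have h1 : ∫ x', ({x} : Set W).indicator (fun _ => Real.exp (-‖z‖ ^ 2)) x' ∂P =
      P.real {x} * Real.exp (-‖z‖ ^ 2) := by
    rw [integral_indicator (measurableSet_singleton x), integral_singleton]; rfl
  rw [← h1]
  refine tendsto_integral_filter_of_dominated_convergence (fun _ => 1)
    (Eventually.of_forall fun s => (integrable_lik s _).aestronglyMeasurable)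
    (Eventually.of_forall fun s => ae_of_all _ fun x' => norm_lik_le _ _ _)
    (integrable_const _) (ae_of_all _ fun x' => ?_)
  by_cases hx : x' = x
  · subst hx; simp [lik]
  · rw [indicator_of_notMem (by simpa using hx)]
    unfold lik
    refine Real.tendsto_exp_neg_atTop_nhds_zero.comp ?_
    have h2 : 0 < ‖x - x'‖ := norm_pos_iff.2 (sub_ne_zero.2 (Ne.symm hx))
    have h3 : Tendsto (fun s : ℝ => s * ‖x - x'‖ - ‖z‖) atTop atTop :=
      tendsto_atTop_add_const_right _ _ (tendsto_id.atTop_mul_const h2)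
    refine (tendsto_pow_atTop two_ne_zero).comp (tendsto_atTop_mono' _ ?_ h3)
    filter_upwards [eventually_ge_atTop 0] with s hs
    have h4 : s • x + z - s • x' = s • (x - x') + z := by rw [smul_sub]; abel
    have h5 := norm_sub_le_norm_add (s • (x - x')) z
    rw [norm_smul, Real.norm_of_nonneg hs] at h5
    rw [h4]; exact h5

/-- The atom at the true signal bounds the evidence below by `δ exp (-‖z‖²)`, and 1 bounds it above.
The result is a dominating function free of `s`. -/
lemma norm_neg_sub_log_evid_le [IsProbabilityMeasure P] {δ : ℝ} (hδ : 0 < δ) (s : ℝ) {x : W}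
    (hx : δ ≤ P.real {x}) (z : W) :
    ‖-‖z‖ ^ 2 - Real.log (evid P s (s • x + z))‖ ≤ ‖z‖ ^ 2 - Real.log δ := by
  have h1 := measureReal_mul_exp_le_evid (P := P) s x z
  have h2 := Real.log_nonpos (evid_pos (P := P) s (s • x + z)).le (evid_le_one s _)
  have h3 : δ * Real.exp (-‖z‖ ^ 2) ≤ evid P s (s • x + z) :=
    (mul_le_mul_of_nonneg_right hx (Real.exp_pos _).le).trans h1
  have h4 := Real.log_le_log (mul_pos hδ (Real.exp_pos _)) h3
  rw [Real.log_mul hδ.ne' (Real.exp_pos _).ne', Real.log_exp] at h4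
  have h5 : Real.log δ ≤ 0 := Real.log_nonpos hδ.le (hx.trans measureReal_le_one)
  rw [Real.norm_eq_abs, abs_le]
  constructor <;> nlinarith [sq_nonneg ‖z‖]

/-- For a discrete signal with finitely many values the information tends to the entropy. -/
lemma tendsto_info_atTop [IsProbabilityMeasure P] (h : IsGaussNoise ν γ) {δ : ℝ} (hδ : 0 < δ)
    (hat : ∀ᵐ x ∂P, δ ≤ P.real {x}) :
    Tendsto (fun s => info P γ s) atTop (𝓝 (∫ x, -Real.log (P.real {x}) ∂P)) := by
  have := h.prob
  have hat2 : ∀ᵐ p ∂(P.prod γ), δ ≤ P.real {p.1} :=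
    Measure.quasiMeasurePreserving_fst.ae hat
  have hev : ∀ s : ℝ, Measurable fun p : W × W => evid P s (s • p.1 + p.2) := fun s =>
    (stronglyMeasurable_evid (P := P)).measurable.comp
      (f := fun p : W × W => (s, s • p.1 + p.2)) (by fun_prop)
  have h1 : ∫ x, -Real.log (P.real {x}) ∂P =
      ∫ p, -Real.log (P.real {p.1}) ∂(P.prod γ) := by
    rw [integral_fun_fst (fun x : W => -Real.log (P.real {x}))]; simp
  rw [h1]
  refine tendsto_integral_filter_of_dominated_convergence
    (fun p : W × W => ‖p.2‖ ^ 2 - Real.log δ) (Eventually.of_forall fun s => ?_)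
    (Eventually.of_forall fun s => ?_)
    (h.integrable_snd_sq.sub (integrable_const _)) ?_
  · have := hev s
    exact Measurable.aestronglyMeasurable (by fun_prop)
  · filter_upwards [hat2] with p hp using norm_neg_sub_log_evid_le hδ s hp p.2
  · filter_upwards [hat2] with p hp
    have hp0 : 0 < P.real {p.1} := hδ.trans_le hp
    have h2 := ((tendsto_evid (P := P) p.1 p.2).log
      (mul_pos hp0 (Real.exp_pos _)).ne').const_sub (-‖p.2‖ ^ 2)
    convert h2 using 2
    rw [Real.log_mul hp0.ne' (Real.exp_pos _).ne', Real.log_exp]; ring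

/-- The error of a discrete signal with finitely many values is integrable over the
signal-to-noise ratio, and its integral is the entropy. -/
lemma integrableOn_mmse_and_integral [IsProbabilityMeasure P] (h : IsGaussNoise ν γ)
    (hP : Integrable (fun x => ‖x‖ ^ 2) P) {δ : ℝ} (hδ : 0 < δ)
    (hat : ∀ᵐ x ∂P, δ ≤ P.real {x}) :
    IntegrableOn (fun ρ => mmse P γ (Real.sqrt ρ)) (Ioi 0) ∧
      ∫ ρ in Ioi 0, mmse P γ (Real.sqrt ρ) = ∫ x, -Real.log (P.real {x}) ∂P := by
  have hc := continuous_mmse h hP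
  have hlim : Tendsto (fun R : ℝ => ∫ ρ in (0 : ℝ)..R, mmse P γ (Real.sqrt ρ)) atTop
      (𝓝 (∫ x, -Real.log (P.real {x}) ∂P)) := by
    refine ((tendsto_info_atTop h hδ hat).comp Real.tendsto_sqrt_atTop).congr' ?_
    filter_upwards [eventually_ge_atTop 0] with R hR
    exact info_sqrt_eq_integral h hP hR
  have hi : IntegrableOn (fun ρ => mmse P γ (Real.sqrt ρ)) (Ioi 0) := by
    refine integrableOn_Ioi_of_intervalIntegral_norm_tendsto
      (∫ x, -Real.log (P.real {x}) ∂P) 0 (b := id) (l := atTop) (fun R => ?_) tendsto_id ?_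
    · exact (Continuous.integrableOn_Icc (by fun_prop)).mono_set Ioc_subset_Icc_self
    · simpa only [Real.norm_of_nonneg (mmse_nonneg P γ _), id] using hlim
  exact ⟨hi, tendsto_nhds_unique (intervalIntegral_tendsto_integral_Ioi 0 hi tendsto_id) hlim⟩

/-! #### Kullback-Leibler divergence -/

/-- With respect to the product of the marginals the joint law has the density likelihood over
evidence, whose logarithm at `(x, s • x + z)` is the integrand of `info`. -/
lemma toReal_klDiv_eq_info [IsProbabilityMeasure P] (h : IsGaussNoise ν γ) (s : ℝ) :
    (InformationTheory.klDiv ((P.prod γ).map fun p => (p.1, s • p.1 + p.2))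
      (P.prod ((P.prod γ).map fun p => s • p.1 + p.2))).toReal = info P γ s := by
  have := h.prob
  have := h.sigmaFinite
  have hf : Measurable fun p : W × W => (p.1, s • p.1 + p.2) := by fun_prop
  have hg : Measurable fun p : W × W => s • p.1 + p.2 := by fun_prop
  have hl : Measurable fun q : W × W => lik s q.1 q.2 := (continuous_lik_pair s).measurable
  have hev : Measurable fun y => evid P s y :=
    (stronglyMeasurable_evid (P := P)).measurable.comp (f := fun y : W => (s, y))
      measurable_prodMk_left
  set J := (P.prod γ).map fun p => (p.1, s • p.1 + p.2) with hJ
  set PY := (P.prod γ).map fun p => s • p.1 + p.2 with hPY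
  have : IsProbabilityMeasure J := Measure.isProbabilityMeasure_map hf.aemeasurable
  have : IsProbabilityMeasure PY := Measure.isProbabilityMeasure_map hg.aemeasurable
  have hPY2 : PY = ν.withDensity fun y => ENNReal.ofReal (evid P s y) := by
    have h1 : PY = J.map Prod.snd := by
      rw [hJ, Measure.map_map measurable_snd hf]; rfl
    ext B hB
    rw [h1, Measure.map_apply measurable_snd hB, hJ, map_joint h,
      withDensity_apply _ (measurable_snd hB), withDensity_apply _ hB]
    have h2 : (Prod.snd ⁻¹' B : Set (W × W)) = univ ×ˢ B := by ext; simp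
    rw [h2, setLIntegral_prod_symm _ (by fun_prop)]
    simp only [Measure.restrict_univ]
    refine lintegral_congr fun y => ?_
    rw [evid, ofReal_integral_eq_lintegral_ofReal (integrable_lik s y)
      (ae_of_all _ fun x => (lik_pos _ _ _).le)]
  set r : W × W → ENNReal := fun q => ENNReal.ofReal (lik s q.1 q.2 / evid P s q.2) with hr
  have hrm : Measurable r := by fun_prop
  have hJ2 : J = (P.prod PY).withDensity r := by
    rw [hPY2, prod_withDensity_right (by fun_prop), ← withDensity_mul _ (by fun_prop) hrm, hJ,
      map_joint h]
    congr 1; ext q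
    simp only [hr, Pi.mul_apply]
    rw [← ENNReal.ofReal_mul (evid_pos s q.2).le, mul_div_cancel₀ _ (evid_pos s q.2).ne']
  have hac : J ≪ P.prod PY := by
    rw [hJ2]; exact withDensity_absolutelyContinuous _ _
  rw [InformationTheory.toReal_klDiv_of_measure_eq hac (by simp)]
  have hllr : llr J (P.prod PY) =ᵐ[J] fun q => Real.log (lik s q.1 q.2 / evid P s q.2) := by
    have h1 : J.rnDeriv (P.prod PY) =ᵐ[J] r := by
      have h2 := Measure.rnDeriv_withDensity (P.prod PY) hrm
      rw [← hJ2] at h2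
      exact hac.ae_le h2
    filter_upwards [h1] with q hq
    rw [llr, hq, ENNReal.toReal_ofReal (div_nonneg (lik_pos _ _ _).le (evid_pos _ _).le)]
  rw [integral_congr_ae hllr, hJ, integral_map hf.aemeasurable
    (Measurable.aestronglyMeasurable (by fun_prop)), info]
  congr 1; ext p
  rw [Real.log_div (lik_pos _ _ _).ne' (evid_pos _ _).ne']
  simp [lik]

end Info

end OAMP

namespace OAMP

/-! ### Complex Gaussian noise -/

lemma map_withDensity_comp {Ω Ω' : Type*} [MeasurableSpace Ω] [MeasurableSpace Ω']
    {Q : Measure Ω} {Q' : Measure Ω'} {e : Ω → Ω'} (he : MeasurePreserving e Q Q')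
    {f : Ω' → ENNReal} (hf : Measurable f) :
    (Q.withDensity (f ∘ e)).map e = Q'.withDensity f := by
  ext B hB
  rw [Measure.map_apply he.measurable hB, withDensity_apply _ (he.measurable hB),
    withDensity_apply _ hB, ← he.setLIntegral_comp_preimage hB hf]
  rfl

/-- The translation-invariant reference measure for `CN(0, 1)`. -/
def refMeasure : Measure ℂ := (Real.toNNReal Real.pi⁻¹) • volume

instance : SigmaFinite refMeasure := by unfold refMeasure; infer_instance

instance : refMeasure.IsAddLeftInvariant := by
  change (((Real.toNNReal Real.pi⁻¹ : NNReal) : ENNReal) • (volume : Measure ℂ)).IsAddLeftInvariant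
  infer_instance

instance (v : NNReal) : IsProbabilityMeasure (cgauss v) :=
  Measure.isProbabilityMeasure_map (by
    exact Complex.measurableEquivRealProd.symm.measurable.aemeasurable)

lemma norm_sq_mk (p : ℝ × ℝ) : ‖({ re := p.1, im := p.2 } : ℂ)‖ ^ 2 = p.1 ^ 2 + p.2 ^ 2 := by
  rw [← Complex.normSq_eq_norm_sq, Complex.normSq_mk]; ring

/-- Variance 1/2 per real coordinate makes the exponent exactly -‖z‖²; the constant 1/π is absorbed
into `refMeasure`. -/
lemma cgauss_one_eq : cgauss 1 =
    refMeasure.withDensity fun z => ENNReal.ofReal (Real.exp (-‖z‖ ^ 2)) := by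
  have hv : (1 / 2 : NNReal) ≠ 0 := by norm_num
  have hm : Measurable fun z : ℂ => ENNReal.ofReal (Real.exp (-‖z‖ ^ 2)) := by fun_prop
  have he := Complex.volume_preserving_equiv_real_prod.symm
  have h1 : refMeasure.withDensity (fun z => ENNReal.ofReal (Real.exp (-‖z‖ ^ 2))) =
      (volume : Measure ℂ).withDensity
        (fun z => ENNReal.ofReal (Real.pi⁻¹ * Real.exp (-‖z‖ ^ 2))) := by
    rw [refMeasure]
    change (((Real.toNNReal Real.pi⁻¹ : NNReal) : ENNReal) • (volume : Measure ℂ)).withDensity _ = _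
    rw [withDensity_smul_measure, ← withDensity_smul _ hm]
    congr 1; ext z
    simp only [Pi.smul_apply, smul_eq_mul]
    rw [ENNReal.ofReal_mul (by positivity)]
    rfl
  rw [h1, cgauss, gaussianReal_of_var_ne_zero _ hv,
    prod_withDensity (measurable_gaussianPDF _ _) (measurable_gaussianPDF _ _)]
  rw [← map_withDensity_comp he (by fun_prop)]
  have h2 : (fun p : ℝ × ℝ => gaussianPDF 0 (1 / 2) p.1 * gaussianPDF 0 (1 / 2) p.2) =
      (fun z : ℂ => ENNReal.ofReal (Real.pi⁻¹ * Real.exp (-‖z‖ ^ 2))) ∘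
        Complex.measurableEquivRealProd.symm := by
    ext p
    simp only [Function.comp, gaussianPDF, gaussianPDFReal,
      Complex.measurableEquivRealProd_symm_apply]
    rw [← ENNReal.ofReal_mul (by positivity)]
    congr 1
    rw [norm_sq_mk]
    have h4 : 2 * Real.pi * ((1 / 2 : NNReal) : ℝ) = Real.pi := by push_cast; ring
    have h5 : (2 * ((1 / 2 : NNReal) : ℝ)) = 1 := by push_cast; ring
    rw [h4, h5, mul_mul_mul_comm, ← Real.exp_add, ← mul_inv,
      Real.mul_self_sqrt Real.pi_pos.le]
    congr 2; ring
  rw [h2]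
  rfl

lemma integral_cgauss {E : Type*} [NormedAddCommGroup E] [NormedSpace ℝ E] (f : ℂ → E)
    (v : NNReal) :
    ∫ z, f z ∂(cgauss v) = ∫ p, f ⟨p.1, p.2⟩
      ∂((gaussianReal 0 (v / 2)).prod (gaussianReal 0 (v / 2))) :=
  integral_map_equiv Complex.measurableEquivRealProd.symm f

lemma integrable_cgauss_iff {E : Type*} [NormedAddCommGroup E] (f : ℂ → E) (v : NNReal) :
    Integrable f (cgauss v) ↔ Integrable (fun p : ℝ × ℝ => f ⟨p.1, p.2⟩)
      ((gaussianReal 0 (v / 2)).prod (gaussianReal 0 (v / 2))) :=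
  integrable_map_equiv Complex.measurableEquivRealProd.symm f

lemma integrable_sq_gaussianReal (v : NNReal) : Integrable (fun x => x ^ 2) (gaussianReal 0 v) :=
  (memLp_id_gaussianReal (μ := 0) (v := v) 2).integrable_sq

lemma integral_sq_gaussianReal (v : NNReal) : ∫ x, x ^ 2 ∂(gaussianReal 0 v) = v := by
  have h1 := variance_id_gaussianReal (μ := 0) (v := v)
  rw [variance_of_integral_eq_zero (by fun_prop) (by simp)] at h1
  exact h1

lemma integrable_sq_cgauss (v : NNReal) : Integrable (fun z => ‖z‖ ^ 2) (cgauss v) := by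
  rw [integrable_cgauss_iff]
  simp only [norm_sq_mk]
  exact ((integrable_sq_gaussianReal _).comp_fst _).add ((integrable_sq_gaussianReal _).comp_snd _)

lemma integral_sq_cgauss_one : ∫ z, ‖z‖ ^ 2 ∂(cgauss 1) = 1 := by
  rw [integral_cgauss]
  simp only [norm_sq_mk]
  rw [integral_add ((integrable_sq_gaussianReal _).comp_fst _)
    ((integrable_sq_gaussianReal _).comp_snd _), integral_fun_fst (fun x : ℝ => x ^ 2),
    integral_fun_snd (fun x : ℝ => x ^ 2), integral_sq_gaussianReal]
  simp; norm_num

lemma integral_cgauss_one : ∫ z, z ∂(cgauss 1) = 0 := by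
  have hi : Integrable (fun z : ℂ => z) (cgauss 1) := integrable_self_of_sq (integrable_sq_cgauss 1)
  apply Complex.ext
  · have h1 := integral_re (𝕜 := ℂ) hi
    simp only [RCLike.re_to_complex] at h1
    rw [← h1, integral_cgauss, integral_fun_fst (fun x : ℝ => x)]
    simp
  · have h1 := integral_im (𝕜 := ℂ) hi
    simp only [RCLike.im_to_complex] at h1
    rw [← h1, integral_cgauss, integral_fun_snd (fun x : ℝ => x)]
    simp

lemma isGaussNoise_cgauss : IsGaussNoise refMeasure (cgauss 1) where
  sigmaFinite := inferInstance
  invariant := inferInstance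
  density := cgauss_one_eq
  prob := inferInstance
  sq := integrable_sq_cgauss 1

instance (n : ℕ) (v : NNReal) : IsProbabilityMeasure (cgaussVec n v) := by
  unfold cgaussVec; infer_instance

/-- The law `CN(0, I)` on the Euclidean space `ℂⁿ`. -/
def cgaussEuclid (n : ℕ) : Measure (EuclideanSpace ℂ (Fin n)) :=
  (cgaussVec n 1).map (MeasurableEquiv.toLp 2 (Fin n → ℂ))

/-- The translation-invariant reference measure for `CN(0, I)`. -/
def refMeasureEuclid (n : ℕ) : Measure (EuclideanSpace ℂ (Fin n)) :=
  (Measure.pi fun _ => refMeasure).map (MeasurableEquiv.toLp 2 (Fin n → ℂ))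

lemma cgaussVec_one_eq (n : ℕ) : cgaussVec n 1 = (Measure.pi fun _ => refMeasure).withDensity
    fun z => ENNReal.ofReal (Real.exp (-∑ i, ‖z i‖ ^ 2)) := by
  set g : ℂ → ℝ := fun z => Real.exp (-‖z‖ ^ 2) with hg
  have hgm : Measurable g := by fun_prop
  have hgi : Integrable g refMeasure := by
    refine ⟨hgm.aestronglyMeasurable, ?_⟩
    rw [hasFiniteIntegral_iff_ofReal (ae_of_all _ fun z => (Real.exp_pos _).le)]
    have h1 : cgauss 1 univ = ∫⁻ z, ENNReal.ofReal (g z) ∂refMeasure := by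
      rw [cgauss_one_eq, withDensity_apply _ .univ, Measure.restrict_univ]
    rw [← h1]; simp
  have hprod : ∀ z : Fin n → ℂ, Real.exp (-∑ i, ‖z i‖ ^ 2) = ∏ i, g (z i) := fun z => by
    rw [← Finset.sum_neg_distrib, Real.exp_sum]
  refine Measure.pi_eq fun B hB => ?_
  rw [withDensity_apply _ (MeasurableSet.univ_pi hB), Measure.restrict_pi_pi]
  simp only [hprod]
  have hi : Integrable (fun z : Fin n → ℂ => ∏ i, g (z i))
      (Measure.pi fun i => refMeasure.restrict (B i)) :=
    Integrable.fintype_prod fun i => hgi.restrict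
  rw [← ofReal_integral_eq_lintegral_ofReal hi
    (ae_of_all _ fun z => Finset.prod_nonneg fun i _ => (Real.exp_pos _).le),
    integral_fintype_prod_eq_prod (fun _ => g), ENNReal.ofReal_prod_of_nonneg
    fun i _ => integral_nonneg fun z => (Real.exp_pos _).le]
  refine Finset.prod_congr rfl fun i _ => ?_
  rw [ofReal_integral_eq_lintegral_ofReal hgi.restrict (ae_of_all _ fun z => (Real.exp_pos _).le),
    cgauss_one_eq, withDensity_apply _ (hB i)]

/-- The norm of `Fin n → ℂ` is the supremum norm; the transport by `toLp` provides the inner product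
that the general theory requires. -/
lemma isGaussNoise_cgaussEuclid (n : ℕ) :
    IsGaussNoise (refMeasureEuclid n) (cgaussEuclid n) where
  sigmaFinite := MeasurableEquiv.sigmaFinite_map _
  invariant := isAddLeftInvariant_map (μ := Measure.pi fun _ : Fin n => refMeasure)
    (⟨MeasurableEquiv.toLp 2 (Fin n → ℂ), fun _ _ => rfl⟩ :
      (Fin n → ℂ) →ₙ+ EuclideanSpace ℂ (Fin n))
    (MeasurableEquiv.toLp 2 (Fin n → ℂ)).measurable (MeasurableEquiv.toLp 2 (Fin n → ℂ)).surjective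
  density := by
    rw [cgaussEuclid, refMeasureEuclid, cgaussVec_one_eq, ← map_withDensity_comp
      ((MeasurableEquiv.toLp 2 (Fin n → ℂ)).measurable.measurePreserving _) (by fun_prop)]
    congr 2; ext z
    simp [EuclideanSpace.norm_sq_eq]
  prob := Measure.isProbabilityMeasure_map (MeasurableEquiv.measurable _).aemeasurable
  sq := by
    rw [cgaussEuclid, integrable_map_equiv]
    have : (fun z : EuclideanSpace ℂ (Fin n) => ‖z‖ ^ 2) ∘ MeasurableEquiv.toLp 2 (Fin n → ℂ) =
        fun z => ∑ i, ‖z i‖ ^ 2 := by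
      ext z; simp [EuclideanSpace.norm_sq_eq]
    rw [this]
    refine integrable_finsetSum _ fun i _ => ?_
    exact (measurePreserving_eval (fun _ : Fin n => cgauss 1) i).integrable_comp_of_integrable
      (integrable_sq_cgauss 1)

/-! ### The scalar channel -/

section Scalar

variable {PX : Measure ℂ}

/-- The integral of a non-integrable function is 0 by convention, hence not 1. -/
lemma integrable_sq_of_power (hpow : ∫ x, ‖x‖ ^ 2 ∂PX = 1) :
    Integrable (fun x => ‖x‖ ^ 2) PX := by
  by_contra h
  rw [integral_undef h] at hpow
  exact zero_ne_one hpow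

lemma scalarOut_eq (ρ : ℝ) : scalarOut ρ = fun p : ℂ × ℂ => Real.sqrt ρ • p.1 + p.2 := by
  ext p; simp [scalarOut]

lemma measurable_scalarOut (ρ : ℝ) : Measurable (scalarOut ρ) := by
  rw [scalarOut_eq]; fun_prop

instance [IsProbabilityMeasure PX] : IsProbabilityMeasure (scalarLaw PX) := by
  unfold scalarLaw; infer_instance

lemma phiS_eq_mmse [IsProbabilityMeasure PX] (hpow : ∫ x, ‖x‖ ^ 2 ∂PX = 1) (ρ : ℝ) :
    phiS PX ρ = mmse PX (cgauss 1) (Real.sqrt ρ) := by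
  have hP := integrable_sq_of_power hpow
  have h1 := condExp_eq_postAvg (P := PX) isGaussNoise_cgauss (Real.sqrt ρ) (Q := scalarLaw PX)
    (X := Prod.fst) (Y := scalarOut ρ) measurable_fst (measurable_scalarOut ρ)
    (by rw [scalarOut_eq]; rfl) (f := fun x => x) measurable_id.stronglyMeasurable
    (integrable_self_of_sq hP)
  unfold phiS mmse
  refine integral_congr_ae ?_
  filter_upwards [h1] with p hp
  rw [← hp, scalarOut_eq]; rfl

lemma mutualInfo_eq_info [IsProbabilityMeasure PX] (ρ : ℝ) :
    mutualInfo PX ρ = info PX (cgauss 1) (Real.sqrt ρ) := by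
  rw [← toReal_klDiv_eq_info isGaussNoise_cgauss, mutualInfo, scalarOut_eq]
  rfl

variable [IsProbabilityMeasure PX]

lemma phiS_nonneg (hpow : ∫ x, ‖x‖ ^ 2 ∂PX = 1) (ρ : ℝ) : 0 ≤ phiS PX ρ := by
  rw [phiS_eq_mmse hpow]; exact mmse_nonneg _ _ _

lemma phiS_le (hpow : ∫ x, ‖x‖ ^ 2 ∂PX = 1) {ρ : ℝ} (hρ : 0 ≤ ρ) : phiS PX ρ ≤ (1 + ρ)⁻¹ := by
  rw [phiS_eq_mmse hpow]
  have := mmse_le_linear isGaussNoise_cgauss (integrable_sq_of_power hpow) hpow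
    integral_sq_cgauss_one integral_cgauss_one (Real.sqrt ρ)
  rwa [Real.sq_sqrt hρ] at this

lemma continuous_phiS (hpow : ∫ x, ‖x‖ ^ 2 ∂PX = 1) : Continuous (phiS PX) := by
  have h1 : phiS PX = fun ρ => mmse PX (cgauss 1) (Real.sqrt ρ) := funext (phiS_eq_mmse hpow)
  rw [h1]
  exact (continuous_mmse isGaussNoise_cgauss (integrable_sq_of_power hpow)).comp
    Real.continuous_sqrt

lemma phiS_pos_of_pos (hpow : ∫ x, ‖x‖ ^ 2 ∂PX = 1) {ρ₀ : ℝ}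
    (h0 : 0 < phiS PX ρ₀) (ρ : ℝ) : 0 < phiS PX ρ := by
  refine lt_of_le_of_ne (phiS_nonneg hpow ρ) fun h => h0.ne' ?_
  rw [phiS_eq_mmse hpow] at h ⊢
  exact mmse_eq_zero_of_eq_zero isGaussNoise_cgauss (integrable_sq_of_power hpow) h.symm _

lemma mutualInfo_eq_integral (hpow : ∫ x, ‖x‖ ^ 2 ∂PX = 1) {ρ : ℝ} (hρ : 0 ≤ ρ) :
    mutualInfo PX ρ = ∫ r in (0 : ℝ)..ρ, phiS PX r := by
  rw [mutualInfo_eq_info, info_sqrt_eq_integral isGaussNoise_cgauss (integrable_sq_of_power hpow)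
    hρ]
  simp only [phiS_eq_mmse hpow]

end Scalar

end OAMP

namespace OAMP

/-! ### Codes -/

section Code

variable {PX : Measure ℂ} {n : ℕ} {P : Measure (Fin n → ℂ)}

/-- The law of the codeword in the Euclidean space `ℂⁿ`. -/
def euclidLaw (P : Measure (Fin n → ℂ)) : Measure (EuclideanSpace ℂ (Fin n)) :=
  P.map (MeasurableEquiv.toLp 2 (Fin n → ℂ))

instance [IsProbabilityMeasure P] : IsProbabilityMeasure (euclidLaw P) :=
  Measure.isProbabilityMeasure_map (MeasurableEquiv.measurable _).aemeasurable

lemma IsCode.measurePreserving (hP : IsCode PX P) (i : Fin n) :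
    MeasurePreserving (fun x : Fin n → ℂ => x i) P PX :=
  ⟨measurable_pi_apply i, hP.marginal i⟩

lemma IsCode.integrable_sq (hP : IsCode PX P) (hpow : ∫ x, ‖x‖ ^ 2 ∂PX = 1) :
    Integrable (fun x => ‖x‖ ^ 2) (euclidLaw P) := by
  rw [euclidLaw, integrable_map_equiv]
  have : (fun z : EuclideanSpace ℂ (Fin n) => ‖z‖ ^ 2) ∘ MeasurableEquiv.toLp 2 (Fin n → ℂ) =
      fun z => ∑ i, ‖z i‖ ^ 2 := by
    ext z; simp [EuclideanSpace.norm_sq_eq]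
  rw [this]
  exact integrable_finsetSum _ fun i _ =>
    (hP.measurePreserving i).integrable_comp_of_integrable (integrable_sq_of_power hpow)

lemma measurePreserving_toLp_prod [IsProbabilityMeasure P] :
    MeasurePreserving (Prod.map (MeasurableEquiv.toLp 2 (Fin n → ℂ))
      (MeasurableEquiv.toLp 2 (Fin n → ℂ))) (P.prod (cgaussVec n 1))
      ((euclidLaw P).prod (cgaussEuclid n)) :=
  ⟨by fun_prop, (Measure.map_prod_map _ _ (MeasurableEquiv.measurable _)
    (MeasurableEquiv.measurable _)).symm⟩

lemma toLp_obs (s : ℝ) (q : (Fin n → ℂ) × (Fin n → ℂ)) :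
    MeasurableEquiv.toLp 2 (Fin n → ℂ) ((s : ℂ) • q.1 + q.2) =
      s • MeasurableEquiv.toLp 2 (Fin n → ℂ) q.1 + MeasurableEquiv.toLp 2 (Fin n → ℂ) q.2 := by
  ext i; simp

lemma codeMmse_eq (hP : IsCode PX P) (hpow : ∫ x, ‖x‖ ^ 2 ∂PX = 1) (ρ : ℝ) :
    codeMmse P ρ = (1 / (n : ℝ)) * mmse (euclidLaw P) (cgaussEuclid n) (Real.sqrt ρ) := by
  have := hP.prob
  set T := MeasurableEquiv.toLp 2 (Fin n → ℂ)
  set s := Real.sqrt ρ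
  have hmp := measurePreserving_toLp_prod (P := P)
  have hsq := hP.integrable_sq hpow
  have hid := integrable_self_of_sq hsq
  have hG := isGaussNoise_cgaussEuclid n
  set Y : (Fin n → ℂ) × (Fin n → ℂ) → EuclideanSpace ℂ (Fin n) :=
    fun q => T ((s : ℂ) • q.1 + q.2) with hYdef
  have hX : Measurable fun q : (Fin n → ℂ) × (Fin n → ℂ) => T q.1 := by fun_prop
  have hY : Measurable Y := by fun_prop
  have hY2 : ∀ q, Y q = s • T q.1 + T q.2 := toLp_obs s
  -- `T` is a measurable equivalence, so passing to the Euclidean space leaves the σ-algebra of the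
  -- observation unchanged.
  have hcomap : MeasurableSpace.comap Y inferInstance =
      MeasurableSpace.comap (fun q : (Fin n → ℂ) × (Fin n → ℂ) => (s : ℂ) • q.1 + q.2)
        inferInstance := by
    rw [hYdef, ← Function.comp_def T, ← MeasurableSpace.comap_comp]
    congr 1
    exact T.measurableEmbedding.comap_eq
  have hXY : (P.prod (cgaussVec n 1)).map (fun q => (T q.1, Y q)) =
      ((euclidLaw P).prod (cgaussEuclid n)).map fun p => (p.1, s • p.1 + p.2) := by
    rw [← hmp.map_eq, Measure.map_map (by fun_prop) hmp.measurable]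
    congr 1
  have hce : ∀ i, (fun q => (pmean (euclidLaw P) s (Y q)) i) =ᵐ[P.prod (cgaussVec n 1)]
      (P.prod (cgaussVec n 1))[fun q : (Fin n → ℂ) × (Fin n → ℂ) => q.1 i |
        MeasurableSpace.comap (fun q : (Fin n → ℂ) × (Fin n → ℂ) =>
          (s : ℂ) • q.1 + q.2) inferInstance] := fun i => by
    -- Coordinates are continuous real-linear maps and commute with the posterior average; the
    -- entrywise conditional expectations are therefore the coordinates of one posterior mean.
    set Li : EuclideanSpace ℂ (Fin n) →L[ℝ] ℂ := (EuclideanSpace.proj i).restrictScalars ℝ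
    have h1 := condExp_eq_postAvg hG s hX hY hXY (f := fun x => Li x)
      Li.continuous.stronglyMeasurable (Li.integrable_comp hid)
    rw [hcomap] at h1
    refine EventuallyEq.trans (ae_of_all _ fun q => ?_) h1
    exact (postAvg_clm Li hid s (Y q)).symm
  unfold codeMmse
  congr 1
  have hint : ∀ i, Integrable (fun q => ‖q.1 i - (pmean (euclidLaw P) s (Y q)) i‖ ^ 2)
      (P.prod (cgaussVec n 1)) := fun i => by
    have h1 := hmp.integrable_comp_of_integrable (hG.integrable_err hsq s)
    have hpm := (measurable_pmean (P := euclidLaw P) s).comp hY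
    refine h1.mono' ?_ (ae_of_all _ fun q => ?_)
    · have : Measurable fun q => (pmean (euclidLaw P) s (Y q)) i := by
        exact (EuclideanSpace.proj (𝕜 := ℂ) i).continuous.measurable.comp hpm
      exact Measurable.aestronglyMeasurable (by fun_prop)
    · rw [Real.norm_of_nonneg (by positivity), hY2]
      simp only [Function.comp, EuclideanSpace.norm_sq_eq]
      exact Finset.single_le_sum (f := fun j => ‖(T q.1 -
        pmean (euclidLaw P) s (s • T q.1 + T q.2)) j‖ ^ 2) (fun j _ => by positivity)
        (Finset.mem_univ i)
  have h2 : ∀ i, ∫ p, ‖p.1 i - ((P.prod (cgaussVec n 1))[fun q : (Fin n → ℂ) × (Fin n → ℂ) =>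
      q.1 i | MeasurableSpace.comap (fun q : (Fin n → ℂ) × (Fin n → ℂ) =>
        (s : ℂ) • q.1 + q.2) inferInstance]) p‖ ^ 2 ∂(P.prod (cgaussVec n 1)) =
      ∫ q, ‖q.1 i - (pmean (euclidLaw P) s (Y q)) i‖ ^ 2 ∂(P.prod (cgaussVec n 1)) := fun i => by
    refine integral_congr_ae ?_
    filter_upwards [hce i] with q hq
    rw [hq]
  rw [Finset.sum_congr rfl fun i _ => h2 i, ← integral_finsetSum _ fun i _ => hint i, mmse,
    ← hmp.map_eq, integral_map hmp.measurable.aemeasurable]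
  · congr 1; ext q
    rw [EuclideanSpace.norm_sq_eq]
    simp only [hY2]; rfl
  · have := measurable_pmean_obs (P := euclidLaw P) s
    exact Measurable.aestronglyMeasurable (by fun_prop)

lemma codeMmse_nonneg (P : Measure (Fin n → ℂ)) (ρ : ℝ) : 0 ≤ codeMmse P ρ :=
  mul_nonneg (by positivity) (Finset.sum_nonneg fun _ _ => integral_nonneg fun _ => by positivity)

lemma codeMmse_antitoneOn (hP : IsCode PX P) (hpow : ∫ x, ‖x‖ ^ 2 ∂PX = 1) :
    AntitoneOn (codeMmse P) (Ici 0) := by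
  have := hP.prob
  intro a _ b _ hab
  rw [codeMmse_eq hP hpow, codeMmse_eq hP hpow]
  exact mul_le_mul_of_nonneg_left (mmse_antitoneOn (isGaussNoise_cgaussEuclid n)
    (hP.integrable_sq hpow) (Real.sqrt_nonneg a) (Real.sqrt_nonneg b) (Real.sqrt_le_sqrt hab))
    (by positivity)

/-- Decoding jointly is at least as good as estimating every entry from its own observation. -/
lemma codeMmse_le_phiS [IsProbabilityMeasure PX] (hP : IsCode PX P)
    (hpow : ∫ x, ‖x‖ ^ 2 ∂PX = 1) (ρ : ℝ) : codeMmse P ρ ≤ phiS PX ρ := by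
  have := hP.prob
  rcases Nat.eq_zero_or_pos n with rfl | hn
  · have : codeMmse P ρ = 0 := by simp [codeMmse]
    rw [this]; exact phiS_nonneg hpow ρ
  have hn0 : (0 : ℝ) < n := by exact_mod_cast hn
  rw [codeMmse_eq hP hpow, one_div, inv_mul_le_iff₀ hn0]
  set s := Real.sqrt ρ
  set T := MeasurableEquiv.toLp 2 (Fin n → ℂ)
  have hmp := measurePreserving_toLp_prod (P := P)
  have hpm := measurable_pmean (P := PX) s
  -- The competitor applies the scalar posterior mean to each entry. Its error involves only the
  -- laws of the pairs `(x i, z i)`, which are those of the scalar channel however the entries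
  -- depend on one another.
  set g : EuclideanSpace ℂ (Fin n) → EuclideanSpace ℂ (Fin n) :=
    fun y => T fun i => pmean PX s (y i) with hg
  have hgm : Measurable g := by
    refine T.measurable.comp (measurable_pi_lambda _ fun i => hpm.comp ?_)
    exact (EuclideanSpace.proj (𝕜 := ℂ) i).continuous.measurable
  have hi : ∀ i : Fin n, MeasurePreserving (fun q : (Fin n → ℂ) × (Fin n → ℂ) => (q.1 i, q.2 i))
      (P.prod (cgaussVec n 1)) (PX.prod (cgauss 1)) := fun i =>
    (hP.measurePreserving i).prod (measurePreserving_eval (fun _ : Fin n => cgauss 1) i)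
  have herr := isGaussNoise_cgauss.integrable_err (integrable_sq_of_power hpow) s
  have hcomp : ∀ q : (Fin n → ℂ) × (Fin n → ℂ),
      ‖T q.1 - g (s • T q.1 + T q.2)‖ ^ 2 =
        ∑ i, ‖q.1 i - pmean PX s (s • q.1 i + q.2 i)‖ ^ 2 := fun q => by
    rw [EuclideanSpace.norm_sq_eq]; rfl
  have herr2 : ∀ i : Fin n, Integrable (fun q : (Fin n → ℂ) × (Fin n → ℂ) =>
      ‖q.1 i - pmean PX s (s • q.1 i + q.2 i)‖ ^ 2) (P.prod (cgaussVec n 1)) := fun i =>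
    (hi i).integrable_comp_of_integrable herr
  have herr3 : ∀ i : Fin n, ∫ q : (Fin n → ℂ) × (Fin n → ℂ),
      ‖q.1 i - pmean PX s (s • q.1 i + q.2 i)‖ ^ 2 ∂(P.prod (cgaussVec n 1)) = phiS PX ρ := by
    intro i
    have hpo := measurable_pmean_obs (P := PX) s
    rw [phiS_eq_mmse hpow, mmse, ← (hi i).map_eq, integral_map (hi i).measurable.aemeasurable
      (Measurable.aestronglyMeasurable (by fun_prop))]
  have hFm : AEStronglyMeasurable (fun p : EuclideanSpace ℂ (Fin n) × EuclideanSpace ℂ (Fin n) =>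
      ‖p.1 - g (s • p.1 + p.2)‖ ^ 2)
      ((P.prod (cgaussVec n 1)).map (Prod.map T T)) := by
    have : Measurable fun p : EuclideanSpace ℂ (Fin n) × EuclideanSpace ℂ (Fin n) =>
      g (s • p.1 + p.2) := hgm.comp (by fun_prop)
    exact Measurable.aestronglyMeasurable (by fun_prop)
  refine (mmse_le (isGaussNoise_cgaussEuclid n) (hP.integrable_sq hpow) s hgm ?_).trans ?_
  · rw [← hmp.map_eq, integrable_map_measure hFm hmp.measurable.aemeasurable]
    refine (integrable_finsetSum Finset.univ fun i _ => herr2 i).congr (ae_of_all _ fun q => ?_)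
    exact (hcomp q).symm
  · rw [← hmp.map_eq, integral_map hmp.measurable.aemeasurable hFm]
    refine le_of_eq ?_
    calc _ = ∫ q : (Fin n → ℂ) × (Fin n → ℂ),
          ∑ i, ‖q.1 i - pmean PX s (s • q.1 i + q.2 i)‖ ^ 2 ∂(P.prod (cgaussVec n 1)) := by
          congr 1; ext q; exact hcomp q
      _ = _ := by
          rw [integral_finsetSum _ fun i _ => herr2 i]
          rw [Finset.sum_congr rfl fun i _ => herr3 i]; simp

/-! #### Finite codebooks -/

lemma uniformOn_real_singleton {Ω : Type*} [MeasurableSpace Ω] [MeasurableSingletonClass Ω]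
    {C : Finset Ω} {x : Ω} (hx : x ∈ C) :
    (uniformOn (C : Set Ω)).real {x} = (C.card : ℝ)⁻¹ := by
  classical
  have h1 := uniformOn_apply_finset (s := C) (t := {x})
  rw [Finset.coe_singleton, Finset.inter_singleton_of_mem hx] at h1
  rw [measureReal_def, h1]; simp

lemma ae_mem_uniformOn {Ω : Type*} [MeasurableSpace Ω] [MeasurableSingletonClass Ω]
    (C : Finset Ω) : ∀ᵐ x ∂(uniformOn (C : Set Ω)), x ∈ C := by
  rw [uniformOn]
  exact ae_cond_mem C.measurableSet

lemma nonempty_of_uniformOn {Ω : Type*} [MeasurableSpace Ω] {C : Finset Ω}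
    (h : IsProbabilityMeasure (uniformOn (C : Set Ω))) : C.Nonempty := by
  rw [Finset.nonempty_iff_ne_empty]
  rintro rfl
  exact IsProbabilityMeasure.ne_zero (uniformOn ((∅ : Finset Ω) : Set Ω))
    (by rw [Finset.coe_empty, uniformOn_empty_meas])

lemma euclidLaw_real_singleton (P : Measure (Fin n → ℂ)) (x : Fin n → ℂ) :
    (euclidLaw P).real {MeasurableEquiv.toLp 2 (Fin n → ℂ) x} = P.real {x} := by
  rw [measureReal_def, euclidLaw, MeasurableEquiv.map_apply, measureReal_def]
  congr 2; ext z
  simp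

/-- The rate of a finite codebook is the integral of its error. -/
lemma integral_codeMmse_of_uniformOn (hP : IsCode PX P) (hpow : ∫ x, ‖x‖ ^ 2 ∂PX = 1)
    {C : Finset (Fin n → ℂ)} (hC : P = uniformOn (C : Set (Fin n → ℂ))) :
    ∫ ρ in Ioi 0, codeMmse P ρ = Real.log C.card / n := by
  have := hP.prob
  have hCne : C.Nonempty := nonempty_of_uniformOn (hC ▸ hP.prob)
  have hc0 : (0 : ℝ) < (C.card : ℝ)⁻¹ := by
    have := hCne.card_pos; positivity
  have hat : ∀ᵐ x ∂(euclidLaw P), (euclidLaw P).real {x} = (C.card : ℝ)⁻¹ := by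
    rw [euclidLaw, (MeasurableEquiv.measurableEmbedding _).ae_map_iff, ← euclidLaw]
    have h1 := ae_mem_uniformOn C
    rw [← hC] at h1
    filter_upwards [h1] with x hx
    rw [euclidLaw_real_singleton, hC, uniformOn_real_singleton hx]
  have h1 := (integrableOn_mmse_and_integral (isGaussNoise_cgaussEuclid n)
    (hP.integrable_sq hpow) hc0 (hat.mono fun x hx => hx.ge)).2
  simp only [codeMmse_eq hP hpow]
  rw [integral_const_mul, h1]
  have h2 : ∫ x, -Real.log ((euclidLaw P).real {x}) ∂(euclidLaw P) = Real.log C.card := by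
    rw [integral_congr_ae (g := fun _ => Real.log C.card)]
    · simp
    · filter_upwards [hat] with x hx
      rw [hx, Real.log_inv, neg_neg]
  rw [h2]; ring

/-- The entries of a finite codebook have finitely many values. -/
lemma integrableOn_phiS_of_uniformOn [IsProbabilityMeasure PX] (hP : IsCode PX P)
    (hpow : ∫ x, ‖x‖ ^ 2 ∂PX = 1) (hn : 0 < n)
    {C : Finset (Fin n → ℂ)} (hC : P = uniformOn (C : Set (Fin n → ℂ))) :
    IntegrableOn (phiS PX) (Ioi 0) := by
  classical
  have := hP.prob
  have hCne : C.Nonempty := nonempty_of_uniformOn (hC ▸ hP.prob)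
  have hc0 : (0 : ℝ) < (C.card : ℝ)⁻¹ := by
    have := hCne.card_pos; positivity
  let i : Fin n := ⟨0, hn⟩
  have hmp := hP.measurePreserving i
  have h1 : ∀ᵐ a ∂PX, a ∈ C.image fun x => x i := by
    rw [← hmp.map_eq, ae_map_iff hmp.measurable.aemeasurable
      (by exact (C.image fun x => x i).measurableSet)]
    have h1 := ae_mem_uniformOn C
    rw [← hC] at h1
    filter_upwards [h1] with x hx using Finset.mem_image_of_mem _ hx
  -- The mass of a value is at least that of any single codeword showing it in position `i`.
  have hat : ∀ᵐ a ∂PX, (C.card : ℝ)⁻¹ ≤ PX.real {a} := by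
    filter_upwards [h1] with a ha
    obtain ⟨x, hx, rfl⟩ := Finset.mem_image.1 ha
    rw [← uniformOn_real_singleton hx, ← hC, ← hmp.map_eq,
      map_measureReal_apply hmp.measurable (measurableSet_singleton _)]
    exact measureReal_mono (by simp)
  have h2 := (integrableOn_mmse_and_integral isGaussNoise_cgauss (integrable_sq_of_power hpow)
    hc0 hat).1
  simpa only [← phiS_eq_mmse hpow] using h2

end Code

/-! ### Transfer functions of code families -/

section Family

variable {PX : Measure ℂ} [IsProbabilityMeasure PX]
  {N : ℕ → ℕ} {P : ∀ j, Measure (Fin (N j) → ℂ)} {φ : ℝ → ℝ}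

lemma transfer_antitoneOn (hpow : ∫ x, ‖x‖ ^ 2 ∂PX = 1) (hP : ∀ j, IsCode PX (P j))
    (hφ : ∀ ρ, 0 ≤ ρ → Tendsto (fun j => codeMmse (P j) ρ) atTop (𝓝 (φ ρ))) :
    AntitoneOn φ (Ici 0) := fun _ ha _ hb hab =>
  le_of_tendsto_of_tendsto' (hφ _ hb) (hφ _ ha)
    fun j => codeMmse_antitoneOn (hP j) hpow ha hb hab

lemma transfer_nonneg
    (hφ : ∀ ρ, 0 ≤ ρ → Tendsto (fun j => codeMmse (P j) ρ) atTop (𝓝 (φ ρ)))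
    {ρ : ℝ} (hρ : 0 ≤ ρ) : 0 ≤ φ ρ :=
  ge_of_tendsto' (hφ ρ hρ) fun j => codeMmse_nonneg (P j) ρ

/-- The rates of finite codebooks tend to the area below the transfer curve. -/
lemma tendsto_codeRate (hpow : ∫ x, ‖x‖ ^ 2 ∂PX = 1) (hP : ∀ j, IsCode PX (P j))
    (hN : Tendsto N atTop atTop)
    (hφ : ∀ ρ, 0 ≤ ρ → Tendsto (fun j => codeMmse (P j) ρ) atTop (𝓝 (φ ρ)))
    (C : ∀ j, Finset (Fin (N j) → ℂ)) (hC : ∀ j, P j = uniformOn (C j : Set (Fin (N j) → ℂ))) :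
    Tendsto (fun j => Real.log (C j).card / (N j : ℝ)) atTop (𝓝 (oampRate φ)) := by
  -- A single codebook of positive length shows that `PX` has finitely many values, so that `phiS
  -- PX` is integrable and dominates the errors of all the codes.
  obtain ⟨j₀, hj₀⟩ := (hN.eventually_gt_atTop 0).exists
  have hint := integrableOn_phiS_of_uniformOn (hP j₀) hpow hj₀ (hC j₀)
  simp only [← integral_codeMmse_of_uniformOn (hP _) hpow (hC _)]
  refine tendsto_integral_filter_of_dominated_convergence (phiS PX)
    (Eventually.of_forall fun j => ?_) (Eventually.of_forall fun j => ?_) hint ?_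
  · have := (hP j).prob
    have hc := continuous_mmse (isGaussNoise_cgaussEuclid (N j)) ((hP j).integrable_sq hpow)
    rw [show codeMmse (P j) = _ from funext (codeMmse_eq (hP j) hpow)]
    exact Continuous.aestronglyMeasurable (by fun_prop)
  · refine ae_of_all _ fun ρ => ?_
    rw [Real.norm_of_nonneg (codeMmse_nonneg _ _)]
    exact codeMmse_le_phiS (hP j) hpow ρ
  · filter_upwards [ae_restrict_mem measurableSet_Ioi] with ρ hρ
    exact hφ ρ (le_of_lt hρ)

end Family

end OAMP

namespace OAMP

/-! ### The linear estimator -/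

/-- `μ` is a probability law on `[0, ∞)` with mean one. -/
structure IsSpectrum (μ : Measure ℝ) : Prop where
  prob : IsProbabilityMeasure μ
  nonneg : ∀ᵐ l ∂μ, 0 ≤ l
  mean : ∫ l, l ∂μ = 1

section Spectrum

variable {μ : Measure ℝ} {snr : ℝ}

lemma IsSpectrum.integrable (hμ : IsSpectrum μ) : Integrable (fun l => l) μ := by
  by_contra h
  have := hμ.mean
  rw [integral_undef h] at this
  exact zero_ne_one this

lemma IsSpectrum.ae_pos_le (hμ : IsSpectrum μ) (hs : 0 < snr) {v : ℝ} (hv : 0 < v) :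
    ∀ᵐ l ∂μ, 0 < (snr * l + v⁻¹)⁻¹ ∧ (snr * l + v⁻¹)⁻¹ ≤ v := by
  filter_upwards [hμ.nonneg] with l hl
  have h1 : 0 < v⁻¹ := inv_pos.2 hv
  have h2 : v⁻¹ ≤ snr * l + v⁻¹ := by nlinarith
  exact ⟨inv_pos.2 (h1.trans_le h2), by simpa using inv_anti₀ h1 h2⟩

lemma IsSpectrum.integrable_gamma (hμ : IsSpectrum μ) (hs : 0 < snr) {v : ℝ} (hv : 0 < v) :
    Integrable (fun l => (snr * l + v⁻¹)⁻¹) μ := by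
  have := hμ.prob
  refine (integrable_const v).mono' (by fun_prop) ?_
  filter_upwards [hμ.ae_pos_le hs hv] with l hl
  rw [Real.norm_of_nonneg hl.1.le]; exact hl.2

lemma IsSpectrum.integrable_denom (hμ : IsSpectrum μ) (snr v : ℝ) :
    Integrable (fun l => snr * l + v⁻¹) μ :=
  have := hμ.prob
  (hμ.integrable.const_mul snr).add (integrable_const _)

lemma IsSpectrum.integral_denom (hμ : IsSpectrum μ) (snr v : ℝ) :
    ∫ l, (snr * l + v⁻¹) ∂μ = snr + v⁻¹ := by
  have := hμ.prob
  rw [integral_add (hμ.integrable.const_mul snr) (integrable_const _), integral_const_mul, hμ.mean]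
  simp

lemma gammaHat_pos (hμ : IsSpectrum μ) (hs : 0 < snr) {v : ℝ} (hv : 0 < v) :
    0 < gammaHat μ snr v := by
  have := hμ.prob
  rw [gammaHat, integral_pos_iff_support_of_nonneg_ae
    ((hμ.ae_pos_le hs hv).mono fun l hl => hl.1.le) (hμ.integrable_gamma hs hv)]
  have : Function.support (fun l => (snr * l + v⁻¹)⁻¹) =ᵐ[μ] univ := by
    rw [eventuallyEq_univ]
    filter_upwards [hμ.ae_pos_le hs hv] with l hl using hl.1.ne'
  rw [measure_congr this]; simp

/-- Equality would force l = 0 almost surely, against mean one. -/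
lemma gammaHat_lt (hμ : IsSpectrum μ) (hs : 0 < snr) {v : ℝ} (hv : 0 < v) :
    gammaHat μ snr v < v := by
  have := hμ.prob
  have hle : gammaHat μ snr v ≤ v := by
    have := integral_mono_ae (hμ.integrable_gamma hs hv) (integrable_const v)
      ((hμ.ae_pos_le hs hv).mono fun l hl => hl.2)
    simpa [gammaHat] using this
  refine lt_of_le_of_ne hle fun h => ?_
  have h1 : ∫ l, (v - (snr * l + v⁻¹)⁻¹) ∂μ = 0 := by
    rw [integral_sub (integrable_const v) (hμ.integrable_gamma hs hv), ← gammaHat, h]; simp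
  rw [integral_eq_zero_iff_of_nonneg_ae
    ((hμ.ae_pos_le hs hv).mono fun l hl => sub_nonneg.2 hl.2)
    ((integrable_const v).sub (hμ.integrable_gamma hs hv))] at h1
  have h2 : ∫ l, l ∂μ = 0 := by
    refine integral_eq_zero_of_ae ?_
    filter_upwards [h1] with l hl
    have h3 : (snr * l + v⁻¹)⁻¹ = v := (sub_eq_zero.1 hl).symm
    have h4 : snr * l + v⁻¹ = v⁻¹ := inv_eq_iff_eq_inv.1 h3
    have h5 : snr * l = 0 := by linarith
    exact (mul_eq_zero.1 h5).resolve_left hs.ne'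
  rw [hμ.mean] at h2
  exact one_ne_zero h2

lemma gammaSE_of_pos {v : ℝ} (hv : 0 < v) : gammaSE μ snr v = (gammaHat μ snr v)⁻¹ - v⁻¹ :=
  if_neg hv.ne'

lemma inv_gammaHat {v : ℝ} (hv : 0 < v) : (gammaHat μ snr v)⁻¹ = gammaSE μ snr v + v⁻¹ := by
  rw [gammaSE_of_pos hv]; ring

lemma gammaHat_eq {v : ℝ} (hv : 0 < v) : gammaHat μ snr v = (gammaSE μ snr v + v⁻¹)⁻¹ := by
  rw [← inv_gammaHat hv, inv_inv]

lemma gammaSE_pos (hμ : IsSpectrum μ) (hs : 0 < snr) {v : ℝ} (hv : 0 < v) :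
    0 < gammaSE μ snr v := by
  rw [gammaSE_of_pos hv, sub_pos]
  exact inv_strictAnti₀ (gammaHat_pos hμ hs hv) (gammaHat_lt hμ hs hv)

/-- Put δ = 1/v - 1/w ≥ 0. If f is the integrand at `w`, the one at `v` is f/(1 + δf), a concave
function of f. Jensen gives γ̂(v) ≤ c/(1 + δc) with c = γ̂(w), and taking inverses gives 1/γ̂(v) ≥
1/c + δ. -/
lemma gammaSE_antitoneOn (hμ : IsSpectrum μ) (hs : 0 < snr) :
    AntitoneOn (gammaSE μ snr) (Ioi 0) := by
  intro v hv w hw hvw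
  have hv : 0 < v := hv
  have hw : 0 < w := hw
  have := hμ.prob
  set δ := v⁻¹ - w⁻¹ with hδdef
  have hδ : 0 ≤ δ := sub_nonneg.2 (inv_anti₀ hv hvw)
  set c := gammaHat μ snr w with hc
  have hc0 : 0 < c := gammaHat_pos hμ hs hw
  have hk : 0 < 1 + δ * c := by positivity
  have hi := hμ.integrable_gamma hs hw
  have h1 : gammaHat μ snr v ≤ c / (1 + δ * c) := by
    -- Jensen's inequality through the tangent of f ↦ f/(1 + δf) at f = c; the gap is the explicit
    -- square in `e2`.
    have h2 : gammaHat μ snr v ≤ ∫ l, (c / (1 + δ * c) +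
        ((1 + δ * c) ^ 2)⁻¹ * ((snr * l + w⁻¹)⁻¹ - c)) ∂μ := by
      refine integral_mono_ae (hμ.integrable_gamma hs hv)
        ((integrable_const _).add ((hi.sub (integrable_const c)).const_mul _)) ?_
      filter_upwards [hμ.ae_pos_le hs hw] with l hl
      set f := (snr * l + w⁻¹)⁻¹ with hf
      have hf0 : 0 < f := hl.1
      have hkf : 0 < 1 + δ * f := by positivity
      have e1 : (snr * l + v⁻¹)⁻¹ = f / (1 + δ * f) := by
        have : snr * l + v⁻¹ = f⁻¹ + δ := by rw [hf, inv_inv]; ring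
        rw [this]; field_simp
      have e2 : c / (1 + δ * c) + ((1 + δ * c) ^ 2)⁻¹ * (f - c) - f / (1 + δ * f) =
          (f - c) ^ 2 * δ / ((1 + δ * c) ^ 2 * (1 + δ * f)) := by
        field_simp; ring
      have e3 : 0 ≤ (f - c) ^ 2 * δ / ((1 + δ * c) ^ 2 * (1 + δ * f)) := by positivity
      rw [e1]; linarith
    refine h2.trans (le_of_eq ?_)
    have i2 : Integrable (fun l => ((1 + δ * c) ^ 2)⁻¹ * ((snr * l + w⁻¹)⁻¹ - c)) μ :=
      (hi.sub (integrable_const c)).const_mul _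
    rw [integral_add (integrable_const _) i2,
      integral_const_mul, integral_sub hi (integrable_const c), ← gammaHat, ← hc]
    simp
  have h3 := inv_anti₀ (gammaHat_pos hμ hs hv) h1
  have h4 : (c / (1 + δ * c))⁻¹ = c⁻¹ + δ := by field_simp
  rw [gammaSE_of_pos hv, gammaSE_of_pos hw]
  linarith

/-- The gap between 1/a and its tangent at b. With b the mean of the denominators, nonnegativity
gives Jensen for `gammaSE_le`, and the square decides the case of equality. -/
lemma tangent_inv {a b : ℝ} (ha : 0 < a) (hb : 0 < b) :
    a⁻¹ - (2 * b⁻¹ - (b ^ 2)⁻¹ * a) = (a - b) ^ 2 / (a * b ^ 2) := by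
  field_simp; ring

lemma integral_tangent (hμ : IsSpectrum μ) (hs : 0 < snr) {v : ℝ} (hv : 0 < v) :
    Integrable (fun l => (snr * l + v⁻¹)⁻¹ -
      (2 * (snr + v⁻¹)⁻¹ - ((snr + v⁻¹) ^ 2)⁻¹ * (snr * l + v⁻¹))) μ ∧
    ∫ l, ((snr * l + v⁻¹)⁻¹ -
      (2 * (snr + v⁻¹)⁻¹ - ((snr + v⁻¹) ^ 2)⁻¹ * (snr * l + v⁻¹))) ∂μ =
      gammaHat μ snr v - (snr + v⁻¹)⁻¹ := by
  have := hμ.prob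
  have hb : 0 < snr + v⁻¹ := by positivity
  have i1 := hμ.integrable_gamma hs hv
  have i2 := (hμ.integrable_denom snr v).const_mul (((snr + v⁻¹) ^ 2)⁻¹)
  have i3 : Integrable (fun l => 2 * (snr + v⁻¹)⁻¹ - ((snr + v⁻¹) ^ 2)⁻¹ * (snr * l + v⁻¹)) μ :=
    (integrable_const _).sub i2
  refine ⟨i1.sub i3, ?_⟩
  rw [integral_sub i1 i3, integral_sub (integrable_const _) i2,
    integral_const_mul (((snr + v⁻¹) ^ 2)⁻¹), hμ.integral_denom, ← gammaHat]
  simp only [integral_const, probReal_univ, one_smul]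
  field_simp
  ring

lemma tangent_nonneg (hμ : IsSpectrum μ) (hs : 0 < snr) {v : ℝ} (hv : 0 < v) :
    ∀ᵐ l ∂μ, 0 ≤ (snr * l + v⁻¹)⁻¹ -
      (2 * (snr + v⁻¹)⁻¹ - ((snr + v⁻¹) ^ 2)⁻¹ * (snr * l + v⁻¹)) := by
  filter_upwards [hμ.nonneg] with l hl
  have ha : 0 < snr * l + v⁻¹ := by positivity
  rw [tangent_inv ha (by positivity)]
  positivity

lemma gammaSE_le (hμ : IsSpectrum μ) (hs : 0 < snr) {v : ℝ} (hv : 0 < v) :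
    gammaSE μ snr v ≤ snr := by
  have h1 := integral_nonneg_of_ae (tangent_nonneg hμ hs hv)
  rw [(integral_tangent hμ hs hv).2] at h1
  have h2 := inv_anti₀ (show 0 < (snr + v⁻¹)⁻¹ by positivity) (sub_nonneg.1 h1)
  rw [inv_inv] at h2
  rw [gammaSE_of_pos hv]; linarith

/-- `γ_SE` attains its supremum only when the spectrum is a point mass. -/
lemma gammaSE_eq_of_eq (hμ : IsSpectrum μ) (hs : 0 < snr) {v : ℝ} (hv : 0 < v)
    (h : gammaSE μ snr v = snr) {u : ℝ} (hu : 0 < u) : gammaSE μ snr u = snr := by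
  have := hμ.prob
  have h0 : gammaHat μ snr v - (snr + v⁻¹)⁻¹ = 0 := by rw [gammaHat_eq hv, h, sub_self]
  rw [← (integral_tangent hμ hs hv).2, integral_eq_zero_iff_of_nonneg_ae
    (tangent_nonneg hμ hs hv) (integral_tangent hμ hs hv).1] at h0
  have h1 : ∀ᵐ l ∂μ, l = 1 := by
    filter_upwards [h0, hμ.nonneg] with l hl hl0
    have ha : 0 < snr * l + v⁻¹ := by positivity
    rw [tangent_inv ha (by positivity)] at hl
    have hd : (snr * l + v⁻¹) * (snr + v⁻¹) ^ 2 ≠ 0 := by positivity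
    have h2 : (snr * l + v⁻¹ - (snr + v⁻¹)) ^ 2 = 0 := (div_eq_zero_iff.1 hl).resolve_right hd
    have h3 : snr * (l - 1) = 0 := by
      have := pow_eq_zero_iff (two_ne_zero) |>.1 h2; linarith
    linarith [(mul_eq_zero.1 h3).resolve_left hs.ne']
  have h4 : gammaHat μ snr u = (snr + u⁻¹)⁻¹ := by
    rw [gammaHat, integral_congr_ae (g := fun _ => (snr + u⁻¹)⁻¹)]
    · simp
    · filter_upwards [h1] with l hl
      rw [hl, mul_one]
  rw [gammaSE_of_pos hu, h4, inv_inv]; ring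

lemma gammaHat_strictMonoOn (hμ : IsSpectrum μ) (hs : 0 < snr) :
    StrictMonoOn (gammaHat μ snr) (Ioi 0) := by
  intro v hv w hw hvw
  have h1 := gammaSE_antitoneOn hμ hs hv hw hvw.le
  have h2 := inv_strictAnti₀ hv hvw
  rw [gammaHat_eq hv, gammaHat_eq hw]
  have h3 : 0 < w⁻¹ := inv_pos.2 hw
  exact inv_strictAnti₀ (add_pos (gammaSE_pos hμ hs hw) h3) (by linarith)

/-- The integrands f at `v` and g at `w` satisfy f - g = (f/v)(g/w)(v - w) with both factors in [0,
1], so `gammaHat` is 1-Lipschitz. -/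
lemma continuousOn_gammaHat (hμ : IsSpectrum μ) (hs : 0 < snr) :
    ContinuousOn (gammaHat μ snr) (Ioi 0) := by
  have := hμ.prob
  refine LipschitzOnWith.continuousOn (K := 1) (LipschitzOnWith.of_dist_le_mul
    fun v hv w hw => ?_)
  have hv : 0 < v := hv
  have hw : 0 < w := hw
  rw [NNReal.coe_one, one_mul, dist_eq_norm, dist_eq_norm, gammaHat, gammaHat,
    ← integral_sub (hμ.integrable_gamma hs hv) (hμ.integrable_gamma hs hw)]
  have h1 := norm_integral_le_of_norm_le_const (μ := μ) (C := ‖v - w‖)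
    (f := fun l => (snr * l + v⁻¹)⁻¹ - (snr * l + w⁻¹)⁻¹) ?_
  · simpa using h1
  filter_upwards [hμ.ae_pos_le hs hv, hμ.ae_pos_le hs hw] with l hl hl'
  set f := (snr * l + v⁻¹)⁻¹ with hf
  set g := (snr * l + w⁻¹)⁻¹ with hg
  have hf0 := hl.1
  have hg0 := hl'.1
  have e1 : f⁻¹ - g⁻¹ = v⁻¹ - w⁻¹ := by rw [hf, hg, inv_inv, inv_inv]; ring
  have e2 : f - g = (f * v⁻¹) * (g * w⁻¹) * (v - w) := by
    have e3 : f - g = f * g * (g⁻¹ - f⁻¹) := by field_simp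
    have e4 : w⁻¹ - v⁻¹ = v⁻¹ * w⁻¹ * (v - w) := by field_simp
    rw [e3, show g⁻¹ - f⁻¹ = w⁻¹ - v⁻¹ by linarith, e4]; ring
  have b1 : f * v⁻¹ ≤ 1 := by rw [← div_eq_mul_inv, div_le_one hv]; exact hl.2
  have b2 : g * w⁻¹ ≤ 1 := by rw [← div_eq_mul_inv, div_le_one hw]; exact hl'.2
  have p1 : 0 ≤ f * v⁻¹ := by positivity
  have p2 : 0 ≤ g * w⁻¹ := by positivity
  rw [e2, norm_mul, Real.norm_of_nonneg (mul_nonneg p1 p2)]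
  exact mul_le_of_le_one_left (norm_nonneg _) (mul_le_one₀ b1 p2 b2)

lemma continuousOn_gammaSE (hμ : IsSpectrum μ) (hs : 0 < snr) :
    ContinuousOn (gammaSE μ snr) (Ioi 0) := by
  have h1 : ContinuousOn (fun v => (gammaHat μ snr v)⁻¹ - v⁻¹) (Ioi 0) :=
    ((continuousOn_gammaHat hμ hs).inv₀ fun v hv => (gammaHat_pos hμ hs hv).ne').sub
      (continuousOn_id.inv₀ fun v hv => (show (0 : ℝ) < v from hv).ne')
  exact h1.congr fun v hv => gammaSE_of_pos hv

/-- The range reaches down to 0: since γ̂(u) < u, the value `u` lies between two attained ones. -/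
lemma mem_gammaRange_of_le (hμ : IsSpectrum μ) (hs : 0 < snr) {u v : ℝ}
    (hv : v ∈ gammaRange μ snr) (hu : 0 < u) (huv : u ≤ v) : u ∈ gammaRange μ snr := by
  obtain ⟨w, hw, rfl⟩ := hv
  exact isPreconnected_Ioi.intermediate_value (mem_Ioi.2 hu) hw (continuousOn_gammaHat hμ hs)
    ⟨(gammaHat_lt hμ hs hu).le, huv⟩

lemma pos_of_mem_gammaRange (hμ : IsSpectrum μ) (hs : 0 < snr) {v : ℝ}
    (hv : v ∈ gammaRange μ snr) : 0 < v := by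
  obtain ⟨w, hw, rfl⟩ := hv
  exact gammaHat_pos hμ hs hw

lemma gammaHatInv_gammaHat (hμ : IsSpectrum μ) (hs : 0 < snr) {w : ℝ} (hw : 0 < w) :
    gammaHatInv μ snr (gammaHat μ snr w) = w :=
  (gammaHat_strictMonoOn hμ hs).injOn.leftInvOn_invFunOn hw

/-- The parametrization v = γ̂(w) turns η into γ; the properties of η are all obtained through it.
-/
lemma etaSE_gammaHat (hμ : IsSpectrum μ) (hs : 0 < snr) {w : ℝ} (hw : 0 < w) :
    etaSE μ snr (gammaHat μ snr w) = gammaSE μ snr w := by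
  rw [etaSE, gammaHatInv_gammaHat hμ hs hw, gammaSE_of_pos hw]

lemma etaSE_antitoneOn (hμ : IsSpectrum μ) (hs : 0 < snr) :
    AntitoneOn (etaSE μ snr) (gammaRange μ snr) := by
  rintro _ ⟨v, hv, rfl⟩ _ ⟨w, hw, rfl⟩ h
  rw [etaSE_gammaHat hμ hs hv, etaSE_gammaHat hμ hs hw]
  exact gammaSE_antitoneOn hμ hs hv hw (((gammaHat_strictMonoOn hμ hs).le_iff_le hv hw).1 h)

lemma etaSE_le (hμ : IsSpectrum μ) (hs : 0 < snr) {v : ℝ} (hv : v ∈ gammaRange μ snr) :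
    etaSE μ snr v ≤ snr := by
  obtain ⟨w, hw, rfl⟩ := hv
  rw [etaSE_gammaHat hμ hs hw]
  exact gammaSE_le hμ hs hw

/-! #### The inverse of `η_SE` -/

lemma etaInv_le {ρ v : ℝ} (hv : v ∈ gammaRange μ snr) (h : etaSE μ snr v ≤ ρ) :
    etaInv μ snr ρ ≤ ENNReal.ofReal v :=
  iInf₂_le v ⟨hv, h⟩

lemma etaInv_antitone : Antitone (etaInv μ snr) := fun _ _ h =>
  le_iInf₂ fun _ hv => etaInv_le hv.1 (hv.2.trans h)

lemma etaInv_le_gammaHat (hμ : IsSpectrum μ) (hs : 0 < snr) {ρ w : ℝ} (hw : 0 < w)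
    (h : gammaSE μ snr w ≤ ρ) : etaInv μ snr ρ ≤ ENNReal.ofReal (gammaHat μ snr w) :=
  etaInv_le ⟨w, hw, rfl⟩ (by rwa [etaSE_gammaHat hμ hs hw])

/-- Since γ never exceeds `snr`, the arbitrarily small values γ̂(ε) all enter the infimum. -/
lemma etaInv_eq_zero (hμ : IsSpectrum μ) (hs : 0 < snr) {ρ : ℝ} (hρ : snr ≤ ρ) :
    etaInv μ snr ρ = 0 := by
  refine le_antisymm (ENNReal.le_of_forall_pos_le_add fun ε hε _ => ?_) bot_le
  rw [zero_add]
  have hε' : (0 : ℝ) < ε := hε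
  refine (etaInv_le_gammaHat hμ hs hε' ((gammaSE_le hμ hs hε').trans hρ)).trans ?_
  rw [← ENNReal.ofReal_coe_nnreal]
  exact ENNReal.ofReal_le_ofReal (gammaHat_lt hμ hs hε').le

/-! #### The R-transform -/

/-- The substitution z = -1/(snr w) maps (0, ∞) onto the negative half-line and identifies the two
inverse functions. -/
lemma stieltjes_eq (hs : 0 < snr) {w : ℝ} (hw : 0 < w) :
    stieltjes μ (-(snr * w)⁻¹) = snr * gammaHat μ snr w := by
  rw [stieltjes, gammaHat, ← integral_const_mul]
  congr 1; ext l
  have h1 : snr * l + w⁻¹ = snr * (l + (snr * w)⁻¹) := by field_simp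
  rw [sub_neg_eq_add, h1, mul_inv snr (l + _), mul_inv_cancel_left₀ hs.ne']

lemma stieltjes_eq_of_neg (hs : 0 < snr) {z : ℝ} (hz : z < 0) :
    stieltjes μ z = snr * gammaHat μ snr (-(snr * z)⁻¹) := by
  have h1 : 0 < -(snr * z)⁻¹ := by
    rw [Left.neg_pos_iff, inv_lt_zero]; exact mul_neg_of_pos_of_neg hs hz
  rw [← stieltjes_eq hs h1]
  congr 1
  field_simp

lemma neg_inv_pos_of_neg (hs : 0 < snr) {z : ℝ} (hz : z < 0) : 0 < -(snr * z)⁻¹ := by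
  rw [Left.neg_pos_iff, inv_lt_zero]; exact mul_neg_of_pos_of_neg hs hz

lemma stieltjes_injOn (hμ : IsSpectrum μ) (hs : 0 < snr) : InjOn (stieltjes μ) (Iio 0) := by
  intro a ha b hb h
  rw [stieltjes_eq_of_neg hs ha, stieltjes_eq_of_neg hs hb] at h
  have h1 := (gammaHat_strictMonoOn hμ hs).injOn (neg_inv_pos_of_neg hs ha)
    (neg_inv_pos_of_neg hs hb) (mul_left_cancel₀ hs.ne' h)
  exact mul_left_cancel₀ hs.ne' (inv_injective (neg_injective h1))

lemma mem_stieltjes_image_iff (hs : 0 < snr) {v : ℝ} :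
    snr * v ∈ stieltjes μ '' Iio 0 ↔ v ∈ gammaRange μ snr := by
  constructor
  · rintro ⟨z, hz, h⟩
    rw [stieltjes_eq_of_neg hs hz] at h
    exact ⟨_, neg_inv_pos_of_neg hs hz, mul_left_cancel₀ hs.ne' h⟩
  · rintro ⟨w, hw, rfl⟩
    have hw : 0 < w := hw
    exact ⟨-(snr * w)⁻¹, by rw [mem_Iio, Left.neg_neg_iff]; positivity, stieltjes_eq hs hw⟩

/-- For v = γ̂(w) the inverse Stieltjes transform at snr v is -1/(snr w), so snr R(-snr v) = 1/v -
1/w. -/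
lemma snr_mul_rTransform (hμ : IsSpectrum μ) (hs : 0 < snr) {v : ℝ}
    (hv : v ∈ gammaRange μ snr) : snr * rTransform μ (-(snr * v)) = etaSE μ snr v := by
  obtain ⟨w, hw, rfl⟩ := hv
  have hw : 0 < w := hw
  have hz : -(snr * w)⁻¹ ∈ Iio (0 : ℝ) := by rw [mem_Iio, Left.neg_neg_iff]; positivity
  have h1 := (stieltjes_injOn hμ hs).leftInvOn_invFunOn hz
  rw [stieltjes_eq hs hw] at h1
  have hg := gammaHat_pos hμ hs hw
  rw [rTransform, neg_neg, h1, etaSE_gammaHat hμ hs hw, gammaSE_of_pos hw]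
  field_simp
  ring

lemma isReplicaSolution_iff {PX : Measure ℂ} (hμ : IsSpectrum μ) (hs : 0 < snr) {ρ : ℝ} :
    IsReplicaSolution PX μ snr ρ ↔ IsFixedPoint PX μ snr ρ := by
  unfold IsReplicaSolution IsFixedPoint
  rw [mem_stieltjes_image_iff hs]
  refine and_congr_right fun _ => and_congr_right fun h => ?_
  rw [snr_mul_rTransform hμ hs h, eq_comm]

/-! #### The area below `η_SE` -/

/-- As η decreases, its superlevel set in (0, v] is an interval from 0 to η⁻¹(r), up to endpoints.
Neither continuity nor strict monotonicity of η is used. -/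
lemma volume_lt_etaSE (hμ : IsSpectrum μ) (hs : 0 < snr) {v r : ℝ}
    (hv : v ∈ gammaRange μ snr) (hr : etaSE μ snr v ≤ r) :
    (volume.restrict (Ioc 0 v)).real {u | r < etaSE μ snr u} = (etaInv μ snr r).toReal := by
  have hle := etaInv_le hv hr
  have hv0 := pos_of_mem_gammaRange hμ hs hv
  have htop : etaInv μ snr r ≠ ⊤ := ne_top_of_le_ne_top ENNReal.ofReal_ne_top hle
  set e := (etaInv μ snr r).toReal with he
  have hev : e ≤ v := ENNReal.toReal_le_of_le_ofReal hv0.le hle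
  have he0 : 0 ≤ e := ENNReal.toReal_nonneg
  have h1 : {u | r < etaSE μ snr u} ∩ Ioc 0 v ⊆ Icc 0 e := by
    rintro u ⟨hu, hu0, huv⟩
    refine ⟨hu0.le, le_of_not_gt fun hlt => ?_⟩
    have h2 : etaInv μ snr r < ENNReal.ofReal u := by
      rw [← ENNReal.ofReal_toReal htop]
      exact (ENNReal.ofReal_lt_ofReal_iff hu0).2 hlt
    obtain ⟨x, hx'⟩ := iInf_lt_iff.1 h2
    obtain ⟨hx, hxu⟩ := iInf_lt_iff.1 hx'
    have h3 := (ENNReal.ofReal_lt_ofReal_iff hu0).1 hxu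
    exact absurd (etaSE_antitoneOn hμ hs hx.1 (mem_gammaRange_of_le hμ hs hv hu0 huv) h3.le)
      (not_le.2 (hx.2.trans_lt hu))
  have h2 : Ioo 0 e ⊆ {u | r < etaSE μ snr u} ∩ Ioc 0 v := by
    rintro u ⟨hu0, hue⟩
    have huv := hue.le.trans hev
    refine ⟨show r < etaSE μ snr u from lt_of_not_ge fun hle => ?_, hu0, huv⟩
    have h3 := etaInv_le (mem_gammaRange_of_le hμ hs hv hu0 huv) hle
    exact absurd (ENNReal.toReal_le_of_le_ofReal hu0.le h3) (not_le.2 hue)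
  rw [measureReal_def, Measure.restrict_apply' measurableSet_Ioc, ← measureReal_def]
  refine le_antisymm ?_ ?_
  · refine (measureReal_mono h1 (by simp)).trans (le_of_eq ?_)
    simp [Real.volume_real_Icc_of_le he0]
  · refine le_trans (le_of_eq ?_) (measureReal_mono h2 ?_)
    · simp [Real.volume_real_Ioo_of_le he0]
    · exact ne_top_of_le_ne_top (by simp) (measure_mono h1)

/-- Layer-cake formula for η - η(v) on (0, v]: the superlevel sets have length η⁻¹, which is zero
from `snr` on. -/
lemma integral_etaSE (hμ : IsSpectrum μ) (hs : 0 < snr) {v : ℝ} (hv : v ∈ gammaRange μ snr) :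
    ∫ u in Ioc 0 v, etaSE μ snr u =
      etaSE μ snr v * v + ∫ r in Ioc (etaSE μ snr v) snr, (etaInv μ snr r).toReal := by
  have hv0 := pos_of_mem_gammaRange hμ hs hv
  have hsub : Ioc 0 v ⊆ gammaRange μ snr := fun u hu => mem_gammaRange_of_le hμ hs hv hu.1 hu.2
  have hanti : AntitoneOn (etaSE μ snr) (Ioc 0 v) := (etaSE_antitoneOn hμ hs).mono hsub
  set a := etaSE μ snr v with ha
  have hint : IntegrableOn (etaSE μ snr) (Ioc 0 v) := by
    refine (integrable_const (max |snr| |a|)).mono'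
      (aemeasurable_restrict_of_antitoneOn measurableSet_Ioc hanti).aestronglyMeasurable ?_
    filter_upwards [ae_restrict_mem measurableSet_Ioc] with u hu
    exact (abs_le_max_abs_abs (hanti hu ⟨hv0, le_rfl⟩ hu.2) (etaSE_le hμ hs (hsub hu))).trans
      (le_of_eq (max_comm _ _))
  have hc : IntegrableOn (fun _ : ℝ => a) (Ioc 0 v) := by simp
  have h1 := Integrable.integral_eq_integral_meas_lt (μ := volume.restrict (Ioc 0 v))
    (f := fun u => etaSE μ snr u - a) (hint.sub hc) (by
      filter_upwards [ae_restrict_mem measurableSet_Ioc] with u hu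
      exact sub_nonneg.2 (hanti hu ⟨hv0, le_rfl⟩ hu.2))
  have h2 : ∫ u in Ioc 0 v, (etaSE μ snr u - a) = (∫ u in Ioc 0 v, etaSE μ snr u) - a * v := by
    rw [integral_sub hint hc]
    simp [hv0.le, mul_comm]
  have h3 : ∫ t in Ioi (0 : ℝ), (volume.restrict (Ioc 0 v)).real {u | t < etaSE μ snr u - a} =
      ∫ t in Ioi (0 : ℝ), (etaInv μ snr (a + t)).toReal := by
    refine setIntegral_congr_fun measurableSet_Ioi fun t ht => ?_
    have ht : 0 < t := ht
    simp only [lt_sub_iff_add_lt, add_comm t a]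
    exact volume_lt_etaSE hμ hs hv (by linarith)
  have h4 : ∫ t in Ioi (0 : ℝ), (etaInv μ snr (a + t)).toReal =
      ∫ r in Ioi a, (etaInv μ snr r).toReal := by
    have h5 := (measurePreserving_add_left volume a).setIntegral_preimage_emb
      (measurableEmbedding_addLeft a) (fun r => (etaInv μ snr r).toReal) (Ioi a)
    rw [← h5]
    simp
  have h6 : ∫ r in Ioi a, (etaInv μ snr r).toReal = ∫ r in Ioc a snr, (etaInv μ snr r).toReal := by
    refine setIntegral_eq_of_subset_of_forall_sdiff_eq_zero measurableSet_Ioi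
      Ioc_subset_Ioi_self fun r hr => ?_
    have : snr ≤ r := le_of_not_ge fun h => hr.2 ⟨hr.1, h⟩
    rw [etaInv_eq_zero hμ hs this]; rfl
  linarith

lemma integral_rTransform (hμ : IsSpectrum μ) (hs : 0 < snr) {v : ℝ}
    (hv : v ∈ gammaRange μ snr) :
    ∫ z in (0 : ℝ)..(v * snr), rTransform μ (-z) = ∫ u in Ioc 0 v, etaSE μ snr u := by
  have hv0 := pos_of_mem_gammaRange hμ hs hv
  have h1 := intervalIntegral.smul_integral_comp_mul_left (a := 0) (b := v)
    (fun z => rTransform μ (-z)) snr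
  rw [mul_zero, mul_comm snr v] at h1
  rw [← h1, smul_eq_mul, ← intervalIntegral.integral_const_mul,
    intervalIntegral.integral_of_le hv0.le]
  refine setIntegral_congr_fun measurableSet_Ioc fun u hu => ?_
  exact snr_mul_rTransform hμ hs (mem_gammaRange_of_le hμ hs hv hu.1 hu.2)

end Spectrum

end OAMP

namespace OAMP

/-! ### The matched transfer curve -/

section Matching

variable {PX : Measure ℂ} [IsProbabilityMeasure PX] {μ : Measure ℝ} {snr : ℝ}

/-- The mean squared error of the orthogonalized message after scalar estimation. -/
def orthVar (PX : Measure ℂ) (ρ : ℝ) : ℝ := ((phiS PX ρ)⁻¹ - ρ)⁻¹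

lemma inv_orthVar (ρ : ℝ) : (orthVar PX ρ)⁻¹ = (phiS PX ρ)⁻¹ - ρ := inv_inv _

lemma inv_orthVar_pos (hpow : ∫ x, ‖x‖ ^ 2 ∂PX = 1) (hpos : ∀ ρ, 0 < phiS PX ρ) {ρ : ℝ}
    (hρ : 0 ≤ ρ) : 0 < (phiS PX ρ)⁻¹ - ρ := by
  have h1 := inv_anti₀ (hpos ρ) (phiS_le hpow hρ)
  rw [inv_inv] at h1
  linarith

lemma orthVar_pos (hpow : ∫ x, ‖x‖ ^ 2 ∂PX = 1) (hpos : ∀ ρ, 0 < phiS PX ρ) {ρ : ℝ}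
    (hρ : 0 ≤ ρ) : 0 < orthVar PX ρ :=
  inv_pos.2 (inv_orthVar_pos hpow hpos hρ)

lemma continuousOn_orthVar (hpow : ∫ x, ‖x‖ ^ 2 ∂PX = 1) (hpos : ∀ ρ, 0 < phiS PX ρ) :
    ContinuousOn (orthVar PX) (Ici 0) :=
  (((continuous_phiS hpow).inv₀ fun ρ => (hpos ρ).ne').sub continuous_id).continuousOn.inv₀
    fun _ hρ => (inv_orthVar_pos hpow hpos hρ).ne'

lemma IsFixedPoint.phiS_pos (hpow : ∫ x, ‖x‖ ^ 2 ∂PX = 1) (hμ : IsSpectrum μ) (hs : 0 < snr)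
    {ρ₀ : ℝ} (h : IsFixedPoint PX μ snr ρ₀) (ρ : ℝ) : 0 < phiS PX ρ :=
  phiS_pos_of_pos hpow (pos_of_mem_gammaRange hμ hs h.2.1) ρ

lemma IsFixedPoint.le_snr (hμ : IsSpectrum μ) (hs : 0 < snr)
    {ρ₀ : ℝ} (h : IsFixedPoint PX μ snr ρ₀) : ρ₀ ≤ snr := by
  rw [← h.2.2]; exact etaSE_le hμ hs h.2.1

/-- If φ̂^S(ρ) = γ̂(u) and γ(u) = ρ, then 1/u = 1/φ̂^S(ρ) - ρ, that is, u = `orthVar PX ρ`. Fixed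
points become zeros of a function continuous for all ρ ≥ 0, even where φ̂^S(ρ) is outside the domain
of η. -/
lemma isFixedPoint_iff (hpow : ∫ x, ‖x‖ ^ 2 ∂PX = 1) (hμ : IsSpectrum μ) (hs : 0 < snr)
    (hpos : ∀ ρ, 0 < phiS PX ρ) {ρ : ℝ} (hρ : 0 < ρ) :
    IsFixedPoint PX μ snr ρ ↔ gammaSE μ snr (orthVar PX ρ) = ρ := by
  have hw := orthVar_pos hpow hpos hρ.le
  constructor
  · rintro ⟨-, ⟨u, hu, hv⟩, h⟩
    rw [← hv, etaSE_gammaHat hμ hs hu] at h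
    have h1 := inv_gammaHat (μ := μ) (snr := snr) hu
    have h2 : orthVar PX ρ = u := by
      rw [orthVar, ← hv, h1, h, add_sub_cancel_left, inv_inv]
    rw [h2, h]
  · intro h
    have h1 : gammaHat μ snr (orthVar PX ρ) = phiS PX ρ := by
      rw [gammaHat_eq hw, h, inv_orthVar]; simp
    refine ⟨hρ, ⟨_, hw, h1⟩, ?_⟩
    rw [← h1, etaSE_gammaHat hμ hs hw, h]

/-- The curves cross at the fixed point only. -/
lemma lt_gammaSE_orthVar (hpow : ∫ x, ‖x‖ ^ 2 ∂PX = 1) (hμ : IsSpectrum μ) (hs : 0 < snr)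
    {ρ₀ : ℝ} (h0 : IsFixedPoint PX μ snr ρ₀) (hu : ∀ ρ, IsFixedPoint PX μ snr ρ → ρ = ρ₀)
    {ρ : ℝ} (hρ : ρ ∈ Ioo 0 ρ₀) : ρ < gammaSE μ snr (orthVar PX ρ) := by
  have hpos := h0.phiS_pos hpow hμ hs
  have hc : ContinuousOn (fun ρ => gammaSE μ snr (orthVar PX ρ) - ρ) (Icc 0 ρ) :=
    (((continuousOn_gammaSE hμ hs).comp (continuousOn_orthVar hpow hpos)
      fun r hr => orthVar_pos hpow hpos hr).sub continuousOn_id).mono Icc_subset_Ici_self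
  by_contra! hle
  -- The difference is positive at 0; were it nonpositive at ρ, it would vanish somewhere in (0, ρ],
  -- before ρ₀.
  have hg0 := gammaSE_pos hμ hs (orthVar_pos hpow hpos (le_refl (0 : ℝ)))
  obtain ⟨r, hr, hr2⟩ := intermediate_value_Icc' hρ.1.le hc
    (show (0 : ℝ) ∈ Icc _ _ from ⟨sub_nonpos.2 hle, by simpa using hg0.le⟩)
  have hr3 : gammaSE μ snr (orthVar PX r) = r := sub_eq_zero.1 hr2
  have hr0 : 0 < r := by
    rw [← hr3]; exact gammaSE_pos hμ hs (orthVar_pos hpow hpos hr.1)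
  have := hu r ((isFixedPoint_iff hpow hμ hs hpos hr0).2 hr3)
  linarith [hr.2, hρ.2]

/-- Since γ ≤ `snr`, the difference is nonpositive at ρ + snr; a nonnegative value at ρ would
produce a second fixed point beyond ρ₀. -/
lemma gammaSE_orthVar_lt (hpow : ∫ x, ‖x‖ ^ 2 ∂PX = 1) (hμ : IsSpectrum μ) (hs : 0 < snr)
    {ρ₀ : ℝ} (h0 : IsFixedPoint PX μ snr ρ₀) (hu : ∀ ρ, IsFixedPoint PX μ snr ρ → ρ = ρ₀)
    {ρ : ℝ} (hρ : ρ₀ < ρ) : gammaSE μ snr (orthVar PX ρ) < ρ := by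
  have hpos := h0.phiS_pos hpow hμ hs
  have hρ0 : 0 < ρ := h0.1.trans hρ
  have hc : ContinuousOn (fun ρ => gammaSE μ snr (orthVar PX ρ) - ρ) (Icc ρ (ρ + snr)) :=
    (((continuousOn_gammaSE hμ hs).comp (continuousOn_orthVar hpow hpos)
      fun r hr => orthVar_pos hpow hpos hr).sub continuousOn_id).mono
        fun r hr => hρ0.le.trans hr.1
  by_contra! hle
  have hg := gammaSE_le hμ hs (orthVar_pos hpow hpos (show 0 ≤ ρ + snr by positivity))
  obtain ⟨r, hr, hr2⟩ := intermediate_value_Icc' (by linarith) hc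
    (show (0 : ℝ) ∈ Icc _ _ from ⟨by linarith, sub_nonneg.2 hle⟩)
  have := hu r ((isFixedPoint_iff hpow hμ hs hpos (hρ0.trans_le hr.1)).2 (sub_eq_zero.1 hr2))
  linarith [hr.1]

/-- If γ̂(u) < φ̂^S(ρ) and γ(u) ≤ ρ, then 1/u > 1/φ̂^S(ρ) - ρ, so u is below `orthVar PX ρ`;
monotonicity of γ then gives γ(u) > ρ. -/
lemma ofReal_phiS_le_etaInv (hpow : ∫ x, ‖x‖ ^ 2 ∂PX = 1) (hμ : IsSpectrum μ) (hs : 0 < snr)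
    (hpos : ∀ ρ, 0 < phiS PX ρ) {ρ : ℝ} (hρ : 0 ≤ ρ) (h : ρ < gammaSE μ snr (orthVar PX ρ)) :
    ENNReal.ofReal (phiS PX ρ) ≤ etaInv μ snr ρ := by
  refine le_iInf₂ ?_
  rintro _ ⟨⟨u, hu, rfl⟩, hle⟩
  have hu : 0 < u := hu
  have hw := orthVar_pos hpow hpos hρ
  rw [etaSE_gammaHat hμ hs hu] at hle
  refine ENNReal.ofReal_le_ofReal (le_of_not_gt fun hlt => ?_)
  have h1 := inv_strictAnti₀ (gammaHat_pos hμ hs hu) hlt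
  rw [inv_gammaHat hu] at h1
  have h2 : (orthVar PX ρ)⁻¹ < u⁻¹ := by rw [inv_orthVar]; linarith
  have h3 := (inv_lt_inv₀ hw hu).1 h2
  linarith [gammaSE_antitoneOn hμ hs hu hw h3.le]

/-- The value φ̂^S(ρ) itself enters the infimum: it is at most γ̂(`orthVar PX ρ`), hence equals
γ̂(u) with u ≤ `orthVar PX ρ`, and η there is 1/φ̂^S(ρ) - 1/u ≤ ρ. -/
lemma etaInv_le_ofReal_phiS (hpow : ∫ x, ‖x‖ ^ 2 ∂PX = 1) (hμ : IsSpectrum μ) (hs : 0 < snr)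
    (hpos : ∀ ρ, 0 < phiS PX ρ) {ρ : ℝ} (hρ : 0 ≤ ρ) (h : gammaSE μ snr (orthVar PX ρ) < ρ) :
    etaInv μ snr ρ ≤ ENNReal.ofReal (phiS PX ρ) := by
  have hw := orthVar_pos hpow hpos hρ
  have h1 : phiS PX ρ ≤ gammaHat μ snr (orthVar PX ρ) := by
    rw [gammaHat_eq hw, inv_orthVar]
    refine le_inv_of_le_inv₀ ?_ (by linarith)
    linarith [gammaSE_pos hμ hs hw, inv_orthVar_pos hpow hpos hρ]
  have h2 := mem_gammaRange_of_le hμ hs ⟨_, hw, rfl⟩ (hpos ρ) h1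
  obtain ⟨u, hu, hv⟩ := id h2
  have hu' : 0 < u := hu
  refine etaInv_le h2 ?_
  rw [← hv, etaSE_gammaHat hμ hs hu]
  have h3 : u ≤ orthVar PX ρ := by
    rw [← hv] at h1
    exact ((gammaHat_strictMonoOn hμ hs).le_iff_le hu hw).1 h1
  have h4 := inv_anti₀ hu' h3
  have h5 := inv_gammaHat (μ := μ) (snr := snr) hu
  rw [inv_orthVar] at h4
  rw [hv] at h5
  linarith

lemma phiStar_le_phiS (hpow : ∫ x, ‖x‖ ^ 2 ∂PX = 1) (ρ : ℝ) :
    phiStar PX μ snr ρ ≤ phiS PX ρ :=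
  ENNReal.toReal_le_of_le_ofReal (phiS_nonneg hpow ρ) (min_le_right _ _)

lemma phiStar_of_snr_le (hμ : IsSpectrum μ) (hs : 0 < snr) {ρ : ℝ} (hρ : snr ≤ ρ) :
    phiStar PX μ snr ρ = 0 := by
  simp [phiStar, etaInv_eq_zero hμ hs hρ]

/-- The area below the matched transfer curve is the replica constrained capacity. -/
lemma integral_phiStar (hpow : ∫ x, ‖x‖ ^ 2 ∂PX = 1) (hμ : IsSpectrum μ) (hs : 0 < snr)
    (hfix : ∃! ρ, IsFixedPoint PX μ snr ρ) :
    ∫ ρ in Ioc 0 snr, phiStar PX μ snr ρ = replicaCapacity PX μ snr := by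
  obtain ⟨ρ₀, h0, hu⟩ := hfix
  have hpos := h0.phiS_pos hpow hμ hs
  have hle := h0.le_snr hμ hs
  have hρ : replicaRho PX μ snr = ρ₀ := by
    have h1 : IsReplicaSolution PX μ snr (replicaRho PX μ snr) :=
      Classical.epsilon_spec ⟨ρ₀, (isReplicaSolution_iff hμ hs).2 h0⟩
    exact hu _ ((isReplicaSolution_iff hμ hs).1 h1)
  have e1 : EqOn (phiStar PX μ snr) (phiS PX) (Ioo 0 ρ₀) := fun ρ hρ => by
    rw [phiStar, min_eq_right (ofReal_phiS_le_etaInv hpow hμ hs hpos hρ.1.le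
      (lt_gammaSE_orthVar hpow hμ hs h0 hu hρ)), ENNReal.toReal_ofReal (hpos ρ).le]
  have e2 : EqOn (phiStar PX μ snr) (fun r => (etaInv μ snr r).toReal) (Ioc ρ₀ snr) :=
    fun ρ hρ => by
      simp only
      rw [phiStar, min_eq_left (etaInv_le_ofReal_phiS hpow hμ hs hpos (h0.1.le.trans hρ.1.le)
        (gammaSE_orthVar_lt hpow hμ hs h0 hu hρ.1))]
  have i1 : IntegrableOn (phiStar PX μ snr) (Ioc 0 ρ₀) := by
    rw [integrableOn_Ioc_iff_integrableOn_Ioo, integrableOn_congr_fun e1 measurableSet_Ioo]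
    exact ((continuous_phiS hpow).integrableOn_Icc).mono_set Ioo_subset_Icc_self
  have i2 : IntegrableOn (phiStar PX μ snr) (Ioc ρ₀ snr) := by
    have hanti : AntitoneOn (phiStar PX μ snr) (Ioc ρ₀ snr) := by
      intro a ha b hb hab
      rw [e2 ha, e2 hb]
      refine ENNReal.toReal_mono ?_ (etaInv_antitone hab)
      exact ne_top_of_le_ne_top ENNReal.ofReal_ne_top
        (etaInv_le_ofReal_phiS hpow hμ hs hpos (h0.1.le.trans ha.1.le)
          (gammaSE_orthVar_lt hpow hμ hs h0 hu ha.1))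
    refine (integrable_const (1 : ℝ)).mono'
      (aemeasurable_restrict_of_antitoneOn measurableSet_Ioc hanti).aestronglyMeasurable ?_
    filter_upwards [ae_restrict_mem measurableSet_Ioc] with r hr
    have hr0 : 0 ≤ r := h0.1.le.trans hr.1.le
    rw [Real.norm_of_nonneg (show 0 ≤ phiStar PX μ snr r from ENNReal.toReal_nonneg)]
    refine (phiStar_le_phiS hpow r).trans ((phiS_le hpow hr0).trans ?_)
    exact inv_le_one_of_one_le₀ (by linarith)
  rw [← Ioc_union_Ioc_eq_Ioc h0.1.le hle, setIntegral_union (Ioc_disjoint_Ioc_of_le le_rfl)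
    measurableSet_Ioc i1 i2, integral_Ioc_eq_integral_Ioo,
    setIntegral_congr_fun measurableSet_Ioo e1, setIntegral_congr_fun measurableSet_Ioc e2,
    ← integral_Ioc_eq_integral_Ioo]
  -- At the fixed point η(v*) = ρ*, so the right area is the integral of η minus ρ* v*.
  have h3 := integral_etaSE hμ hs h0.2.1
  rw [h0.2.2] at h3
  simp only [replicaCapacity, hρ]
  rw [integral_rTransform hμ hs h0.2.1, h3, mutualInfo_eq_integral hpow h0.1.le,
    intervalIntegral.integral_of_le h0.1.le]
  ring

/-! ### Rates -/

lemma eq_zero_of_snr_le (hμ : IsSpectrum μ) (hs : 0 < snr) {φ : ℝ → ℝ}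
    (hanti : AntitoneOn φ (Ici 0)) (h0 : ∀ ρ, 0 ≤ ρ → 0 ≤ φ ρ)
    (hle : ∀ ρ ∈ Icc 0 snr, φ ρ ≤ phiStar PX μ snr ρ) {ρ : ℝ} (hρ : snr ≤ ρ) : φ ρ = 0 := by
  have h1 := hle snr ⟨hs.le, le_rfl⟩
  rw [phiStar_of_snr_le hμ hs le_rfl] at h1
  exact le_antisymm ((hanti hs.le (hs.le.trans hρ) hρ).trans h1) (h0 ρ (hs.le.trans hρ))

lemma norm_transfer_le_one (hpow : ∫ x, ‖x‖ ^ 2 ∂PX = 1) {φ : ℝ → ℝ}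
    (h0 : ∀ ρ, 0 ≤ ρ → 0 ≤ φ ρ) (hle : ∀ ρ ∈ Icc 0 snr, φ ρ ≤ phiStar PX μ snr ρ) {ρ : ℝ}
    (hρ : ρ ∈ Icc 0 snr) : ‖φ ρ‖ ≤ 1 := by
  rw [Real.norm_of_nonneg (h0 ρ hρ.1)]
  refine (hle ρ hρ).trans ((phiStar_le_phiS hpow ρ).trans ((phiS_le hpow hρ.1).trans ?_))
  exact inv_le_one_of_one_le₀ (by linarith [hρ.1])

lemma integrableOn_transfer (hpow : ∫ x, ‖x‖ ^ 2 ∂PX = 1) (hμ : IsSpectrum μ) (hs : 0 < snr)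
    {φ : ℝ → ℝ} (hanti : AntitoneOn φ (Ici 0)) (h0 : ∀ ρ, 0 ≤ ρ → 0 ≤ φ ρ)
    (hle : ∀ ρ ∈ Icc 0 snr, φ ρ ≤ phiStar PX μ snr ρ) : IntegrableOn φ (Ioi 0) := by
  have i1 : IntegrableOn φ (Ioc 0 snr) := by
    refine (integrable_const (1 : ℝ)).mono'
      (aemeasurable_restrict_of_antitoneOn measurableSet_Ioc
        (hanti.mono fun r hr => hr.1.le)).aestronglyMeasurable ?_
    filter_upwards [ae_restrict_mem measurableSet_Ioc] with r hr
    exact norm_transfer_le_one hpow h0 hle (Ioc_subset_Icc_self hr)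
  have i2 : IntegrableOn φ (Ioi snr) :=
    (integrableOn_zero (ε' := ℝ)).congr_fun (fun r hr =>
      (eq_zero_of_snr_le hμ hs hanti h0 hle (le_of_lt hr)).symm) measurableSet_Ioi
  rw [← Ioc_union_Ioi_eq_Ioi hs.le]
  exact i1.union i2

lemma oampRate_eq (hμ : IsSpectrum μ) (hs : 0 < snr)
    {φ : ℝ → ℝ} (hanti : AntitoneOn φ (Ici 0)) (h0 : ∀ ρ, 0 ≤ ρ → 0 ≤ φ ρ)
    (hle : ∀ ρ ∈ Icc 0 snr, φ ρ ≤ phiStar PX μ snr ρ) :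
    oampRate φ = ∫ ρ in Ioc 0 snr, φ ρ := by
  refine setIntegral_eq_of_subset_of_forall_sdiff_eq_zero measurableSet_Ioi
    Ioc_subset_Ioi_self fun r hr => ?_
  exact eq_zero_of_snr_le hμ hs hanti h0 hle (le_of_not_ge fun h => hr.2 ⟨hr.1, h⟩)

lemma tendsto_oampRate (hpow : ∫ x, ‖x‖ ^ 2 ∂PX = 1) (hμ : IsSpectrum μ) (hs : 0 < snr)
    (hfix : ∃! ρ, IsFixedPoint PX μ snr ρ) {φ : ℕ → ℝ → ℝ}
    (hanti : ∀ k, AntitoneOn (φ k) (Ici 0)) (h0 : ∀ k ρ, 0 ≤ ρ → 0 ≤ φ k ρ)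
    (hle : ∀ k, ∀ ρ ∈ Icc 0 snr, φ k ρ ≤ phiStar PX μ snr ρ)
    (hconv : ∀ ρ ∈ Icc 0 snr, Tendsto (fun k => φ k ρ) atTop (𝓝 (phiStar PX μ snr ρ))) :
    Tendsto (fun k => oampRate (φ k)) atTop (𝓝 (replicaCapacity PX μ snr)) := by
  rw [← integral_phiStar hpow hμ hs hfix]
  simp only [oampRate_eq hμ hs (hanti _) (h0 _) (hle _)]
  refine tendsto_integral_of_dominated_convergence (fun _ => 1) (fun k => ?_)
    (integrable_const _) (fun k => ?_) ?_
  · exact (aemeasurable_restrict_of_antitoneOn measurableSet_Ioc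
      ((hanti k).mono fun r hr => hr.1.le)).aestronglyMeasurable
  · filter_upwards [ae_restrict_mem measurableSet_Ioc] with r hr
    exact norm_transfer_le_one hpow (h0 k) (hle k) (Ioc_subset_Icc_self hr)
  · filter_upwards [ae_restrict_mem measurableSet_Ioc] with r hr
    exact hconv r (Ioc_subset_Icc_self hr)

/-! ### State evolution -/

/-- The minimum with the finite φ̂^S is never `⊤`, so `toReal` loses nothing even where η⁻¹ is
infinite. -/
lemma ofReal_lt_etaInv_of_lt_phiStar {a ρ : ℝ} (ha : 0 ≤ a) (h : a < phiStar PX μ snr ρ) :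
    ENNReal.ofReal a < etaInv μ snr ρ := by
  have htop : min (etaInv μ snr ρ) (ENNReal.ofReal (phiS PX ρ)) ≠ ⊤ :=
    ne_top_of_le_ne_top ENNReal.ofReal_ne_top (min_le_right _ _)
  have h1 := (ENNReal.ofReal_lt_ofReal_iff (ha.trans_lt h)).2 h
  rw [phiStar, ENNReal.ofReal_toReal htop] at h1
  exact h1.trans_le (min_le_left _ _)

lemma phiOrth_inv {φ : ℝ → ℝ} {ρ : ℝ} (h : φ ρ ≠ 0) : (phiOrth φ ρ)⁻¹ = (φ ρ)⁻¹ - ρ := by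
  rw [phiOrth, inv_div]; field_simp

/-- In one iteration, an input of positive error is improved. -/
lemma phiOrth_gammaSE_lt (hμ : IsSpectrum μ) (hs : 0 < snr) {φ : ℝ → ℝ} {v : ℝ} (hv : 0 < v)
    (hφ0 : 0 < φ (gammaSE μ snr v))
    (hlt : ENNReal.ofReal (φ (gammaSE μ snr v)) < etaInv μ snr (gammaSE μ snr v)) :
    0 < phiOrth φ (gammaSE μ snr v) ∧ phiOrth φ (gammaSE μ snr v) < v := by
  -- γ̂(v) enters the infimum that defines η⁻¹ at ρ = γ(v), so φ(ρ) < γ̂(v); taking inverses and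
  -- subtracting ρ leaves 1/v on the right.
  have h1 := hlt.trans_le (etaInv_le_gammaHat hμ hs hv le_rfl)
  have h2 := (ENNReal.ofReal_lt_ofReal_iff (gammaHat_pos hμ hs hv)).1 h1
  have h3 := inv_strictAnti₀ hφ0 h2
  rw [inv_gammaHat hv] at h3
  have h4 : v⁻¹ < (phiOrth φ (gammaSE μ snr v))⁻¹ := by rw [phiOrth_inv hφ0.ne']; linarith
  have h5 : 0 < phiOrth φ (gammaSE μ snr v) := inv_pos.1 ((inv_pos.2 hv).trans h4)
  exact ⟨h5, (inv_lt_inv₀ hv h5).1 h4⟩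

lemma tendsto_transfer_seRho (hμ : IsSpectrum μ) (hs : 0 < snr)
    {φ : ℝ → ℝ} (hanti : AntitoneOn φ (Ici 0)) (h0 : ∀ ρ, 0 ≤ ρ → 0 ≤ φ ρ)
    (hz : ∀ ρ, snr ≤ ρ → φ ρ = 0)
    (hlt : ∀ ρ ∈ Ioo 0 snr, ENNReal.ofReal (φ ρ) < etaInv μ snr ρ)
    (hleft : ∀ ρ ∈ Ioo 0 snr, ∃ r ∈ Ioo 0 ρ, ENNReal.ofReal (φ r) < etaInv μ snr ρ) :
    Tendsto (fun t => φ (seRho μ snr φ t)) atTop (𝓝 0) := by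
  set v := seInput μ snr φ with hv
  have hρ : ∀ t, seRho μ snr φ t = gammaSE μ snr (v t) := fun t => rfl
  have hsucc : ∀ t, v (t + 1) = phiOrth φ (gammaSE μ snr (v t)) := fun t => rfl
  -- An exact input gives ρ = `snr`, where φ = 0, so zero error is absorbing. Otherwise all iterates
  -- are positive and strictly decrease.
  by_cases hex : ∃ t, v t = 0
  · obtain ⟨t₀, ht₀⟩ := hex
    have hz2 : ∀ t, v t = 0 → φ (seRho μ snr φ t) = 0 := fun t ht => by
      rw [hρ, ht, gammaSE, if_pos rfl]; exact hz snr le_rfl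
    have hz3 : ∀ t ≥ t₀, v t = 0 := fun t ht => by
      induction t, ht using Nat.le_induction with
      | base => exact ht₀
      | succ t _ ih =>
        have := hz2 t ih
        rw [hρ] at this
        rw [hsucc, phiOrth, this, zero_div]
    refine tendsto_const_nhds.congr' ?_
    filter_upwards [eventually_ge_atTop t₀] with t ht
    exact (hz2 t (hz3 t ht)).symm
  push Not at hex
  have hφ : ∀ t, φ (gammaSE μ snr (v t)) ≠ 0 := fun t h => by
    apply hex (t + 1)
    rw [hsucc, phiOrth, h, zero_div]
  have hmem : ∀ t, 0 < v t → gammaSE μ snr (v t) ∈ Ioo 0 snr := fun t ht => by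
    refine ⟨gammaSE_pos hμ hs ht, lt_of_not_ge fun h => hφ t (hz _ h)⟩
  have hφ0 : ∀ t, 0 < v t → 0 < φ (gammaSE μ snr (v t)) := fun t ht =>
    lt_of_le_of_ne (h0 _ (hmem t ht).1.le) (hφ t).symm
  have hstep : ∀ t, 0 < v t → 0 < v (t + 1) ∧ v (t + 1) < v t := fun t ht =>
    phiOrth_gammaSE_lt hμ hs ht (hφ0 t ht) (hlt _ (hmem t ht))
  have hpos : ∀ t, 0 < v t := fun t => by
    induction t with
    | zero => exact one_pos
    | succ t ih => exact (hstep t ih).1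
  have hva : Antitone v := antitone_nat_of_succ_le fun t => (hstep t (hpos t)).2.le
  have hlim := tendsto_atTop_ciInf hva ⟨0, by rintro _ ⟨t, rfl⟩; exact (hpos t).le⟩
  set L := ⨅ t, v t with hL
  have hL0 : 0 ≤ L := ge_of_tendsto' hlim fun t => (hpos t).le
  have hlim1 : Tendsto (fun t => v (t + 1)) atTop (𝓝 L) := (tendsto_add_atTop_iff_nat 1).2 hlim
  have heq : ∀ t, φ (seRho μ snr φ t) = (seRho μ snr φ t + (v (t + 1))⁻¹)⁻¹ := fun t => by
    rw [hsucc, phiOrth_inv (hφ t), hρ, add_sub_cancel, inv_inv]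
  -- If the limit is 0, the decoder error is squeezed, since `heq` bounds it by the next input
  -- error.
  rcases hL0.eq_or_lt with h | hLpos
  · rw [← h] at hlim1
    refine squeeze_zero (fun t => ?_) (fun t => ?_) hlim1
    · exact h0 _ (hmem t (hpos t)).1.le
    · have h1 : 0 < (v (t + 1))⁻¹ := inv_pos.2 (hpos _)
      have h2 := inv_anti₀ h1 (le_add_of_nonneg_left (hmem t (hpos t)).1.le)
      rw [inv_inv] at h2
      rw [heq]; exact h2
  · exfalso
    have hρlim : Tendsto (fun t => seRho μ snr φ t) atTop (𝓝 (gammaSE μ snr L)) :=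
      ((continuousOn_gammaSE hμ hs).continuousAt (Ioi_mem_nhds hLpos)).tendsto.comp hlim
    have hρ0 := gammaSE_pos hμ hs hLpos
    -- Equality would mean a point-mass spectrum, for which γ equals `snr` already at the first
    -- input.
    have hρs : gammaSE μ snr L < snr := by
      refine lt_of_le_of_ne (gammaSE_le hμ hs hLpos) fun h => ?_
      exact (hmem 0 (hpos 0)).2.ne (gammaSE_eq_of_eq hμ hs hLpos h (hpos 0))
    have hφlim : Tendsto (fun t => φ (seRho μ snr φ t)) atTop (𝓝 (gammaHat μ snr L)) := by
      rw [gammaHat_eq hLpos]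
      simp only [heq]
      exact (hρlim.add (hlim1.inv₀ hLpos.ne')).inv₀ (by positivity)
    -- Eventually ρ_t > r, so φ(ρ_t) ≤ φ(r), which lies strictly below γ̂(L), the limit of φ(ρ_t).
    -- Without the hypothesis on left limits, φ could jump down exactly at the limit of the ρ_t.
    obtain ⟨r, hr, hlr⟩ := hleft _ ⟨hρ0, hρs⟩
    have h1 := hlr.trans_le (etaInv_le_gammaHat hμ hs hLpos le_rfl)
    have h2 := (ENNReal.ofReal_lt_ofReal_iff (gammaHat_pos hμ hs hLpos)).1 h1
    refine h2.not_ge (le_of_tendsto hφlim ?_)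
    filter_upwards [hρlim.eventually (lt_mem_nhds hr.2)] with t ht
    exact hanti hr.1.le (hr.1.le.trans ht.le) ht.le

lemma errorFree_of_stateEvolution {N M : ℕ → ℕ} {A : ∀ j, Measure (Fin (M j) → Fin (N j) → ℂ)}
    {P : ∀ j, Measure (Fin (N j) → ℂ)} {φ : ℝ → ℝ} (hSE : StateEvolution μ snr φ N M A P)
    (h : Tendsto (fun t => φ (seRho μ snr φ t)) atTop (𝓝 0)) : ErrorFree snr N M A P := by
  intro ε hε
  obtain ⟨T, hT⟩ := eventually_atTop.1 (h.eventually (gt_mem_nhds hε))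
  exact ⟨T, fun t ht => (hSE t).2.eventually (gt_mem_nhds (hT t ht))⟩

lemma IsLUIS.isSpectrum {N M : ℕ → ℕ} {A : ∀ j, Measure (Fin (M j) → Fin (N j) → ℂ)} {β : ℝ}
    (h : IsLUIS N M A β μ) : IsSpectrum μ :=
  ⟨h.spectrum_prob, h.spectrum_nonneg, h.spectrum_mean⟩

end Matching

end OAMP

end

/-! ### Capacity optimality -/

theorem theorem2
    -- signal distribution, of unit power
    (PX : Measure ℂ) (hPX : IsProbabilityMeasure PX) (hpow : ∫ x, ‖x‖ ^ 2 ∂PX = 1)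
    -- large unitarily invariant system
    (snr : ℝ) (hsnr : 0 < snr) (β : ℝ) (μ : Measure ℝ) (N M : ℕ → ℕ)
    (A : ∀ j, Measure (Fin (M j) → Fin (N j) → ℂ)) (hA : OAMP.IsLUIS N M A β μ)
    -- exactly one fixed point
    (hfix : ∃! ρ, OAMP.IsFixedPoint PX μ snr ρ)
    -- a sequence of code families, with asymptotic MMSE transfer functions `φ k`
    (P : ∀ _ j : ℕ, Measure (Fin (N j) → ℂ)) (hP : ∀ k j, OAMP.IsCode PX (P k j))
    (φ : ℕ → ℝ → ℝ)
    (hφ : ∀ k, ∀ ρ, 0 ≤ ρ → Tendsto (fun j => OAMP.codeMmse (P k j) ρ) atTop (𝓝 (φ k ρ)))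
    -- state evolution is correct for joint OAMP and decoding
    (hSE : ∀ k, OAMP.StateEvolution μ snr (φ k) N M A (P k))
    -- the transfer curves stay below the matched curve and converge to it
    (hle : ∀ k, ∀ ρ ∈ Icc 0 snr, φ k ρ ≤ OAMP.phiStar PX μ snr ρ)
    (hlt : ∀ k, ∀ ρ ∈ Ioo 0 snr, φ k ρ < OAMP.phiStar PX μ snr ρ)
    (hconv : ∀ ρ ∈ Icc 0 snr,
      Tendsto (fun k => φ k ρ) atTop (𝓝 (OAMP.phiStar PX μ snr ρ))) :
    -- the replica capacity is well defined
    (∃! ρ, OAMP.IsReplicaSolution PX μ snr ρ) ∧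
    -- OAMP is error-free (if a curve jumps, also its left limits have to be below `η⁻¹`)
    (∀ k, (∀ ρ ∈ Ioo 0 snr, ∃ r ∈ Ioo 0 ρ,
        ENNReal.ofReal (φ k r) < OAMP.etaInv μ snr ρ) →
      OAMP.ErrorFree snr N M A (P k)) ∧
    -- the rate integral converges, and is the limiting rate of equiprobable finite codebooks
    (∀ k, IntegrableOn (φ k) (Ioi 0) ∧
      ∀ C : ∀ j, Finset (Fin (N j) → ℂ), (∀ j, P k j = uniformOn (C j : Set (Fin (N j) → ℂ))) →
        Tendsto (fun j => Real.log (C j).card / (N j : ℝ)) atTop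
          (𝓝 (OAMP.oampRate (φ k)))) ∧
    -- the achievable rate of OAMP tends to the replica constrained capacity
    Tendsto (fun k => OAMP.oampRate (φ k)) atTop (𝓝 (OAMP.replicaCapacity PX μ snr)) := by
  have hμ := hA.isSpectrum
  have hanti : ∀ k, AntitoneOn (φ k) (Ici 0) :=
    fun k => OAMP.transfer_antitoneOn hpow (hP k) (hφ k)
  have h0 : ∀ k ρ, 0 ≤ ρ → 0 ≤ φ k ρ := fun k ρ hρ => OAMP.transfer_nonneg (hφ k) hρ
  refine ⟨?_, fun k hleft => ?_, fun k => ⟨?_, fun C hC => ?_⟩, ?_⟩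
  · simpa only [OAMP.isReplicaSolution_iff hμ hsnr] using hfix
  · exact OAMP.errorFree_of_stateEvolution (hSE k)
      (OAMP.tendsto_transfer_seRho hμ hsnr (hanti k) (h0 k)
        (fun ρ hρ => OAMP.eq_zero_of_snr_le hμ hsnr (hanti k) (h0 k) (hle k) hρ)
        (fun ρ hρ => OAMP.ofReal_lt_etaInv_of_lt_phiStar (PX := PX) (h0 k ρ hρ.1.le)
          (hlt k ρ hρ)) hleft)
  · exact OAMP.integrableOn_transfer hpow hμ hsnr (hanti k) (h0 k) (hle k)
  · exact OAMP.tendsto_codeRate hpow (hP k) hA.tendsto_N (hφ k) C hC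
  · exact OAMP.tendsto_oampRate hpow hμ hsnr hfix hanti h0 hle hconv
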